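/- **Setting.** Fix $T>0$. An extended distance is a distance with values in $[0,\infty]$. For an extended distance $d$ on $X$, a curve $u:[a,b]\to X$ is absolutely continuous ($u\in AC(a,b;(X,d))$) if there is $m\in L^1(a,b)$ with $d(u(s),u(t))\le\int_s^t m(r)\,dr$ for all $a\le s<t\le b$; then $|\dot u|_d(t)=\lim_{\tau\downarrow0}d(u(t+\tau),u(t))/\tau$ exists for a.e. $t$. A curve $(\mathsf t,\mathsf u):[\alpha,\beta]\to[0,T]\times X$ is a *time-ordered a.c. curve* if both components are absolutely continuous and $\mathsf t$ is nondecreasing. A function on $[0,T]\times X$ is measurable along such curves if its composition with each of them is Lebesgue measurable. An *evolution system* $(X,d,\mathcal E,\mathcal F,\mathcal P)$ consists of a complete extended distance $d$ on $X$, an energy $\mathcal E:[0,T]\times X\to(-\infty,\infty]$, a slope $\mathcal F:[0,T]\times X\to[0,\infty]$ and a power $\mathcal P:[0,T]\times X\times[0,\infty]\to[-\infty,\infty]$ such that $\mathcal E$, $\mathcal F$ and, for every $f\in[0,\infty)$, $\mathcal P(\cdot,\cdot,f)$ are measurable along time-ordered a.c. curves, and $\mathcal P(t,x,\cdot)$ is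 nondecreasing and upper semicontinuous for all $(t,x)$. It is an *upper gradient system* if for every time-ordered a.c. curve $\mathsf q=(\mathsf t,\mathsf u):[\alpha,\beta]\to[0,T]\times X$ and every Lebesgue measurable $F:[\alpha,\beta]\to[0,\infty]$ with $\mathcal E(\mathsf q(\alpha))<\infty$, $F\ge\mathcal F\circ\mathsf q$ on $[\alpha,\beta]$ and $\int_\alpha^\beta[\mathcal P(\mathsf q,F)]_-\,\dot{\mathsf t}\,ds<\infty$, $$\mathcal E(\mathsf q(\alpha))+\int_\alpha^\beta\mathcal P(\mathsf q(s),F(s))\,\dot{\mathsf t}(s)\,ds\le\mathcal E(\mathsf q(\beta))+\int_\alpha^\beta F(s)\,|\dot{\mathsf u}|_d(s)\,ds .$$ A *dissipation function* is a convex $\psi:[0,\infty)\to[0,\infty)$ with $\psi(0)=0$ and $\lim_{v\to\infty}\psi(v)/v\in(0,\infty]$; it is superlinear if this limit is $\infty$; $\psi^*(f)=\sup_{v\ge0}(fv-\psi(v))$. A curve $u\in AC(0,T;(X,d))$ with $\mathcal E(0,u(0))<\infty$ *satisfies the $\psi$-energy-dissipation inequality with* a measurable $F:[0,T]\to[0,\infty]$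 if $F(t)\ge\mathcal F(t,u(t))$ on $[0,T]$, $\int_0^T[\mathcal P(t,u(t),F(t))]_+\,dt<\infty$, and for every $t\in[0,T]$ $$\mathcal E(t,u(t))+\int_0^t\big(\psi(|\dot u|_d(r))+\psi^*(F(r))\big)dr\le\mathcal E(0,u(0))+\int_0^t\mathcal P(r,u(r),F(r))\,dr .$$ If the system is an upper gradient system and such an $F$ exists, $u$ is called a *$\psi$-gradient flow*. **Hypotheses.** Let $X$ be a topological space with topology $\sigma$, let $(X,d_h,\mathcal E_h,\mathcal F_h,\mathcal P_h)$, $h\in\mathbb N$, be evolution systems, let $(X,d,\mathcal E,\mathcal F,\mathcal P)$ be an upper gradient system, and let $\psi_h,\psi$ be dissipation functions with $\psi_h(v)\to\psi(v)$ for every $v\ge0$ and $\psi$ superlinear. Let $\bar u_h\to\bar u$ in $\sigma$. Below, $H$ always denotes an infinite subset of $\mathbb N$, and limits over $h\in H$ are for $h\to\infty$. Assume that there are constants $a,b\ge0$ such that, with $\tilde{\mathcal E}_h(t,x)=\mathcal E_h(t,x)+a\,d_h(x,\bar u_h)+b$: * (C1) $\tilde{\mathcal E}_h\ge0$ on $[0,T]\times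 X$ for every $h$; * (C2) for every $H$, every sequence $(t_h,x_h)_{h\in H}$ in $[0,T]\times X$ with $\sup_{h\in H}\tilde{\mathcal E}_h(t_h,x_h)<\infty$ has a subsequence that converges in $[0,T]\times(X,\sigma)$; * (C3) if $(t^i_h,x^i_h)_{h\in H}$, $i=1,2$, satisfy $\sup_{h\in H}\tilde{\mathcal E}_h(t^i_h,x^i_h)<\infty$ and converge to $(t^i,x^i)$ in $[0,T]\times(X,\sigma)$, then $\liminf_{h\in H}d_h(x^1_h,x^2_h)\ge d(x^1,x^2)$; * (C4) if $t\in[0,T]$, $x_h\to x$ in $\sigma$ along $H$ and $\sup_{h\in H}\tilde{\mathcal E}_h(t,x_h)<\infty$, then $(\mathrm{C4}_E)$ $\liminf_{h\in H}\mathcal E_h(t,x_h)\ge\mathcal E(t,x)$, and $(\mathrm{C4}_{FP})$ whenever $f_h\ge\mathcal F_h(t,x_h)$ and $f_h\to f$ in $[0,\infty)$, then $f\ge\mathcal F(t,x)$ and $\limsup_{h\in H}\mathcal P_h(t,x_h,f_h)\le\mathcal P(t,x,f)$. **Theorem.** Let $H\subset\mathbb N$ be infinite and, for $h\in H$, let $u_h\in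 AC(0,T;(X,d_h))$ with $u_h(0)=\bar u_h$ satisfy the $\psi_h$-energy-dissipation inequality of the $h$-th system with $F_h$. Suppose that $u_h(t)\to u(t)$ in $\sigma$ along $H$ for every $t\in[0,T]$, that $$\lim_{h\in H}\mathcal E_h(0,\bar u_h)=\mathcal E(0,\bar u)<\infty,$$ and that the functions $r\mapsto[\mathcal P_h(r,u_h(r),F_h(r))]_+$, $h\in H$, are equi-integrable in $(0,T)$. Then $u\in AC(0,T;(X,d))$ is a $\psi$-gradient flow of $(X,d,\mathcal E,\mathcal F,\mathcal P)$, and $$\lim_{h\in H}\mathcal E_h(t,u_h(t))=\mathcal E(t,u(t))\qquad\text{for every }t\in[0,T].$$ -/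

import Mathlib

open Set Filter Topology MeasureTheory
open scoped NNReal ENNReal

namespace EvolSys

/-! ### Absolutely continuous curves and metric derivative -/

/-- `u : [a,b] → X` is absolutely continuous for the extended distance `d`: there is a
nonnegative integrable `m` on `(a,b)` with `d (u s) (u t) ≤ ∫_s^t m` for `a ≤ s < t ≤ b`.
Curves are total functions on `ℝ`; only their values on `[a,b]` matter. -/
def IsAC {X : Type*} (d : X → X → ℝ≥0∞) (a b : ℝ) (u : ℝ → X) : Prop :=
  ∃ m : ℝ → ℝ≥0∞, AEMeasurable m (volume.restrict (Ioc a b)) ∧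
    ∫⁻ r in Ioc a b, m r ≠ ∞ ∧
    ∀ s t : ℝ, a ≤ s → s < t → t ≤ b → d (u s) (u t) ≤ ∫⁻ r in Ioc s t, m r

/-- The metric derivative `|u'|_d (t) = lim_{τ ↓ 0} d (u (t+τ)) (u t) / τ`. It is written as an
upper limit so that it is defined everywhere; for an absolutely continuous curve the limit exists
and is finite at almost every `t`. -/
noncomputable def metricDeriv {X : Type*} (d : X → X → ℝ≥0∞) (u : ℝ → X) (t : ℝ) : ℝ≥0∞ :=
  limsup (fun τ : ℝ => d (u (t + τ)) (u t) / ENNReal.ofReal τ) (𝓝[>] (0 : ℝ))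

/-- The integral over `(a,b]` of an extended-real function, as the integral of its positive part
minus that of its negative part (only used when one of the two is finite). -/
noncomputable def erealIntegral (a b : ℝ) (g : ℝ → EReal) : EReal :=
  ((∫⁻ r in Ioc a b, (g r).toENNReal : ℝ≥0∞) : EReal) -
    ((∫⁻ r in Ioc a b, (-g r).toENNReal : ℝ≥0∞) : EReal)

/-- `(𝗍, u) : [α,β] → [0,T] × X` is a time-ordered absolutely continuous curve. -/
structure IsTimeOrdered {X : Type*} (T : ℝ) (d : X → X → ℝ≥0∞) (α β : ℝ)
    (tm : ℝ → ℝ) (u : ℝ → X) : Prop where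
  le : α ≤ β
  mapsTo : MapsTo tm (Icc α β) (Icc 0 T)
  mono : MonotoneOn tm (Icc α β)
  ac_time : IsAC (fun x y : ℝ => edist x y) α β tm
  ac_space : IsAC d α β u

/-- `G` on `[0,T] × X` is (Lebesgue) measurable along time-ordered absolutely continuous
curves. -/
def MeasurableAlong {X Y : Type*} [MeasurableSpace Y] (T : ℝ) (d : X → X → ℝ≥0∞)
    (G : ℝ → X → Y) : Prop :=
  ∀ (α β : ℝ) (tm : ℝ → ℝ) (u : ℝ → X), IsTimeOrdered T d α β tm u →
    AEMeasurable (fun s => G (tm s) (u s)) (volume.restrict (Icc α β))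

/-! ### Evolution systems -/

/-- An evolution system `(X, d, 𝓔, 𝓕, 𝓟)` on the time interval `[0,T]`. Only times in `[0,T]`
matter. Mathlib's `EMetricSpace` is an extended distance (values in `[0,∞]`). -/
structure EvolutionSystem (T : ℝ) (X : Type*) where
  /-- the extended distance -/
  metric : EMetricSpace X
  complete : @CompleteSpace X metric.toUniformSpace
  /-- the energy, with values in `(-∞, ∞]` -/
  energy : ℝ → X → EReal
  energy_ne_bot : ∀ t ∈ Icc 0 T, ∀ x, energy t x ≠ ⊥
  energy_meas : MeasurableAlong T (fun x y => metric.edist x y) energy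
  /-- the slope -/
  slope : ℝ → X → ℝ≥0∞
  slope_meas : MeasurableAlong T (fun x y => metric.edist x y) slope
  /-- the power, with values in `[-∞, ∞]` -/
  power : ℝ → X → ℝ≥0∞ → EReal
  power_meas : ∀ f : ℝ≥0∞, f ≠ ∞ →
    MeasurableAlong T (fun x y => metric.edist x y) (fun t x => power t x f)
  power_mono : ∀ t ∈ Icc 0 T, ∀ x, Monotone (power t x)
  power_usc : ∀ t ∈ Icc 0 T, ∀ x, UpperSemicontinuous (power t x)

/-- The extended distance of an evolution system. -/
def EvolutionSystem.dist {T : ℝ} {X : Type*} (S : EvolutionSystem T X) (x y : X) : ℝ≥0∞ :=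
  S.metric.edist x y

/-- The system is an (irreversible) upper gradient system: the chain-rule inequality holds along
all time-ordered absolutely continuous curves. -/
def EvolutionSystem.IsUpperGradient {T : ℝ} {X : Type*} (S : EvolutionSystem T X) : Prop :=
  ∀ (α β : ℝ) (tm : ℝ → ℝ) (u : ℝ → X) (F : ℝ → ℝ≥0∞),
    IsTimeOrdered T S.dist α β tm u →
    AEMeasurable F (volume.restrict (Icc α β)) →
    S.energy (tm α) (u α) < ⊤ →
    (∀ s ∈ Icc α β, S.slope (tm s) (u s) ≤ F s) →
    ∫⁻ s in Ioc α β,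
      (-S.power (tm s) (u s) (F s)).toENNReal * ENNReal.ofReal (deriv tm s) ≠ ∞ →
    S.energy (tm α) (u α) +
        erealIntegral α β (fun s => S.power (tm s) (u s) (F s) * ((deriv tm s : ℝ) : EReal))
      ≤ S.energy (tm β) (u β) +
        ((∫⁻ s in Ioc α β, F s * metricDeriv S.dist u s : ℝ≥0∞) : EReal)

/-! ### Dissipation functions -/

/-- `ψ : [0,∞) → [0,∞)` is a metric dissipation function: convex, `ψ 0 = 0`, and
`lim_{v → ∞} ψ v / v` exists in `(0,∞]`. -/
structure IsDissipation (ψ : ℝ≥0 → ℝ≥0) : Prop where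
  convex : ConvexOn ℝ≥0 univ ψ
  zero : ψ 0 = 0
  growth : ∃ L : ℝ≥0∞, 0 < L ∧
    Tendsto (fun v : ℝ≥0 => ((ψ v : ℝ≥0) : ℝ≥0∞) / (v : ℝ≥0∞)) atTop (𝓝 L)

/-- `ψ` is superlinear: `lim_{v → ∞} ψ v / v = ∞`. -/
def IsSuperlinear (ψ : ℝ≥0 → ℝ≥0) : Prop :=
  Tendsto (fun v : ℝ≥0 => ((ψ v : ℝ≥0) : ℝ≥0∞) / (v : ℝ≥0∞)) atTop (𝓝 ∞)

/-- The dual `ψ* f = sup_{v ≥ 0} (f v - ψ v)`, also for `f = ∞`. The subtraction in `[0,∞]` is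
truncated at `0`, which does not change the supremum since `v = 0` contributes `0`. -/
noncomputable def dual (ψ : ℝ≥0 → ℝ≥0) (f : ℝ≥0∞) : ℝ≥0∞ :=
  ⨆ v : ℝ≥0, (f * (v : ℝ≥0∞) - ((ψ v : ℝ≥0) : ℝ≥0∞))

/-! ### Energy-dissipation inequality and gradient flows -/

/-- The curve `u` is absolutely continuous, has finite initial energy, and satisfies with the map
`F` the `ψ`-`ψ*` energy-dissipation inequality on `[0,t]` for every `t ∈ [0,T]`. (The metric
derivative is finite almost everywhere, so `toNNReal` is harmless.) -/
structure SatisfiesED {T : ℝ} {X : Type*} (S : EvolutionSystem T X) (ψ : ℝ≥0 → ℝ≥0)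
    (u : ℝ → X) (F : ℝ → ℝ≥0∞) : Prop where
  ac : IsAC S.dist 0 T u
  energy_zero : S.energy 0 (u 0) < ⊤
  meas : AEMeasurable F (volume.restrict (Icc 0 T))
  slope_le : ∀ t ∈ Icc 0 T, S.slope t (u t) ≤ F t
  power_pos : ∫⁻ t in Ioc 0 T, (S.power t (u t) (F t)).toENNReal ≠ ∞
  ineq : ∀ t ∈ Icc 0 T,
    S.energy t (u t) +
        ((∫⁻ r in Ioc 0 t,
          (((ψ (metricDeriv S.dist u r).toNNReal : ℝ≥0) : ℝ≥0∞) + dual ψ (F r)) : ℝ≥0∞) : EReal)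
      ≤ S.energy 0 (u 0) + erealIntegral 0 t (fun r => S.power r (u r) (F r))

/-- `u` is a `ψ`-gradient flow of the (upper gradient) evolution system `S`. -/
def IsGradientFlow {T : ℝ} {X : Type*} (S : EvolutionSystem T X) (ψ : ℝ≥0 → ℝ≥0)
    (u : ℝ → X) : Prop :=
  ∃ F : ℝ → ℝ≥0∞, SatisfiesED S ψ u F

/-! ### Convergence of a sequence of systems

Diverging subsequences are identified with infinite sets `H ⊆ ℕ`. -/

/-- The filter of limits `h → ∞`, `h ∈ H`. -/
def along (H : Set ℕ) : Filter ℕ := atTop ⊓ 𝓟 H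

/-- The modified energy `𝓔_h(t,x) + a d_h(x, ū_h) + b`. -/
noncomputable def modEnergy {T : ℝ} {X : Type*} (Sh : ℕ → EvolutionSystem T X) (ub : ℕ → X)
    (a b : ℝ≥0) (h : ℕ) (t : ℝ) (x : X) : EReal :=
  (Sh h).energy t x + (((a : ℝ≥0∞) * (Sh h).dist x (ub h) : ℝ≥0∞) : EReal) + ((b : ℝ) : EReal)

/-- The modified energies are nonnegative. -/
def ModEnergyNonneg {T : ℝ} {X : Type*} (Sh : ℕ → EvolutionSystem T X) (ub : ℕ → X)
    (a b : ℝ≥0) : Prop :=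
  ∀ h : ℕ, ∀ t ∈ Icc 0 T, ∀ x : X, 0 ≤ modEnergy Sh ub a b h t x

/-- The modified energies are equi-coercive on `[0,T] × X` for the product topology. -/
def EquiCoercive {T : ℝ} {X : Type*} [TopologicalSpace X] (Sh : ℕ → EvolutionSystem T X)
    (ub : ℕ → X) (a b : ℝ≥0) : Prop :=
  ∀ (H : Set ℕ) (t : ℕ → ℝ) (x : ℕ → X), H.Infinite → (∀ h ∈ H, t h ∈ Icc 0 T) →
    (∃ C : ℝ, ∀ h ∈ H, modEnergy Sh ub a b h (t h) (x h) ≤ (C : EReal)) →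
    ∃ H' ⊆ H, H'.Infinite ∧ ∃ t₀ ∈ Icc 0 T, ∃ x₀ : X,
      Tendsto t (along H') (𝓝 t₀) ∧ Tendsto x (along H') (𝓝 x₀)

/-- Lower semicontinuity of the distances along converging sequences with bounded modified
energies. -/
def DistLiminf {T : ℝ} {X : Type*} [TopologicalSpace X] (Sh : ℕ → EvolutionSystem T X)
    (S : EvolutionSystem T X) (ub : ℕ → X) (a b : ℝ≥0) : Prop :=
  ∀ (H : Set ℕ) (t₁ t₂ : ℕ → ℝ) (x₁ x₂ : ℕ → X) (s₁ s₂ : ℝ) (y₁ y₂ : X), H.Infinite →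
    (∀ h ∈ H, t₁ h ∈ Icc 0 T) → (∀ h ∈ H, t₂ h ∈ Icc 0 T) →
    (∃ C : ℝ, ∀ h ∈ H, modEnergy Sh ub a b h (t₁ h) (x₁ h) ≤ (C : EReal)) →
    (∃ C : ℝ, ∀ h ∈ H, modEnergy Sh ub a b h (t₂ h) (x₂ h) ≤ (C : EReal)) →
    Tendsto t₁ (along H) (𝓝 s₁) → Tendsto x₁ (along H) (𝓝 y₁) →
    Tendsto t₂ (along H) (𝓝 s₂) → Tendsto x₂ (along H) (𝓝 y₂) →
    S.dist y₁ y₂ ≤ liminf (fun h => (Sh h).dist (x₁ h) (x₂ h)) (along H)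

/-- The `liminf` inequality for the energies at fixed time. -/
def EnergyLiminf {T : ℝ} {X : Type*} [TopologicalSpace X] (Sh : ℕ → EvolutionSystem T X)
    (S : EvolutionSystem T X) (ub : ℕ → X) (a b : ℝ≥0) : Prop :=
  ∀ (H : Set ℕ) (x : ℕ → X) (x₀ : X), H.Infinite → ∀ t ∈ Icc 0 T,
    Tendsto x (along H) (𝓝 x₀) →
    (∃ C : ℝ, ∀ h ∈ H, modEnergy Sh ub a b h t (x h) ≤ (C : EReal)) →
    S.energy t x₀ ≤ liminf (fun h => (Sh h).energy t (x h)) (along H)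

/-- The joint semicontinuity condition for slopes and powers at fixed time, for converging
sequences `f_h → f` of finite numbers. -/
def SlopePowerLimit {T : ℝ} {X : Type*} [TopologicalSpace X] (Sh : ℕ → EvolutionSystem T X)
    (S : EvolutionSystem T X) (ub : ℕ → X) (a b : ℝ≥0) : Prop :=
  ∀ (H : Set ℕ) (x : ℕ → X) (x₀ : X), H.Infinite → ∀ t ∈ Icc 0 T,
    Tendsto x (along H) (𝓝 x₀) →
    (∃ C : ℝ, ∀ h ∈ H, modEnergy Sh ub a b h t (x h) ≤ (C : EReal)) →
    ∀ (f : ℕ → ℝ≥0) (f₀ : ℝ≥0), (∀ h ∈ H, (Sh h).slope t (x h) ≤ (f h : ℝ≥0∞)) →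
      Tendsto f (along H) (𝓝 f₀) →
      S.slope t x₀ ≤ (f₀ : ℝ≥0∞) ∧
      limsup (fun h => (Sh h).power t (x h) (f h : ℝ≥0∞)) (along H) ≤ S.power t x₀ (f₀ : ℝ≥0∞)

/-- Equi-integrability on `(0,T)` of the nonnegative functions `g h`, `h ∈ H`. On a bounded
interval of the line this `ε`-`δ` condition also bounds the integrals. -/
def EquiIntegrable (T : ℝ) (H : Set ℕ) (g : ℕ → ℝ → ℝ≥0∞) : Prop :=
  ∀ ε : ℝ≥0∞, 0 < ε → ∃ δ : ℝ≥0∞, 0 < δ ∧ ∀ A : Set ℝ, MeasurableSet A → A ⊆ Ioc 0 T →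
    volume A ≤ δ → ∀ h ∈ H, ∫⁻ r in A, g h r ≤ ε

end EvolSys

open EvolSys

namespace EvolSys

/-! ### Real absolutely continuous functions -/

/-! Passing to the limit in the energy-dissipation inequalities gives an upper bound for the final
energy plus the dissipation; the chain rule of the upper gradient system gives the matching lower
bound. No energy can then be lost in the limit, and this is what forces the energies to converge.

Velocity. Superlinearity, uniform for large h, makes the curves equi-absolutely continuous, and (C3)
transfers the estimate to `u`. For the dissipation, the metric derivative is replaced by difference
quotients with step 1/(n+1). Jensen's inequality bounds their dissipation by that of the curve; (C3)
with Fatou in h, then Fatou in n, gives `BoundedLimit.lintegral_velDiss_le`.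

Slope and power. The maps F_h converge at best pointwise, along subsequences that depend on the
time, and ψ*(F) - P has no lower bound. It is therefore replaced by the nonnegative quantity
(1+ε)ψ*(F) - min(P, M) + M (`truncPot`). Equi-integrability makes the truncation error at most ω
uniformly in h, the factor 1+ε costs at most εC, and Fatou applies to the pointwise lower limit
`limPot`. At a fixed time, compactness of the extended half-line and (C4) yield some f above the
limit slope whose truncated potential is at most `limPot` (`SlopePowerLimit.exists_truncPot_le`).
The power increases in f and ψ* is right-continuous, so f can be made rational at a cost s, and a
measurable F_n can be selected (`BoundedLimit.exists_near_minimizer`).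

The role of ε. When the limit inequality for F_n is combined with the chain rule for F_n, everything
cancels except ε∫ψ*(F_n) ≤ εC + ω + sT. With ω and sT at most ε, this bounds ∫ψ*(F_n) by C+2,
independently of n (`BoundedLimit.lintegral_dual_le`). Hence F₀ = liminf F_n has finite dual
dissipation and the chain rule applies to it. Semicontinuity of ψ* and of the power gives
`dual_add_le_of_truncPot_le`, and ε → 0 produces the inequality for F₀. The same limit inequality
holds with a number c in place of the final energy whenever the approximating energies are at least
c infinitely often; the chain rule then forces c to be at most the limit energy. With (C4_E) this is
convergence of the energies. -/

theorem absolutelyContinuousOnInterval_of_dist_le {φ M : ℝ → ℝ} {a b : ℝ}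
    (hM : AbsolutelyContinuousOnInterval M a b)
    (h : ∀ s ∈ uIcc a b, ∀ t ∈ uIcc a b, dist (φ s) (φ t) ≤ dist (M s) (M t)) :
    AbsolutelyContinuousOnInterval φ a b := by
  rw [absolutelyContinuousOnInterval_iff] at hM ⊢
  intro ε hε
  obtain ⟨δ, hδ, hE⟩ := hM ε hε
  refine ⟨δ, hδ, fun E hEm hEs => lt_of_le_of_lt (Finset.sum_le_sum fun i hi => ?_) (hE E hEm hEs)⟩
  exact h _ (hEm.1 i hi).1 _ (hEm.1 i hi).2

/-- The primitive of an integrable density, as a difference of lower integrals. -/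
theorem intervalIntegral_toReal_eq {g : ℝ → ℝ≥0∞} {a b s t : ℝ}
    (hg : AEMeasurable g (volume.restrict (Ioc a b))) (hfin : ∫⁻ r in Ioc a b, g r ≠ ∞)
    (has : a ≤ s) (hst : s ≤ t) (htb : t ≤ b) :
    ∫ r in s..t, (g r).toReal = (∫⁻ r in Ioc s t, g r).toReal := by
  have hsub : Ioc s t ⊆ Ioc a b := Ioc_subset_Ioc has htb
  rw [intervalIntegral.integral_of_le hst]
  have hg' : AEMeasurable g (volume.restrict (Ioc s t)) := hg.mono_measure
    (Measure.restrict_mono hsub le_rfl)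
  refine integral_toReal hg' (ae_lt_top' hg' ?_)
  exact ne_top_of_le_ne_top hfin (lintegral_mono_set hsub)

theorem intervalIntegrable_toReal {g : ℝ → ℝ≥0∞} {a b : ℝ} (hab : a ≤ b)
    (hg : AEMeasurable g (volume.restrict (Ioc a b))) (hfin : ∫⁻ r in Ioc a b, g r ≠ ∞) :
    IntervalIntegrable (fun r => (g r).toReal) volume a b := by
  rw [intervalIntegrable_iff_integrableOn_Ioc_of_le hab]
  exact integrable_toReal_of_lintegral_ne_top hg hfin

theorem absolutelyContinuousOnInterval_of_edist_le {φ : ℝ → ℝ} {g : ℝ → ℝ≥0∞} {a b : ℝ}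
    (hab : a ≤ b)
    (hg : AEMeasurable g (volume.restrict (Ioc a b))) (hfin : ∫⁻ r in Ioc a b, g r ≠ ∞)
    (h : ∀ s t, a ≤ s → s < t → t ≤ b → edist (φ s) (φ t) ≤ ∫⁻ r in Ioc s t, g r) :
    AbsolutelyContinuousOnInterval φ a b := by
  have hI := intervalIntegrable_toReal hab hg hfin
  refine absolutelyContinuousOnInterval_of_dist_le
    (hI.absolutelyContinuousOnInterval_intervalIntegral (c := a) left_mem_uIcc) ?_
  have key : ∀ s t, a ≤ s → s < t → t ≤ b →
      dist (φ s) (φ t) ≤ dist (∫ r in a..s, (g r).toReal) (∫ r in a..t, (g r).toReal) := by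
    intro s t has hst htb
    have e : ∫ r in a..t, (g r).toReal - 0 = (∫ r in a..s, (g r).toReal)
        + ∫ r in s..t, (g r).toReal := by
      simp only [sub_zero]
      refine (intervalIntegral.integral_add_adjacent_intervals (hI.mono_set ?_)
        (hI.mono_set ?_)).symm
      · rw [uIcc_of_le has, uIcc_of_le hab]; exact Icc_subset_Icc le_rfl (hst.le.trans htb)
      · rw [uIcc_of_le hst.le, uIcc_of_le hab]; exact Icc_subset_Icc has htb
    simp only [sub_zero] at e
    rw [e, Real.dist_eq, Real.dist_eq, sub_add_cancel_left, abs_neg,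
      intervalIntegral_toReal_eq hg hfin has hst.le htb, abs_of_nonneg ENNReal.toReal_nonneg,
      ← Real.dist_eq, dist_edist]
    exact ENNReal.toReal_mono
      (ne_top_of_le_ne_top hfin (lintegral_mono_set (Ioc_subset_Ioc has htb))) (h s t has hst htb)
  intro s hs t ht
  rw [uIcc_of_le hab] at hs ht
  rcases lt_trichotomy s t with hst | rfl | hst
  · exact key s t hs.1 hst ht.2
  · simp
  · rw [dist_comm, dist_comm (∫ r in a..s, _)]; exact key t s ht.1 hst hs.2

/-! ### Metric derivatives -/

section Metric

variable {X : Type*} [PseudoEMetricSpace X]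

/-- Projection of the line onto `[a,b]`. -/
noncomputable def clamp (a b t : ℝ) : ℝ := max a (min b t)

theorem clamp_of_mem {a b t : ℝ} (ht : t ∈ Icc a b) : clamp a b t = t := by
  simp [clamp, ht.1, ht.2]

theorem clamp_mem {a b : ℝ} (hab : a ≤ b) (t : ℝ) : clamp a b t ∈ Icc a b := by
  simp [clamp, hab]

theorem continuous_clamp (a b : ℝ) : Continuous (clamp a b) := by
  unfold clamp; fun_prop

/-- Difference quotients of the curve frozen outside `[a,b]`. -/
noncomputable def diffQuot (a b : ℝ) (u : ℝ → X) (τ r : ℝ) : ℝ≥0∞ :=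
  edist (u (clamp a b (r + τ))) (u (clamp a b r)) / ENNReal.ofReal τ

/-- The step `1 / (n + 1)`. -/
noncomputable def step (n : ℕ) : ℝ := 1 / ((n : ℝ) + 1)

theorem step_pos (n : ℕ) : 0 < step n := by unfold step; positivity

theorem tendsto_step : Tendsto step atTop (𝓝[>] 0) :=
  tendsto_nhdsWithin_iff.2 ⟨tendsto_one_div_add_atTop_nhds_zero_nat,
    Eventually.of_forall step_pos⟩

/-- Lower limit of the difference quotients along the steps `1 / (n + 1)`. -/
noncomputable def lowerDeriv (a b : ℝ) (u : ℝ → X) (r : ℝ) : ℝ≥0∞ :=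
  liminf (fun n : ℕ => diffQuot a b u (step n) r) atTop

theorem continuous_comp_clamp {a b : ℝ} (hab : a ≤ b) {u : ℝ → X} (hu : ContinuousOn u (Icc a b)) :
    Continuous fun t => u (clamp a b t) :=
  hu.comp_continuous (continuous_clamp a b) (clamp_mem hab)

theorem measurable_diffQuot {a b : ℝ} (hab : a ≤ b) {u : ℝ → X} (hu : ContinuousOn u (Icc a b))
    (τ : ℝ) : Measurable (diffQuot a b u τ) := by
  have h := continuous_comp_clamp hab hu
  have : Continuous fun r => edist (u (clamp a b (r + τ))) (u (clamp a b r)) :=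
    (h.comp (continuous_id.add continuous_const)).edist h
  exact this.measurable.div_const _

theorem measurable_lowerDeriv {a b : ℝ} (hab : a ≤ b) {u : ℝ → X}
    (hu : ContinuousOn u (Icc a b)) : Measurable (lowerDeriv a b u) :=
  Measurable.liminf fun _ => measurable_diffQuot hab hu _

theorem eventually_add_mem_Icc {a b r : ℝ} (hr : r ∈ Ioo a b) :
    ∀ᶠ τ : ℝ in 𝓝[>] 0, r + τ ∈ Ioc r b := by
  have : Ioo (0 : ℝ) (b - r) ∈ 𝓝[>] (0 : ℝ) := Ioo_mem_nhdsGT (by linarith [hr.2])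
  filter_upwards [this] with τ hτ
  exact ⟨by linarith [hτ.1], by linarith [hτ.2]⟩

theorem eventually_diffQuot_eq {a b r : ℝ} (hr : r ∈ Ioo a b) (u : ℝ → X) :
    ∀ᶠ τ : ℝ in 𝓝[>] 0, diffQuot a b u τ r = edist (u (r + τ)) (u r) / ENNReal.ofReal τ := by
  filter_upwards [eventually_add_mem_Icc hr] with τ hτ
  rw [diffQuot, clamp_of_mem ⟨hr.1.le, hr.2.le⟩, clamp_of_mem ⟨hr.1.le.trans hτ.1.le, hτ.2⟩]

theorem lowerDeriv_le_metricDeriv {a b r : ℝ} (hr : r ∈ Ioo a b) (u : ℝ → X) :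
    lowerDeriv a b u r ≤ metricDeriv (fun x y => edist x y) u r := by
  have h1 : lowerDeriv a b u r
      ≤ limsup (fun n => diffQuot a b u (step n) r) atTop := liminf_le_limsup
  refine h1.trans ?_
  have h2 : limsup (fun n => diffQuot a b u (step n) r) atTop
      = limsup (fun τ => diffQuot a b u τ r) (map step atTop) := rfl
  rw [h2, metricDeriv]
  refine (limsup_le_limsup_of_le tendsto_step).trans ?_
  exact (limsup_congr (eventually_diffQuot_eq hr u)).le

theorem ae_restrict_Ioc_of_Ioo {a b : ℝ} {p : ℝ → Prop} (h : ∀ᵐ r, r ∈ Ioo a b → p r) :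
    ∀ᵐ r ∂volume.restrict (Ioc a b), p r := by
  rw [← restrict_Ioo_eq_restrict_Ioc, ae_restrict_iff' measurableSet_Ioo]
  exact h

/-- A density controlling the increments dominates the metric derivative. -/
theorem metricDeriv_le_of_edist_le {a b : ℝ} (hab : a ≤ b) {u : ℝ → X} {g : ℝ → ℝ≥0∞}
    (hg : AEMeasurable g (volume.restrict (Ioc a b))) (hfin : ∫⁻ r in Ioc a b, g r ≠ ∞)
    (h : ∀ s t, a ≤ s → s < t → t ≤ b → edist (u s) (u t) ≤ ∫⁻ r in Ioc s t, g r) :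
    ∀ᵐ r ∂volume.restrict (Ioc a b), metricDeriv (fun x y => edist x y) u r ≤ g r := by
  have hI := intervalIntegrable_toReal hab hg hfin
  have h1 : ∀ᵐ r ∂volume.restrict (Ioc a b), r ∈ Ioo a b := by
    apply ae_restrict_Ioc_of_Ioo; exact ae_of_all _ fun _ h => h
  have h2 := ae_lt_top' hg hfin
  filter_upwards [h1, h2, ae_restrict_of_ae hI.ae_hasDerivAt_integral] with r hr hgr hd
  have hr' : r ∈ uIcc a b := by rw [uIcc_of_le hab]; exact Ioo_subset_Icc_self hr
  have hd := (hd hr' r hr').tendsto_slope_zero_right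
  have hd' := (ENNReal.continuous_ofReal.tendsto _).comp hd
  rw [ENNReal.ofReal_toReal hgr.ne] at hd'
  rw [← hd'.limsup_eq]
  refine limsup_le_limsup ?_
  filter_upwards [eventually_add_mem_Icc hr, self_mem_nhdsWithin] with τ hτ hτ0
  have hτ0 : 0 < τ := hτ0
  simp only [Function.comp, intervalIntegral.integral_same, sub_zero, smul_eq_mul]
  rw [intervalIntegral_toReal_eq hg hfin hr.1.le hτ.1.le hτ.2,
    ENNReal.ofReal_mul (inv_nonneg.2 hτ0.le), ENNReal.ofReal_inv_of_pos hτ0,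
    ENNReal.ofReal_toReal
      (ne_top_of_le_ne_top hfin (lintegral_mono_set (Ioc_subset_Ioc hr.1.le hτ.2))),
    mul_comm, ← div_eq_mul_inv, edist_comm]
  exact ENNReal.div_le_div_right (h _ _ hr.1.le hτ.1 hτ.2) _

/-- If all distance functions along the curve are absolutely continuous, increments are bounded
by the integral of the lower derivative. -/
theorem edist_le_lintegral_lowerDeriv {a b : ℝ} {u : ℝ → X}
    (hfin : ∀ s ∈ Icc a b, ∀ t ∈ Icc a b, edist (u s) (u t) ≠ ∞)
    (hac : ∀ s ∈ Icc a b, AbsolutelyContinuousOnInterval (fun t => (edist (u s) (u t)).toReal) a b)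
    {s t : ℝ} (has : a ≤ s) (hst : s ≤ t) (htb : t ≤ b) :
    edist (u s) (u t) ≤ ∫⁻ r in Ioc s t, lowerDeriv a b u r := by
  have hab : a ≤ b := has.trans (hst.trans htb)
  have hs : s ∈ Icc a b := ⟨has, hst.trans htb⟩
  have ht : t ∈ Icc a b := ⟨has.trans hst, htb⟩
  set φ : ℝ → ℝ := fun t => (edist (u s) (u t)).toReal with hφ
  have hA : AbsolutelyContinuousOnInterval φ s t := (hac s hs).mono (by
    rw [uIcc_of_le hst, uIcc_of_le hab]; exact Icc_subset_Icc has htb)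
  -- The distance to the fixed point `u s` is a real absolutely continuous function, so its
  -- increment is the integral of its derivative.
  have e1 := hA.integral_deriv_eq_sub
  have e2 : φ s = 0 := by simp [hφ]
  rw [e2, sub_zero, intervalIntegral.integral_of_le hst] at e1
  have e3 : edist (u s) (u t) = ‖∫ r in Ioc s t, deriv φ r‖ₑ := by
    rw [e1, Real.enorm_eq_ofReal ENNReal.toReal_nonneg, ENNReal.ofReal_toReal (hfin s hs t ht)]
  rw [e3]
  refine (enorm_integral_le_lintegral_enorm _).trans (lintegral_mono_ae ?_)
  apply ae_restrict_Ioc_of_Ioo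
  filter_upwards [hA.ae_differentiableAt] with r hd hr
  have hr' : r ∈ uIcc s t := by rw [uIcc_of_le hst]; exact Ioo_subset_Icc_self hr
  have hrab : r ∈ Ioo a b := ⟨has.trans_lt hr.1, hr.2.trans_le htb⟩
  -- Where φ is differentiable, the steps 1/(n+1) already compute the derivative; by the triangle
  -- inequality each quotient of φ is at most that of `u`.
  have hd1 := ((hd hr').hasDerivAt.tendsto_slope_zero_right).enorm.comp tendsto_step
  rw [← hd1.liminf_eq, lowerDeriv]
  refine liminf_le_liminf ?_
  filter_upwards [tendsto_step.eventually (eventually_diffQuot_eq hrab u),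
    tendsto_step.eventually (eventually_add_mem_Icc hrab)] with n hn hn2
  rw [hn]
  have hp := step_pos n
  simp only [Function.comp, enorm_smul]
  rw [Real.enorm_eq_ofReal (inv_nonneg.2 hp.le), ENNReal.ofReal_inv_of_pos hp, mul_comm,
    ← div_eq_mul_inv]
  refine ENNReal.div_le_div_right ?_ _
  have hm : r + step n ∈ Icc a b := ⟨hrab.1.le.trans hn2.1.le, hn2.2⟩
  have hm' : r ∈ Icc a b := Ioo_subset_Icc_self hrab
  rw [← edist_eq_enorm_sub, edist_dist, Real.dist_eq]
  refine ENNReal.ofReal_le_of_le_toReal ?_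
  have f1 := hfin s hs _ hm
  have f2 := hfin s hs _ hm'
  have f3 := hfin _ hm _ hm'
  have t1 : φ (r + step n) ≤ φ r + (edist (u (r + step n)) (u r)).toReal := by
    rw [hφ, ← ENNReal.toReal_add f2 f3]
    refine ENNReal.toReal_mono (ENNReal.add_ne_top.2 ⟨f2, f3⟩) ?_
    rw [edist_comm (u (r + step n))]; exact edist_triangle _ _ _
  have t2 : φ r ≤ φ (r + step n) + (edist (u (r + step n)) (u r)).toReal := by
    rw [hφ, ← ENNReal.toReal_add f1 f3]
    exact ENNReal.toReal_mono (ENNReal.add_ne_top.2 ⟨f1, f3⟩) (edist_triangle _ _ _)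
  rw [abs_le]; constructor <;> linarith

theorem continuousOn_of_absolutelyContinuous_edist {a b : ℝ} {u : ℝ → X}
    (hfin : ∀ s ∈ Icc a b, ∀ t ∈ Icc a b, edist (u s) (u t) ≠ ∞)
    (hac : ∀ s ∈ Icc a b,
      AbsolutelyContinuousOnInterval (fun t => (edist (u s) (u t)).toReal) a b) :
    ContinuousOn u (Icc a b) := by
  intro s hs
  have hab : a ≤ b := hs.1.trans hs.2
  have hc := (hac s hs).continuousOn
  rw [uIcc_of_le hab] at hc
  have hc := (ENNReal.continuous_ofReal.tendsto _).comp (hc s hs)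
  simp only [edist_self, ENNReal.toReal_zero, ENNReal.ofReal_zero] at hc
  rw [ContinuousWithinAt, EMetric.tendsto_nhds]
  intro ε hε
  filter_upwards [hc.eventually_lt_const hε, self_mem_nhdsWithin] with t ht htm
  rw [Function.comp, ENNReal.ofReal_toReal (hfin s hs t htm)] at ht
  rwa [edist_comm]

/-- Metric derivative of a curve along which all distance functions are absolutely continuous. -/
theorem metricDeriv_eq_lowerDeriv {a b : ℝ} (hab : a ≤ b) {u : ℝ → X}
    (hfin : ∀ s ∈ Icc a b, ∀ t ∈ Icc a b, edist (u s) (u t) ≠ ∞)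
    (hac : ∀ s ∈ Icc a b, AbsolutelyContinuousOnInterval (fun t => (edist (u s) (u t)).toReal) a b)
    (hint : ∫⁻ r in Ioc a b, lowerDeriv a b u r ≠ ∞) :
    metricDeriv (fun x y => edist x y) u =ᵐ[volume.restrict (Ioc a b)] lowerDeriv a b u := by
  have hc := continuousOn_of_absolutelyContinuous_edist hfin hac
  have h1 := metricDeriv_le_of_edist_le hab (measurable_lowerDeriv hab hc).aemeasurable hint
    fun s t has hst htb => edist_le_lintegral_lowerDeriv hfin hac has hst.le htb
  have h2 : ∀ᵐ r ∂volume.restrict (Ioc a b), r ∈ Ioo a b := by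
    apply ae_restrict_Ioc_of_Ioo; exact ae_of_all _ fun _ h => h
  filter_upwards [h1, h2] with r hr hr2
  exact le_antisymm hr (lowerDeriv_le_metricDeriv hr2 u)

theorem IsAC.edist_ne_top {a b : ℝ} {u : ℝ → X} (hu : IsAC (fun x y : X => edist x y) a b u) :
    ∀ s ∈ Icc a b, ∀ t ∈ Icc a b, edist (u s) (u t) ≠ ∞ := by
  obtain ⟨m, hm, hfin, h⟩ := hu
  have key : ∀ s t, a ≤ s → s < t → t ≤ b → edist (u s) (u t) ≠ ∞ := fun s t h1 h2 h3 =>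
    ne_top_of_le_ne_top (ne_top_of_le_ne_top hfin (lintegral_mono_set (Ioc_subset_Ioc h1 h3)))
      (h s t h1 h2 h3)
  intro s hs t ht
  rcases lt_trichotomy s t with hst | rfl | hst
  · exact key s t hs.1 hst ht.2
  · simp
  · rw [edist_comm]; exact key t s ht.1 hst hs.2

theorem IsAC.absolutelyContinuous_edist {a b : ℝ} {u : ℝ → X}
    (hu : IsAC (fun x y : X => edist x y) a b u) :
    ∀ s ∈ Icc a b,
      AbsolutelyContinuousOnInterval (fun t => (edist (u s) (u t)).toReal) a b := by
  intro s hs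
  have hne := hu.edist_ne_top
  obtain ⟨m, hm, hfin, h⟩ := hu
  have hab : a ≤ b := hs.1.trans hs.2
  refine absolutelyContinuousOnInterval_of_edist_le hab hm hfin fun p q hp hpq hq => ?_
  have hpm : p ∈ Icc a b := ⟨hp, hpq.le.trans hq⟩
  have hqm : q ∈ Icc a b := ⟨hp.trans hpq.le, hq⟩
  refine le_trans ?_ (h p q hp hpq hq)
  have f1 := hne s hs p hpm
  have f2 := hne s hs q hqm
  have f3 := hne p hpm q hqm
  rw [edist_dist, Real.dist_eq]
  refine ENNReal.ofReal_le_of_le_toReal ?_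
  have t1 : (edist (u s) (u q)).toReal
      ≤ (edist (u s) (u p)).toReal + (edist (u p) (u q)).toReal := by
    rw [← ENNReal.toReal_add f1 f3]
    exact ENNReal.toReal_mono (ENNReal.add_ne_top.2 ⟨f1, f3⟩) (edist_triangle _ _ _)
  have t2 : (edist (u s) (u p)).toReal
      ≤ (edist (u s) (u q)).toReal + (edist (u p) (u q)).toReal := by
    rw [← ENNReal.toReal_add f2 f3]
    refine ENNReal.toReal_mono (ENNReal.add_ne_top.2 ⟨f2, f3⟩) ?_
    rw [edist_comm (u p)]; exact edist_triangle _ _ _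
  rw [abs_le]; constructor <;> linarith

theorem IsAC.continuousOn {a b : ℝ} {u : ℝ → X}
    (hu : IsAC (fun x y : X => edist x y) a b u) : ContinuousOn u (Icc a b) :=
  continuousOn_of_absolutelyContinuous_edist hu.edist_ne_top hu.absolutelyContinuous_edist

theorem IsAC.lintegral_lowerDeriv_ne_top {a b : ℝ} (hab : a ≤ b) {u : ℝ → X}
    (hu : IsAC (fun x y : X => edist x y) a b u) :
    ∫⁻ r in Ioc a b, lowerDeriv a b u r ≠ ∞ := by
  obtain ⟨m, hm, hfin, h⟩ := hu
  refine ne_top_of_le_ne_top hfin (lintegral_mono_ae ?_)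
  have h2 : ∀ᵐ r ∂volume.restrict (Ioc a b), r ∈ Ioo a b := by
    apply ae_restrict_Ioc_of_Ioo; exact ae_of_all _ fun _ h => h
  filter_upwards [metricDeriv_le_of_edist_le hab hm hfin h, h2] with r hr hr2
  exact (lowerDeriv_le_metricDeriv hr2 u).trans hr

/-- The upper limit over a continuum of τ is not visibly measurable, while the lower limit along a
sequence is. The two agree because `lowerDeriv` is itself an admissible density, hence dominates the
metric derivative, and lies below it by construction. -/
theorem IsAC.metricDeriv_ae_eq {a b : ℝ} (hab : a ≤ b) {u : ℝ → X}
    (hu : IsAC (fun x y : X => edist x y) a b u) :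
    metricDeriv (fun x y => edist x y) u =ᵐ[volume.restrict (Ioc a b)] lowerDeriv a b u :=
  metricDeriv_eq_lowerDeriv hab hu.edist_ne_top hu.absolutelyContinuous_edist
    (hu.lintegral_lowerDeriv_ne_top hab)

theorem IsAC.aemeasurable_metricDeriv {a b : ℝ} (hab : a ≤ b) {u : ℝ → X}
    (hu : IsAC (fun x y : X => edist x y) a b u) :
    AEMeasurable (metricDeriv (fun x y => edist x y) u) (volume.restrict (Ioc a b)) :=
  (measurable_lowerDeriv hab hu.continuousOn).aemeasurable.congr (hu.metricDeriv_ae_eq hab).symm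

theorem IsAC.lintegral_metricDeriv_ne_top {a b : ℝ} (hab : a ≤ b) {u : ℝ → X}
    (hu : IsAC (fun x y : X => edist x y) a b u) :
    ∫⁻ r in Ioc a b, metricDeriv (fun x y => edist x y) u r ≠ ∞ := by
  rw [lintegral_congr_ae (hu.metricDeriv_ae_eq hab)]
  exact hu.lintegral_lowerDeriv_ne_top hab

theorem IsAC.edist_le_lintegral_metricDeriv {a b : ℝ} {u : ℝ → X}
    (hu : IsAC (fun x y : X => edist x y) a b u) {s t : ℝ} (has : a ≤ s) (hst : s ≤ t)
    (htb : t ≤ b) :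
    edist (u s) (u t) ≤ ∫⁻ r in Ioc s t, metricDeriv (fun x y => edist x y) u r := by
  have hab : a ≤ b := has.trans (hst.trans htb)
  have h := edist_le_lintegral_lowerDeriv hu.edist_ne_top hu.absolutelyContinuous_edist has hst htb
  have e : metricDeriv (fun x y => edist x y) u =ᵐ[volume.restrict (Ioc s t)] lowerDeriv a b u :=
    ae_mono (Measure.restrict_mono (Ioc_subset_Ioc has htb) le_rfl) (hu.metricDeriv_ae_eq hab)
  rwa [lintegral_congr_ae e]

end Metric

/-! ### Dissipation functions -/

section Dissipation

variable {ψ : ℝ≥0 → ℝ≥0}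

theorem IsDissipation.real_convex (hψ : IsDissipation ψ) {x y p q : ℝ≥0} (hpq : p + q = 1) :
    (ψ (p * x + q * y) : ℝ) ≤ p * ψ x + q * ψ y := by
  have := hψ.convex.2 (mem_univ x) (mem_univ y) zero_le zero_le hpq
  simp only [smul_eq_mul] at this
  exact_mod_cast this

/-- Three-chord inequality. -/
theorem IsDissipation.three_point (hψ : IsDissipation ψ) {x y z : ℝ≥0} (hxy : x ≤ y) (hyz : y ≤ z) :
    ((z : ℝ) - x) * ψ y ≤ (z - y) * ψ x + (y - x) * ψ z := by
  rcases (hxy.trans hyz).eq_or_lt with h | h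
  · have h1 : x = y := le_antisymm hxy (h ▸ hyz)
    subst h1; subst h; simp
  have hR : (x : ℝ) < z := by exact_mod_cast h
  have hxy' : (x : ℝ) ≤ y := by exact_mod_cast hxy
  have hyz' : (y : ℝ) ≤ z := by exact_mod_cast hyz
  have hpos : (0 : ℝ) < z - x := sub_pos.2 hR
  set p : ℝ≥0 := ⟨(z - y) / (z - x), div_nonneg (sub_nonneg.2 hyz') hpos.le⟩ with hp
  set q : ℝ≥0 := ⟨(y - x) / (z - x), div_nonneg (sub_nonneg.2 hxy') hpos.le⟩ with hq
  have hp' : (p : ℝ) = (z - y) / (z - x) := rfl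
  have hq' : (q : ℝ) = (y - x) / (z - x) := rfl
  have hpq : p + q = 1 := by
    apply NNReal.coe_injective; push_cast; rw [hp', hq']; field_simp; ring
  have hy : p * x + q * z = y := by
    apply NNReal.coe_injective; push_cast; rw [hp', hq']; field_simp; ring
  have := hψ.real_convex (x := x) (y := z) hpq
  rw [hy, hp', hq'] at this
  calc ((z : ℝ) - x) * ψ y ≤ (z - x) * ((z - y) / (z - x) * ψ x + (y - x) / (z - x) * ψ z) :=
        mul_le_mul_of_nonneg_left this hpos.le
    _ = _ := by field_simp

/-- Monotonicity of ψ(v)/v, without division: the three-chord inequality with left endpoint 0. -/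
theorem IsDissipation.mul_le (hψ : IsDissipation ψ) {v w : ℝ≥0} (h : v ≤ w) :
    (w : ℝ) * ψ v ≤ v * ψ w := by
  have := hψ.three_point zero_le h
  simpa [hψ.zero] using this

theorem IsDissipation.monotone (hψ : IsDissipation ψ) : Monotone ψ := by
  intro v w h
  have h1 := hψ.mul_le h
  rcases eq_or_ne w 0 with rfl | hw
  · rw [le_antisymm h zero_le]
  have h2 : (v : ℝ) ≤ w := by exact_mod_cast h
  have h3 : (0 : ℝ) < w := by positivity
  have h4 : (v : ℝ) * ψ w ≤ w * ψ w := mul_le_mul_of_nonneg_right h2 (by positivity)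
  have h5 : (ψ v : ℝ) ≤ ψ w := le_of_mul_le_mul_left (h1.trans h4) h3
  exact_mod_cast h5

/-- A supporting line with nonnegative slope. -/
theorem IsDissipation.exists_support (hψ : IsDissipation ψ) (v : ℝ≥0) :
    ∃ c : ℝ≥0, ∀ w, ψ v + c * w ≤ ψ w + c * v := by
  -- The slope is the supremum of the left difference quotients, bounded by every right one. For v =
  -- 0 the set is empty and the default `sSup ∅ = 0` still works, because ψ is monotone.
  set S : Set ℝ := {x | ∃ w : ℝ≥0, w < v ∧ x = ((ψ v : ℝ) - ψ w) / (v - w)} with hS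
  have hub : ∀ z : ℝ≥0, v < z → ∀ x ∈ S, x ≤ ((ψ z : ℝ) - ψ v) / (z - v) := by
    rintro z hz x ⟨w, hw, rfl⟩
    have h3 := hψ.three_point hw.le hz.le
    have hw' : (0 : ℝ) < v - w := sub_pos.2 (by exact_mod_cast hw)
    have hz' : (0 : ℝ) < z - v := sub_pos.2 (by exact_mod_cast hz)
    rw [div_le_div_iff₀ hw' hz']
    nlinarith
  have hbdd : BddAbove S := ⟨_, hub (v + 1) (lt_add_one v)⟩
  have hc0 : 0 ≤ sSup S := by
    refine Real.sSup_nonneg ?_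
    rintro x ⟨w, hw, rfl⟩
    have hw' : (0 : ℝ) < v - w := sub_pos.2 (by exact_mod_cast hw)
    refine div_nonneg (sub_nonneg.2 ?_) hw'.le
    exact_mod_cast hψ.monotone hw.le
  refine ⟨⟨sSup S, hc0⟩, fun w => ?_⟩
  rw [← NNReal.coe_le_coe]
  push_cast
  change (ψ v : ℝ) + sSup S * w ≤ ψ w + sSup S * v
  rcases lt_trichotomy w v with hw | rfl | hw
  · have hw' : (0 : ℝ) < v - w := sub_pos.2 (by exact_mod_cast hw)
    have := le_csSup hbdd ⟨w, hw, rfl⟩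
    rw [div_le_iff₀ hw'] at this
    linarith
  · rfl
  · have hw' : (0 : ℝ) < w - v := sub_pos.2 (by exact_mod_cast hw)
    have hle : sSup S ≤ ((ψ w : ℝ) - ψ v) / (w - v) := by
      rcases S.eq_empty_or_nonempty with he | hne
      · rw [he, Real.sSup_empty]
        refine div_nonneg (sub_nonneg.2 ?_) hw'.le
        exact_mod_cast hψ.monotone hw.le
      · exact csSup_le hne (hub w hw)
    rw [le_div_iff₀ hw'] at hle
    linarith

/-- The lower semicontinuous monotone extension of `ψ` to `[0,∞]`. -/
noncomputable def lscExt (ψ : ℝ≥0 → ℝ≥0) (x : ℝ≥0∞) : ℝ≥0∞ :=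
  ⨆ (v : ℝ≥0) (_ : (v : ℝ≥0∞) < x), (ψ v : ℝ≥0∞)

theorem lscExt_mono (ψ : ℝ≥0 → ℝ≥0) : Monotone (lscExt ψ) := fun _ _ h =>
  iSup_mono fun _ => iSup_mono' fun hv => ⟨hv.trans_le h, le_rfl⟩

/-- This is left continuity of a finite convex function: the supremum over v < x already reaches
ψ(x). -/
theorem IsDissipation.le_lscExt (hψ : IsDissipation ψ) (x : ℝ≥0) : (ψ x : ℝ≥0∞) ≤ lscExt ψ x := by
  rcases eq_or_ne x 0 with rfl | hx
  · simp [hψ.zero]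
  refine ENNReal.le_of_forall_pos_le_add fun ε hε _ => ?_
  have hxpos : (0 : ℝ) < x := by positivity
  have hD : (0 : ℝ) ≤ ψ (x + 1) := by positivity
  have hε' : (0 : ℝ) < ε := by exact_mod_cast hε
  -- a point slightly to the left
  set θ : ℝ := min (x / 2) (ε / (ψ (x + 1) + 1)) with hθ
  have hθ0 : 0 < θ := by rw [hθ]; positivity
  have hθx : θ < x := (min_le_left _ _).trans_lt (by linarith)
  have hθε : θ * ψ (x + 1) ≤ ε := by
    have : θ ≤ ε / (ψ (x + 1) + 1) := min_le_right _ _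
    rw [le_div_iff₀ (by positivity)] at this
    nlinarith
  set v : ℝ≥0 := ⟨x - θ, by linarith⟩ with hv
  have hvR : (v : ℝ) = x - θ := rfl
  have hvx : v < x := by rw [← NNReal.coe_lt_coe, hvR]; linarith
  have h3 := hψ.three_point hvx.le (le_add_of_nonneg_right zero_le_one : x ≤ x + 1)
  have h4 : (ψ x : ℝ) ≤ ψ v + ε := by
    push_cast at h3
    rw [hvR] at h3
    have : (ψ v : ℝ) ≤ ψ x := by exact_mod_cast hψ.monotone hvx.le
    have hx0 : (0 : ℝ) ≤ ψ x := by positivity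
    nlinarith
  have h5 : (ψ x : ℝ≥0∞) ≤ ψ v + ε := by exact_mod_cast h4
  refine h5.trans (add_le_add_left ?_ _)
  exact le_iSup₂_of_le v (by exact_mod_cast hvx) le_rfl

/-- Superlinearity, with a bound uniform along a pointwise convergent family. -/
theorem exists_superlinear_bound {ψh : ℕ → ℝ≥0 → ℝ≥0} (hψh : ∀ h, IsDissipation (ψh h))
    (hlim : ∀ v : ℝ≥0, Tendsto (fun h => ψh h v) atTop (𝓝 (ψ v))) (hs : IsSuperlinear ψ)
    (M : ℝ≥0) : ∃ c : ℝ≥0, ∀ᶠ h in atTop, ∀ v, M * v ≤ ψh h v + c := by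
  have h1 : ∀ᶠ v : ℝ≥0 in atTop, ((M : ℝ≥0∞)) < (ψ v : ℝ≥0∞) / (v : ℝ≥0∞) :=
    hs.eventually (lt_mem_nhds ENNReal.coe_lt_top)
  obtain ⟨v₀, hv₀, hv₀pos⟩ := (h1.and (eventually_gt_atTop 0)).exists
  have h2 : M * v₀ < ψ v₀ := by
    rw [ENNReal.lt_div_iff_mul_lt (Or.inl (by simpa using hv₀pos.ne')) (by simp)] at hv₀
    exact_mod_cast hv₀
  -- Below v₀ the constant suffices; above v₀ the quotient ψ_h(v)/v only grows, so convergence at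
  -- the single point v₀ makes the bound uniform in large h.
  refine ⟨M * v₀, ?_⟩
  filter_upwards [(hlim v₀).eventually (lt_mem_nhds h2)] with h hh v
  rcases le_total v v₀ with hv | hv
  · exact le_add_of_nonneg_of_le zero_le (mul_le_mul_right hv _)
  · refine le_add_of_le_of_nonneg ?_ zero_le
    have h3 := (hψh h).mul_le hv
    have h4 : (M : ℝ) * v₀ ≤ ψh h v₀ := by exact_mod_cast hh.le
    have h5 : (0 : ℝ) < v₀ := by exact_mod_cast hv₀pos
    have h6 : (M : ℝ) * v ≤ ψh h v := by
      refine le_of_mul_le_mul_left ?_ h5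
      have : (0 : ℝ) ≤ v := by positivity
      nlinarith
    exact_mod_cast h6

/-! ### The dual function -/

theorem dual_mono (ψ : ℝ≥0 → ℝ≥0) : Monotone (dual ψ) := fun _ _ h =>
  iSup_mono fun _ => tsub_le_tsub_right (mul_le_mul_left h _) _

theorem mul_le_add_dual (ψ : ℝ≥0 → ℝ≥0) (f : ℝ≥0∞) (v : ℝ≥0) : f * v ≤ ψ v + dual ψ f := by
  rw [add_comm, ← tsub_le_iff_right]
  exact le_iSup (fun v : ℝ≥0 => f * (v : ℝ≥0∞) - ((ψ v : ℝ≥0) : ℝ≥0∞)) v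

theorem le_dual_add (ψ : ℝ≥0 → ℝ≥0) (f : ℝ≥0∞) : f ≤ dual ψ f + ψ 1 := by
  simpa [add_comm] using mul_le_add_dual ψ f 1

theorem ne_top_of_dual_ne_top {f : ℝ≥0∞} (h : dual ψ f ≠ ∞) : f ≠ ∞ :=
  ne_top_of_le_ne_top (ENNReal.add_ne_top.2 ⟨h, ENNReal.coe_ne_top⟩) (le_dual_add ψ f)

/-- The dual function is lower semicontinuous, jointly with respect to pointwise convergence. -/
theorem dual_le_of_tendsto {ι : Type*} {l : Filter ι} [l.NeBot] {ψh : ι → ℝ≥0 → ℝ≥0}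
    (hlim : ∀ v : ℝ≥0, Tendsto (fun h => ψh h v) l (𝓝 (ψ v))) {f : ι → ℝ≥0∞} {f₀ d : ℝ≥0∞}
    (hf : Tendsto f l (𝓝 f₀)) (hd : Tendsto (fun h => dual (ψh h) (f h)) l (𝓝 d)) :
    dual ψ f₀ ≤ d := by
  refine iSup_le fun v => ?_
  rcases eq_or_ne v 0 with rfl | hv
  · simp
  rw [tsub_le_iff_left]
  have h1 : Tendsto (fun h => f h * (v : ℝ≥0∞)) l (𝓝 (f₀ * v)) :=
    ENNReal.Tendsto.mul_const hf (Or.inr ENNReal.coe_ne_top)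
  have h2 : Tendsto (fun h => ((ψh h v : ℝ≥0∞)) + dual (ψh h) (f h)) l (𝓝 (ψ v + d)) :=
    (ENNReal.tendsto_coe.2 (hlim v)).add hd
  exact le_of_tendsto_of_tendsto' h1 h2 fun h => mul_le_add_dual _ _ _

/-- The dual of a superlinear function is locally Lipschitz on `[0,∞)`. -/
theorem exists_dual_le_add (hψ : IsSuperlinear ψ) (Q : ℝ≥0) :
    ∃ R : ℝ≥0, ∀ f q : ℝ≥0, q ≤ Q → dual ψ q ≤ dual ψ f + ((q - f : ℝ≥0) : ℝ≥0∞) * R := by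
  have h1 : ∀ᶠ v : ℝ≥0 in atTop, ((Q : ℝ≥0∞)) < (ψ v : ℝ≥0∞) / (v : ℝ≥0∞) :=
    hψ.eventually (lt_mem_nhds ENNReal.coe_lt_top)
  obtain ⟨R, hR⟩ := eventually_atTop.1 (h1.and (eventually_gt_atTop 0))
  -- For v ≥ R and q ≤ Q the term qv - ψ(v) is not positive, so only v ≤ R matter and R is a
  -- Lipschitz constant.
  refine ⟨R, fun f q hq => iSup_le fun v => ?_⟩
  rw [tsub_le_iff_left]
  rcases le_total R v with hv | hv
  · obtain ⟨h2, h3⟩ := hR v hv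
    rw [ENNReal.lt_div_iff_mul_lt (Or.inl (by simpa using h3.ne')) (by simp)] at h2
    refine le_add_of_le_of_nonneg (le_trans ?_ h2.le) zero_le
    exact mul_le_mul_left (by exact_mod_cast hq) _
  · have h2 := mul_le_add_dual ψ f v
    have h3 : (q : ℝ≥0∞) ≤ f + ((q - f : ℝ≥0) : ℝ≥0∞) := by exact_mod_cast le_add_tsub
    calc (q : ℝ≥0∞) * v ≤ (f + ((q - f : ℝ≥0) : ℝ≥0∞)) * v := mul_le_mul_left h3 _
      _ = f * v + ((q - f : ℝ≥0) : ℝ≥0∞) * v := add_mul _ _ _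
      _ ≤ (ψ v + dual ψ f) + ((q - f : ℝ≥0) : ℝ≥0∞) * R := by
        gcongr
      _ = _ := add_assoc _ _ _

/-- Right continuity of the dual function. -/
theorem exists_gt_dual_le_add (hψ : IsSuperlinear ψ) (f : ℝ≥0) {ε : ℝ≥0∞} (hε : 0 < ε) :
    ∃ g : ℝ≥0, f < g ∧ ∀ q : ℝ≥0, q ≤ g → dual ψ q ≤ dual ψ f + ε := by
  obtain ⟨R, hR⟩ := exists_dual_le_add hψ (f + 1)
  obtain ⟨ε', hε'0, hε'⟩ := ENNReal.lt_iff_exists_nnreal_btwn.1 hε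
  have hε'0 : 0 < ε' := by exact_mod_cast hε'0
  -- The minimum with 1 stays inside the range f + 1 for which R was chosen; R + 1 avoids division
  -- by zero.
  refine ⟨f + min 1 (ε' / (R + 1)), lt_add_of_pos_right _ (lt_min one_pos (by positivity)), ?_⟩
  intro q hq
  refine (hR f q (hq.trans (add_le_add_right (min_le_left _ _) _))).trans ?_
  refine add_le_add_right (le_trans ?_ hε'.le) _
  have h1 : q - f ≤ ε' / (R + 1) :=
    tsub_le_iff_left.2 (hq.trans (add_le_add_right (min_le_right _ _) _))
  have h2 : (q - f) * R ≤ ε' := by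
    calc (q - f) * R ≤ ε' / (R + 1) * (R + 1) := by gcongr; exact le_self_add
      _ = ε' := by field_simp
  exact_mod_cast h2

theorem measurable_dual (ψ : ℝ≥0 → ℝ≥0) : Measurable (dual ψ) := (dual_mono ψ).measurable

end Dissipation

/-! ### Lower semicontinuity of the dissipation along converging curves -/

/-- Fatou's lemma in the form needed along `along H`, where measurability is known only for indices
in H. -/
theorem lintegral_liminf_le_of_eventually {α ι : Type*} [MeasurableSpace α] {μ : Measure α}
    {f : ι → α → ℝ≥0∞} {l : Filter ι} [l.IsCountablyGenerated]
    (hf : ∀ᶠ i in l, AEMeasurable (f i) μ) :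
    ∫⁻ a, liminf (fun i => f i a) l ∂μ ≤ liminf (fun i => ∫⁻ a, f i a ∂μ) l := by
  classical
  set g : ι → α → ℝ≥0∞ := fun i => if AEMeasurable (f i) μ then f i else 0 with hg
  have hgm : ∀ i, AEMeasurable (g i) μ := by
    intro i
    by_cases h : AEMeasurable (f i) μ
    · simp [hg, h]
    · simp only [hg, h, if_false]
      exact aemeasurable_const (b := (0 : ℝ≥0∞))
  have hgf : ∀ᶠ i in l, g i = f i := by
    filter_upwards [hf] with i hi
    simp [hg, hi]
  calc ∫⁻ a, liminf (fun i => f i a) l ∂μ = ∫⁻ a, liminf (fun i => g i a) l ∂μ := by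
        refine lintegral_congr fun a => liminf_congr ?_
        filter_upwards [hgf] with i hi; rw [hi]
    _ ≤ liminf (fun i => ∫⁻ a, g i a ∂μ) l := lintegral_liminf_le' hgm
    _ = _ := by
        refine liminf_congr ?_
        filter_upwards [hgf] with i hi; rw [hi]

/-- A strict bound v < liminf x holds eventually for x_h itself, so only convergence of ψ_h at the
fixed point v is used. This is why `lscExt` takes the supremum over strictly smaller v. -/
theorem lscExt_liminf_le {ι : Type*} {l : Filter ι} {ψ : ℝ≥0 → ℝ≥0} {ψh : ι → ℝ≥0 → ℝ≥0}
    (hlim : ∀ v : ℝ≥0, Tendsto (fun h => ψh h v) l (𝓝 (ψ v))) (x : ι → ℝ≥0∞) :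
    lscExt ψ (liminf x l) ≤ liminf (fun h => lscExt (ψh h) (x h)) l := by
  rcases l.eq_or_neBot with rfl | _
  · simp
  refine iSup₂_le fun v hv => ?_
  rw [← (ENNReal.tendsto_coe.2 (hlim v)).liminf_eq]
  refine liminf_le_liminf ?_
  filter_upwards [eventually_lt_of_lt_liminf hv] with h hh
  exact le_iSup₂_of_le v hh le_rfl

/-- Fatou is used twice: along `l` for a fixed step, on an interval shortened by that step so that r
+ step n does not exceed t, and then in n. -/
theorem lintegral_lscExt_le_liminf {ι : Type*} {l : Filter ι} [l.IsCountablyGenerated]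
    {ψ : ℝ≥0 → ℝ≥0} {ψh : ι → ℝ≥0 → ℝ≥0}
    (hlim : ∀ v : ℝ≥0, Tendsto (fun h => ψh h v) l (𝓝 (ψ v)))
    {t : ℝ} {Q : ℕ → ℝ → ℝ≥0∞} {Qh : ι → ℕ → ℝ → ℝ≥0∞} {A : ι → ℝ≥0∞}
    (hQm : ∀ n, Measurable (Q n)) (hQhm : ∀ᶠ h in l, ∀ n, Measurable (Qh h n))
    (hQ : ∀ n, ∀ r ∈ Ioc 0 (t - step n), Q n r ≤ liminf (fun h => Qh h n r) l)
    (hA : ∀ᶠ h in l, ∀ n, ∫⁻ r in Ioc 0 (t - step n), lscExt (ψh h) (Qh h n r) ≤ A h) :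
    ∫⁻ r in Ioc 0 t, lscExt ψ (liminf (fun n => Q n r) atTop) ≤ liminf A l := by
  have h1 : ∀ n, ∫⁻ r in Ioc 0 (t - step n), lscExt ψ (Q n r) ≤ liminf A l := by
    intro n
    calc ∫⁻ r in Ioc 0 (t - step n), lscExt ψ (Q n r)
        ≤ ∫⁻ r in Ioc 0 (t - step n), liminf (fun h => lscExt (ψh h) (Qh h n r)) l := by
          refine setLIntegral_mono' measurableSet_Ioc fun r hr => ?_
          exact (lscExt_mono ψ (hQ n r hr)).trans (lscExt_liminf_le hlim _)
      _ ≤ liminf (fun h => ∫⁻ r in Ioc 0 (t - step n), lscExt (ψh h) (Qh h n r)) l := by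
          refine lintegral_liminf_le_of_eventually ?_
          filter_upwards [hQhm] with h hh
          exact ((lscExt_mono _).measurable.comp (hh n)).aemeasurable
      _ ≤ liminf A l := liminf_le_liminf (hA.mono fun h hh => hh n)
  -- The indicator moves the shortening into the integrand; every r < t eventually lies in the
  -- shortened interval.
  set f : ℕ → ℝ → ℝ≥0∞ := fun n => (Ioc 0 (t - step n)).indicator fun r => lscExt ψ (Q n r) with hf
  have hfm : ∀ n, Measurable (f n) := fun n =>
    ((lscExt_mono _).measurable.comp (hQm n)).indicator measurableSet_Ioc
  have h2 : ∀ n, ∫⁻ r in Ioc 0 t, f n r ≤ liminf A l := by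
    intro n
    refine le_trans ?_ (h1 n)
    refine (setLIntegral_le_lintegral _ _).trans ?_
    rw [hf, lintegral_indicator measurableSet_Ioc]
  calc ∫⁻ r in Ioc 0 t, lscExt ψ (liminf (fun n => Q n r) atTop)
      ≤ ∫⁻ r in Ioc 0 t, liminf (fun n => f n r) atTop := by
        refine lintegral_mono_ae (ae_restrict_Ioc_of_Ioo (ae_of_all _ fun r hr => ?_))
        refine (lscExt_liminf_le (ψh := fun _ => ψ) (fun _ => tendsto_const_nhds) _).trans ?_
        refine (liminf_congr ?_).le
        have h0 : Tendsto step atTop (𝓝 0) := tendsto_step.mono_right nhdsWithin_le_nhds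
        filter_upwards [h0.eventually (gt_mem_nhds (sub_pos.2 hr.2))] with n hn
        have hm : r ∈ Ioc 0 (t - step n) := ⟨hr.1, by linarith⟩
        simp [hf, indicator_of_mem hm]
    _ ≤ liminf (fun n => ∫⁻ r in Ioc 0 t, f n r) atTop := lintegral_liminf_le hfm
    _ ≤ liminf (fun _ => liminf A l) (atTop : Filter ℕ) :=
        liminf_le_liminf (Eventually.of_forall h2)
    _ = _ := liminf_const _

/-- Tonelli: the inner integral runs over shifts σ in (0, τ], and for each shift the integral of G
extended by zero is translation invariant. -/
theorem lintegral_lintegral_Ioc_add_le {G : ℝ → ℝ≥0∞} (hG : Measurable G) {t τ : ℝ} :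
    ∫⁻ r in Ioc 0 (t - τ), ∫⁻ s in Ioc r (r + τ), G s ≤
      ENNReal.ofReal τ * ∫⁻ s in Ioc 0 t, G s := by
  set G' : ℝ → ℝ≥0∞ := (Ioc 0 t).indicator G with hG'
  have hG'm : Measurable G' := hG.indicator measurableSet_Ioc
  have h1 : ∀ r ∈ Ioc 0 (t - τ), ∫⁻ s in Ioc r (r + τ), G s = ∫⁻ σ in Ioc 0 τ, G' (r + σ) := by
    intro r hr
    rw [← lintegral_indicator measurableSet_Ioc, ← lintegral_indicator measurableSet_Ioc,
      ← lintegral_add_left_eq_self (μ := volume) _ r]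
    refine lintegral_congr fun σ => ?_
    by_cases hσ : σ ∈ Ioc 0 τ
    · have h2 : r + σ ∈ Ioc r (r + τ) := ⟨by linarith [hσ.1], by linarith [hσ.2]⟩
      have h3 : r + σ ∈ Ioc 0 t := ⟨by linarith [hσ.1, hr.1], by linarith [hσ.2, hr.2]⟩
      rw [indicator_of_mem h2, indicator_of_mem hσ, hG', indicator_of_mem h3]
    · have h2 : r + σ ∉ Ioc r (r + τ) := fun h => hσ ⟨by linarith [h.1], by linarith [h.2]⟩
      rw [indicator_of_notMem h2, indicator_of_notMem hσ]
  have hm : Measurable (Function.uncurry fun r σ : ℝ => G' (r + σ)) :=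
    hG'm.comp (measurable_fst.add measurable_snd)
  rw [setLIntegral_congr_fun measurableSet_Ioc h1, lintegral_lintegral_swap hm.aemeasurable]
  calc ∫⁻ σ in Ioc 0 τ, ∫⁻ r in Ioc 0 (t - τ), G' (r + σ)
      ≤ ∫⁻ σ in Ioc 0 τ, ∫⁻ s in Ioc 0 t, G s := by
        refine lintegral_mono fun σ => ?_
        refine (setLIntegral_le_lintegral _ _).trans ?_
        rw [lintegral_add_right_eq_self (μ := volume) G' σ, hG',
          lintegral_indicator measurableSet_Ioc]
    _ = _ := by simp [mul_comm]

theorem coe_superlinear_le {ψ : ℝ≥0 → ℝ≥0} {M c : ℝ≥0} (hM : ∀ v, M * v ≤ ψ v + c) {x : ℝ≥0∞}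
    (hx : x ≠ ∞) : M * x ≤ (ψ x.toNNReal : ℝ≥0∞) + c := by
  lift x to ℝ≥0 using hx
  exact_mod_cast hM x

/-! ### Jensen's inequality and superlinear control of increments -/

section Metric

variable {X : Type*} [PseudoEMetricSpace X] {ψ : ℝ≥0 → ℝ≥0}

/-- Density of the dissipation of velocity along a curve. -/
noncomputable def velDiss (d : X → X → ℝ≥0∞) (ψ : ℝ≥0 → ℝ≥0) (u : ℝ → X) (r : ℝ) : ℝ≥0∞ :=
  ((ψ (metricDeriv d u r).toNNReal : ℝ≥0) : ℝ≥0∞)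

theorem IsAC.aemeasurable_velDiss {a b : ℝ} (hab : a ≤ b) {u : ℝ → X}
    (hu : IsAC (fun x y : X => edist x y) a b u) (hψ : IsDissipation ψ) :
    AEMeasurable (velDiss (fun x y => edist x y) ψ u) (volume.restrict (Ioc a b)) :=
  (hψ.monotone.measurable.comp_aemeasurable
    (hu.aemeasurable_metricDeriv hab).ennreal_toNNReal).coe_nnreal_ennreal

theorem IsAC.ae_metricDeriv_ne_top {a b : ℝ} (hab : a ≤ b) {u : ℝ → X}
    (hu : IsAC (fun x y : X => edist x y) a b u) :
    ∀ᵐ r ∂volume.restrict (Ioc a b), metricDeriv (fun x y => edist x y) u r ≠ ∞ := by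
  filter_upwards [ae_lt_top' (hu.aemeasurable_metricDeriv hab)
    (hu.lintegral_metricDeriv_ne_top hab)] with r hr using hr.ne

/-- Jensen's inequality for a single increment. -/
theorem IsAC.lscExt_edist_div_le {a b : ℝ} {u : ℝ → X}
    (hu : IsAC (fun x y : X => edist x y) a b u) (hψ : IsDissipation ψ) {r τ : ℝ} (hr : a ≤ r)
    (hτ : 0 < τ) (hrb : r + τ ≤ b) :
    ENNReal.ofReal τ * lscExt ψ (edist (u (r + τ)) (u r) / ENNReal.ofReal τ) ≤
      ∫⁻ s in Ioc r (r + τ), velDiss (fun x y => edist x y) ψ u s := by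
  have hab : a ≤ b := by linarith
  have hsub : Ioc r (r + τ) ⊆ Ioc a b := Ioc_subset_Ioc hr hrb
  have hmono := Measure.restrict_mono hsub (le_refl (volume : Measure ℝ))
  have hτ' : ENNReal.ofReal τ ≠ 0 := by simpa using hτ
  rw [lscExt, ENNReal.mul_iSup]
  refine iSup_le fun v => ?_
  rw [ENNReal.mul_iSup]
  refine iSup_le fun hv => ?_
  -- Jensen via the supporting line at v: it is integrated over the increment, whose mean speed is
  -- at least v, and the linear terms are then cancelled.
  obtain ⟨c, hc⟩ := hψ.exists_support v
  set md := metricDeriv (fun x y => edist x y) u with hmd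
  have hdist : edist (u (r + τ)) (u r) ≤ ∫⁻ s in Ioc r (r + τ), md s := by
    rw [edist_comm]; exact hu.edist_le_lintegral_metricDeriv hr (by linarith) hrb
  have hvτ : (v : ℝ≥0∞) * ENNReal.ofReal τ ≤ ∫⁻ s in Ioc r (r + τ), md s := by
    rw [ENNReal.lt_div_iff_mul_lt (Or.inl hτ') (Or.inl ENNReal.ofReal_ne_top)] at hv
    exact hv.le.trans hdist
  have hmdm : AEMeasurable md (volume.restrict (Ioc r (r + τ))) :=
    (hu.aemeasurable_metricDeriv hab).mono_measure hmono
  have hle : ∫⁻ s in Ioc r (r + τ), ((ψ v : ℝ≥0∞) + c * md s) ≤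
      ∫⁻ s in Ioc r (r + τ), (velDiss (fun x y => edist x y) ψ u s + c * v) := by
    refine lintegral_mono_ae ?_
    filter_upwards [ae_mono hmono (hu.ae_metricDeriv_ne_top hab)] with s hs
    rw [velDiss, ← hmd]
    lift md s to ℝ≥0 using hs with x
    exact_mod_cast hc x
  rw [lintegral_add_left measurable_const, lintegral_add_right _ measurable_const,
    lintegral_const_mul'' _ hmdm] at hle
  simp only [lintegral_const, Measure.restrict_apply MeasurableSet.univ, univ_inter,
    Real.volume_Ioc, add_sub_cancel_left] at hle
  have hfin : (c : ℝ≥0∞) * v * ENNReal.ofReal τ ≠ ∞ := by finiteness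
  rw [mul_comm (ENNReal.ofReal τ)]
  refine (ENNReal.add_le_add_iff_right hfin).1 (le_trans ?_ hle)
  rw [mul_assoc]
  gcongr

/-- The dissipation of the difference quotients is bounded by the dissipation of the curve. -/
theorem IsAC.lintegral_lscExt_diffQuot_le {T t : ℝ} {u : ℝ → X}
    (hu : IsAC (fun x y : X => edist x y) 0 T u) (hψ : IsDissipation ψ) (ht0 : 0 ≤ t) (ht : t ≤ T)
    {τ : ℝ} (hτ : 0 < τ) :
    ∫⁻ r in Ioc 0 (t - τ), lscExt ψ (diffQuot 0 T u τ r) ≤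
      ∫⁻ r in Ioc 0 t, velDiss (fun x y => edist x y) ψ u r := by
  have hT : 0 ≤ T := ht0.trans ht
  have hτ' : ENNReal.ofReal τ ≠ 0 := by simpa using hτ
  obtain ⟨G, hGm, hGe⟩ := (hu.aemeasurable_velDiss hT hψ)
  have hG : ∀ p q, 0 ≤ p → q ≤ T → ∫⁻ r in Ioc p q, velDiss (fun x y => edist x y) ψ u r
      = ∫⁻ r in Ioc p q, G r := fun p q hp hq =>
    lintegral_congr_ae (ae_mono (Measure.restrict_mono (Ioc_subset_Ioc hp hq) le_rfl) hGe)
  rw [hG 0 t le_rfl ht]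
  have h1 : ENNReal.ofReal τ * ∫⁻ r in Ioc 0 (t - τ), lscExt ψ (diffQuot 0 T u τ r) ≤
      ENNReal.ofReal τ * ∫⁻ r in Ioc 0 t, G r := by
    rw [← lintegral_const_mul' _ _ ENNReal.ofReal_ne_top]
    refine le_trans (setLIntegral_mono' measurableSet_Ioc fun r hr => ?_)
      (lintegral_lintegral_Ioc_add_le hGm)
    have hrT : r + τ ≤ T := by linarith [hr.2]
    rw [diffQuot, clamp_of_mem ⟨by linarith [hr.1], hrT⟩, clamp_of_mem ⟨hr.1.le, by linarith⟩,
      ← hG _ _ hr.1.le hrT]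
    exact hu.lscExt_edist_div_le hψ hr.1.le hτ hrT
  exact (ENNReal.mul_le_mul_iff_right hτ' ENNReal.ofReal_ne_top).1 h1

/-! ### Equi-absolute continuity -/

open AbsolutelyContinuousOnInterval in
/-- Superlinear dissipation controls increments along disjoint intervals. -/
theorem IsAC.sum_edist_le {T : ℝ} (hT : 0 ≤ T) {u : ℝ → X}
    (hu : IsAC (fun x y : X => edist x y) 0 T u) {M c : ℝ≥0}
    (hM : ∀ v, M * v ≤ ψ v + c) {E : ℕ × (ℕ → ℝ × ℝ)} (hE : E ∈ disjWithin 0 T) :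
    M * ∑ i ∈ Finset.range E.1, edist (u (E.2 i).1) (u (E.2 i).2) ≤
      (∫⁻ r in Ioc 0 T, velDiss (fun x y => edist x y) ψ u r) +
        c * ENNReal.ofReal (∑ i ∈ Finset.range E.1, dist (E.2 i).1 (E.2 i).2) := by
  set md := metricDeriv (fun x y => edist x y) u with hmd
  set B : Set ℝ := ⋃ i ∈ Finset.range E.1, uIoc (E.2 i).1 (E.2 i).2 with hB
  have hBm : MeasurableSet B := Finset.measurableSet_biUnion _ fun _ _ => measurableSet_uIoc
  have hBsub : B ⊆ Ioc 0 T := by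
    rw [← uIoc_of_le hT]; exact biUnion_uIoc_subset_of_mem_disjWithin hE
  have hmono := Measure.restrict_mono hBsub (le_refl (volume : Measure ℝ))
  have hinc : ∀ i ∈ Finset.range E.1,
      edist (u (E.2 i).1) (u (E.2 i).2) ≤ ∫⁻ r in uIoc (E.2 i).1 (E.2 i).2, md r := by
    intro i hi
    have h12 := hE.1 i hi
    rw [uIcc_of_le hT] at h12
    rcases le_total (E.2 i).1 (E.2 i).2 with h | h
    · rw [uIoc_of_le h]
      exact hu.edist_le_lintegral_metricDeriv h12.1.1 h h12.2.2
    · rw [uIoc_of_ge h, edist_comm]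
      exact hu.edist_le_lintegral_metricDeriv h12.2.1 h h12.1.2
  have hvol : ∀ i, volume (uIoc (E.2 i).1 (E.2 i).2) = ENNReal.ofReal (dist (E.2 i).1 (E.2 i).2) :=
    fun i => by simp [uIoc, Real.dist_eq, max_sub_min_eq_abs']
  calc (M : ℝ≥0∞) * ∑ i ∈ Finset.range E.1, edist (u (E.2 i).1) (u (E.2 i).2)
      ≤ M * ∑ i ∈ Finset.range E.1, ∫⁻ r in uIoc (E.2 i).1 (E.2 i).2, md r := by
        gcongr with i hi; exact hinc i hi
    _ = M * ∫⁻ r in B, md r := by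
        rw [hB, lintegral_biUnion_finset hE.2 fun _ _ => measurableSet_uIoc]
    _ = ∫⁻ r in B, M * md r := (lintegral_const_mul' _ _ ENNReal.coe_ne_top).symm
    _ ≤ ∫⁻ r in B, (velDiss (fun x y => edist x y) ψ u r + c) := by
        refine lintegral_mono_ae ?_
        filter_upwards [ae_mono hmono (hu.ae_metricDeriv_ne_top hT)] with s hs
        exact coe_superlinear_le hM hs
    _ = (∫⁻ r in B, velDiss (fun x y => edist x y) ψ u r) + c * volume B := by
        rw [lintegral_add_right _ measurable_const]; simp
    _ ≤ _ := by
        refine add_le_add (lintegral_mono_set hBsub) (mul_le_mul_right ?_ _)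
        rw [ENNReal.ofReal_sum_of_nonneg fun _ _ => dist_nonneg]
        refine (measure_biUnion_finset_le _ _).trans ?_
        exact Finset.sum_le_sum fun i _ => (hvol i).le

open AbsolutelyContinuousOnInterval in
/-- A curve whose increments are controlled by superlinear dissipation has absolutely continuous
distance functions. -/
theorem absolutelyContinuous_edist_of_sum_le {T : ℝ} (hT : 0 ≤ T) {u : ℝ → X} {C : ℝ≥0}
    (h : ∀ M : ℝ≥0, ∃ c : ℝ≥0, ∀ E ∈ disjWithin 0 T,
      M * ∑ i ∈ Finset.range E.1, edist (u (E.2 i).1) (u (E.2 i).2) ≤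
      C + c * ENNReal.ofReal (∑ i ∈ Finset.range E.1, dist (E.2 i).1 (E.2 i).2)) :
    (∀ s ∈ Icc 0 T, ∀ t ∈ Icc 0 T, edist (u s) (u t) ≠ ∞) ∧
    ∀ s ∈ Icc 0 T,
      AbsolutelyContinuousOnInterval (fun t => (edist (u s) (u t)).toReal) 0 T := by
  have hfin : ∀ s ∈ Icc 0 T, ∀ t ∈ Icc 0 T, edist (u s) (u t) ≠ ∞ := by
    intro s hs t ht
    obtain ⟨c, hc⟩ := h 1
    -- Finiteness comes from the hypothesis with M = 1 and the single interval with endpoints s, t.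
    have hE : ((1, fun _ => (s, t)) : ℕ × (ℕ → ℝ × ℝ)) ∈ disjWithin 0 T := by
      refine ⟨fun i _ => ?_, ?_⟩
      · simp only [uIcc_of_le hT]; exact ⟨hs, ht⟩
      · simp
    have := hc _ hE
    simp only [ENNReal.coe_one, one_mul, Finset.range_one, Finset.sum_singleton] at this
    exact ne_top_of_le_ne_top (by finiteness) this
  refine ⟨hfin, fun s hs => ?_⟩
  rw [absolutelyContinuousOnInterval_iff]
  intro ε hε
  -- With δ = 1/(c+1) the length term stays below 1, so M times the sum of increments is below C + 1
  -- = Mε.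
  set M : ℝ≥0 := (C + 1) / ε.toNNReal with hM
  have hεp : 0 < ε.toNNReal := by simpa using hε
  have hMp : 0 < M := by positivity
  obtain ⟨c, hc⟩ := h M
  refine ⟨1 / (c + 1), by positivity, fun E hE hsum => ?_⟩
  have h1 := hc E hE
  have hmem : ∀ i ∈ Finset.range E.1, (E.2 i).1 ∈ Icc 0 T ∧ (E.2 i).2 ∈ Icc 0 T := by
    intro i hi; have := hE.1 i hi; rwa [uIcc_of_le hT] at this
  have hsfin : ∑ i ∈ Finset.range E.1, edist (u (E.2 i).1) (u (E.2 i).2) ≠ ∞ :=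
    ENNReal.sum_ne_top.2 fun i hi => hfin _ (hmem i hi).1 _ (hmem i hi).2
  have h2 : (M : ℝ) * (∑ i ∈ Finset.range E.1, edist (u (E.2 i).1) (u (E.2 i).2)).toReal ≤
      C + c * ∑ i ∈ Finset.range E.1, dist (E.2 i).1 (E.2 i).2 := by
    have := ENNReal.toReal_mono (by finiteness) h1
    rwa [ENNReal.toReal_mul, ENNReal.toReal_add (by finiteness) (by finiteness),
      ENNReal.toReal_mul, ENNReal.toReal_ofReal (Finset.sum_nonneg fun _ _ => dist_nonneg)] at this
  have h3 : ∑ i ∈ Finset.range E.1, dist (edist (u s) (u (E.2 i).1)).toReal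
      (edist (u s) (u (E.2 i).2)).toReal ≤
      (∑ i ∈ Finset.range E.1, edist (u (E.2 i).1) (u (E.2 i).2)).toReal := by
    rw [ENNReal.toReal_sum fun i hi => hfin _ (hmem i hi).1 _ (hmem i hi).2]
    refine Finset.sum_le_sum fun i hi => ?_
    obtain ⟨m1, m2⟩ := hmem i hi
    have f1 := hfin s hs _ m1
    have f2 := hfin s hs _ m2
    have f3 := hfin _ m1 _ m2
    have t1 := ENNReal.toReal_mono (ENNReal.add_ne_top.2 ⟨f1, f3⟩)
      (edist_triangle (u s) (u (E.2 i).1) (u (E.2 i).2))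
    have t2 := ENNReal.toReal_mono (ENNReal.add_ne_top.2 ⟨f2, edist_comm (u (E.2 i).1) _ ▸ f3⟩)
      (edist_triangle (u s) (u (E.2 i).2) (u (E.2 i).1))
    rw [ENNReal.toReal_add f1 f3] at t1
    rw [ENNReal.toReal_add f2 (edist_comm (u (E.2 i).1) _ ▸ f3), edist_comm (u (E.2 i).2)] at t2
    rw [Real.dist_eq, abs_le]; constructor <;> linarith
  refine h3.trans_lt ?_
  have h4 : (c : ℝ) * ∑ i ∈ Finset.range E.1, dist (E.2 i).1 (E.2 i).2 < 1 := by
    have hc0 : (0 : ℝ) ≤ c := c.2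
    have hs0 : 0 ≤ ∑ i ∈ Finset.range E.1, dist (E.2 i).1 (E.2 i).2 :=
      Finset.sum_nonneg fun _ _ => dist_nonneg
    rw [lt_div_iff₀ (by positivity)] at hsum
    nlinarith
  have h5 : (M : ℝ) * ε = C + 1 := by
    rw [hM]; push_cast; rw [Real.coe_toNNReal _ hε.le]; field_simp
  have h6 : (0 : ℝ) < M := by exact_mod_cast hMp
  refine lt_of_mul_lt_mul_left ?_ h6.le
  linarith

end Metric

/-! ### Limits along infinite sets of indices -/

instance (H : Set ℕ) : (along H).IsCountablyGenerated :=
  inferInstanceAs (atTop ⊓ 𝓟 H : Filter ℕ).IsCountablyGenerated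

theorem along_mono {H H' : Set ℕ} (h : H' ⊆ H) : along H' ≤ along H :=
  inf_le_inf_left _ (principal_mono.2 h)

theorem along_le_atTop (H : Set ℕ) : along H ≤ atTop := inf_le_left

theorem mem_along_self (H : Set ℕ) : ∀ᶠ h in along H, h ∈ H :=
  mem_inf_of_right (mem_principal_self H)

theorem frequently_along {H : Set ℕ} {p : ℕ → Prop} :
    (∃ᶠ h in along H, p h) ↔ {h ∈ H | p h}.Infinite := by
  rw [along, frequently_inf_principal, Nat.frequently_atTop_iff_infinite]

theorem along_neBot {H : Set ℕ} (hH : H.Infinite) : (along H).NeBot := by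
  rw [← frequently_true_iff_neBot, frequently_along]
  simpa using hH

theorem eventually_along {H : Set ℕ} {p : ℕ → Prop} :
    (∀ᶠ h in along H, p h) ↔ ∀ᶠ h in atTop, h ∈ H → p h := by
  rw [along, eventually_inf_principal]

/-- Passing to the indices of a set that satisfy an eventual property. -/
theorem along_sep_eq {H : Set ℕ} {p : ℕ → Prop} (hp : ∀ᶠ h in along H, p h) :
    along {h ∈ H | p h} = along H := by
  refine le_antisymm (along_mono fun h hh => hh.1) (le_inf (along_le_atTop H) ?_)
  rw [le_principal_iff]
  exact (mem_along_self H).and hp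

theorem infinite_sep {H : Set ℕ} (hH : H.Infinite) {p : ℕ → Prop} (hp : ∀ᶠ h in along H, p h) :
    {h ∈ H | p h}.Infinite := by
  have := along_neBot hH
  exact frequently_along.1 hp.frequently

theorem exists_infinite_subset_tendsto {Y : Type*} [TopologicalSpace Y] {H : Set ℕ} {f : ℕ → Y}
    {y : Y} {g : ℕ → ℕ} (hg : Tendsto g atTop (along H)) (hf : Tendsto (fun n => f (g n)) atTop (𝓝 y)) :
    ∃ H' ⊆ H, H'.Infinite ∧ Tendsto f (along H') (𝓝 y) := by
  refine ⟨range g ∩ H, inter_subset_right, ?_, fun s hs => ?_⟩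
  · refine Set.infinite_of_not_bddAbove fun ⟨B, hB⟩ => ?_
    have h1 := (hg.eventually (mem_along_self H)).and
      ((hg.mono_right (along_le_atTop H)).eventually (eventually_gt_atTop B))
    obtain ⟨n, hn1, hn2⟩ := h1.exists
    exact absurd (hB ⟨mem_range_self n, hn1⟩) (not_le.2 hn2)
  · obtain ⟨N, hN⟩ := eventually_atTop.1 (hf hs)
    change ∀ᶠ h in along (range g ∩ H), f h ∈ s
    rw [eventually_along]
    -- The map g need not be monotone or injective; an index g n beyond the sum of its first N
    -- values cannot have n < N.
    filter_upwards [eventually_gt_atTop (∑ i ∈ Finset.range N, g i)] with h hh hm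
    obtain ⟨⟨n, rfl⟩, -⟩ := hm
    refine hN n (not_lt.1 fun hlt => absurd hh (not_lt.2 ?_))
    exact Finset.single_le_sum (f := g) (fun i _ => Nat.zero_le _) (Finset.mem_range.2 hlt)

theorem exists_infinite_subset_tendsto_of_compact {Y : Type*} [TopologicalSpace Y] [CompactSpace Y]
    [FirstCountableTopology Y] {H : Set ℕ} (hH : H.Infinite) (f : ℕ → Y) :
    ∃ y, ∃ H' ⊆ H, H'.Infinite ∧ Tendsto f (along H') (𝓝 y) := by
  classical
  have := hH.to_subtype
  set e : ℕ → ℕ := fun n => Nat.nth (· ∈ H) n with he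
  have hem : StrictMono e := Nat.nth_strictMono hH
  obtain ⟨y, φ, hφ, hy⟩ := CompactSpace.tendsto_subseq (fun n => f (e n))
  refine ⟨y, exists_infinite_subset_tendsto (g := fun n => e (φ n)) ?_ hy⟩
  refine tendsto_inf.2 ⟨(hem.comp hφ).tendsto_atTop, tendsto_principal.2 ?_⟩
  exact Eventually.of_forall fun n => Nat.nth_mem_of_infinite hH _

theorem exists_infinite_subset_tendsto_liminf {H : Set ℕ} (hH : H.Infinite) (f : ℕ → ℝ≥0∞) :
    ∃ H' ⊆ H, H'.Infinite ∧ Tendsto f (along H') (𝓝 (liminf f (along H))) := by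
  have := along_neBot hH
  obtain ⟨g, hg1, hg2⟩ := exists_seq_tendsto_liminf (f := along H) (u := f)
  exact exists_infinite_subset_tendsto hg2 hg1

/-! ### Measurable selection and measurability of the power -/

/-- The first index that works is measurable once each condition is replaced by a measurable set
equal to it almost everywhere. -/
theorem exists_measurable_selection {α : Type*} [MeasurableSpace α] {μ : Measure α}
    {p : ℕ → α → Prop} (hp : ∀ k, NullMeasurableSet {x | p k x} μ) (h : ∀ᵐ x ∂μ, ∃ k, p k x) :
    ∃ N : α → ℕ, Measurable N ∧ ∀ᵐ x ∂μ, p (N x) x := by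
  classical
  choose t hts htm hte using fun k => (hp k).exists_measurable_subset_ae_eq
  have hgood : MeasurableSet (⋃ k, t k) := MeasurableSet.iUnion htm
  -- The second alternative makes `Nat.find` total: it returns 0 on the exceptional null set.
  have hex : ∀ x, ∃ k, x ∈ t k ∨ x ∉ ⋃ k, t k := by
    intro x
    by_cases hx : x ∈ ⋃ k, t k
    · obtain ⟨k, hk⟩ := mem_iUnion.1 hx
      exact ⟨k, Or.inl hk⟩
    · exact ⟨0, Or.inr hx⟩
  refine ⟨fun x => Nat.find (hex x),
    measurable_find hex fun k => (htm k).union hgood.compl, ?_⟩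
  have hall : ∀ᵐ x ∂μ, ∀ k, (x ∈ t k ↔ p k x) := by
    rw [ae_all_iff]
    intro k
    filter_upwards [(hte k).mem_iff] with x hx using hx
  filter_upwards [h, hall] with x ⟨k, hk⟩ hx
  have hxg : x ∈ ⋃ k, t k := mem_iUnion.2 ⟨k, (hx k).2 hk⟩
  rcases Nat.find_spec (hex x) with h1 | h1
  · exact (hx _).1 h1
  · exact absurd hxg h1

/-- The nonnegative rationals, as extended nonnegative reals. -/
noncomputable def nnq (q : ℚ) : ℝ≥0 := Real.toNNReal q

theorem exists_nnq_btwn {a b : ℝ≥0∞} (h : a < b) : ∃ q, a < nnq q ∧ (nnq q : ℝ≥0∞) < b := by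
  obtain ⟨q, -, h1, h2⟩ := ENNReal.lt_iff_exists_rat_btwn.1 h
  exact ⟨q, h1, h2⟩

/-- Monotone and upper semicontinuous means right-continuous, so rationals strictly above f
determine the value; none exists above ∞. This turns measurability of the power at constant
arguments into measurability along a varying F. -/
theorem eq_iInf_nnq_of_usc {P : ℝ≥0∞ → EReal} (hm : Monotone P) (hu : UpperSemicontinuous P)
    {f : ℝ≥0∞} (hf : f ≠ ∞) : P f = ⨅ q : ℚ, if f < nnq q then P (nnq q) else ⊤ := by
  refine le_antisymm (le_iInf fun q => ?_) (le_of_forall_gt_imp_ge_of_dense fun y hy => ?_)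
  · split_ifs with h
    · exact hm h.le
    · exact le_top
  · have h1 : ∀ᶠ f' in 𝓝[>] f, P f' < y := (hu f y hy).filter_mono nhdsWithin_le_nhds
    have : (𝓝[>] f).NeBot := nhdsGT_neBot_of_exists_gt ⟨∞, hf.lt_top⟩
    obtain ⟨f', hf'1, hf'2⟩ := (h1.and self_mem_nhdsWithin).exists
    obtain ⟨q, hq1, hq2⟩ := exists_nnq_btwn (show f < f' from hf'2)
    refine iInf_le_of_le q ?_
    rw [if_pos hq1]
    exact (hm hq2.le).trans hf'1.le

/-! ### Measurability of slope and power along a curve -/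

section System

variable {T : ℝ} {X : Type*} (S : EvolutionSystem T X)

theorem isTimeOrdered_id {d : X → X → ℝ≥0∞} {t : ℝ} (ht : t ∈ Icc 0 T) {u : ℝ → X}
    (hu : IsAC d 0 T u) : IsTimeOrdered T d 0 t (fun s => s) u where
  le := ht.1
  mapsTo := fun s hs => ⟨hs.1, hs.2.trans ht.2⟩
  mono := monotoneOn_id
  ac_time := by
    refine ⟨fun _ => 1, aemeasurable_const, by simp, fun s t _ hst _ => ?_⟩
    simp only [lintegral_const, Measure.restrict_apply MeasurableSet.univ, univ_inter,
      Real.volume_Ioc, one_mul]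
    rw [edist_dist, Real.dist_eq, abs_sub_comm, abs_of_pos (sub_pos.2 hst)]
  ac_space := by
    obtain ⟨m, hm, hfin, h⟩ := hu
    have hsub : Ioc 0 t ⊆ Ioc 0 T := Ioc_subset_Ioc le_rfl ht.2
    exact ⟨m, hm.mono_measure (Measure.restrict_mono hsub le_rfl),
      ne_top_of_le_ne_top hfin (lintegral_mono_set hsub),
      fun p q hp hpq hq => h p q hp hpq (hq.trans ht.2)⟩

theorem EvolutionSystem.aemeasurable_slope (hT : 0 ≤ T) {u : ℝ → X} (hu : IsAC S.dist 0 T u) :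
    AEMeasurable (fun r => S.slope r (u r)) (volume.restrict (Icc 0 T)) :=
  S.slope_meas 0 T _ u (isTimeOrdered_id ⟨hT, le_rfl⟩ hu)

theorem EvolutionSystem.aemeasurable_power (hT : 0 ≤ T) {u : ℝ → X} (hu : IsAC S.dist 0 T u)
    {F : ℝ → ℝ≥0∞} (hF : AEMeasurable F (volume.restrict (Icc 0 T)))
    (hfin : ∀ᵐ r ∂volume.restrict (Icc 0 T), F r ≠ ∞) :
    AEMeasurable (fun r => S.power r (u r) (F r)) (volume.restrict (Icc 0 T)) := by
  have h1 : AEMeasurable (fun r => ⨅ q : ℚ, if F r < nnq q then S.power r (u r) (nnq q) else ⊤)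
      (volume.restrict (Icc 0 T)) := by
    refine AEMeasurable.iInf fun q => ?_
    obtain ⟨F', hF'm, hF'e⟩ := hF
    obtain ⟨G, hGm, hGe⟩ := S.power_meas (nnq q) ENNReal.coe_ne_top 0 T _ u
      (isTimeOrdered_id ⟨hT, le_rfl⟩ hu)
    refine ⟨fun r => if F' r < nnq q then G r else ⊤,
      Measurable.ite (measurableSet_lt hF'm measurable_const) hGm measurable_const, ?_⟩
    filter_upwards [hF'e, hGe] with r hr1 hr2
    rw [hr1, hr2]
  refine h1.congr ?_
  filter_upwards [hfin, ae_restrict_mem measurableSet_Icc] with r hr hrm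
  exact (eq_iInf_nnq_of_usc (S.power_mono r hrm _) (S.power_usc r hrm _) hr).symm

end System

/-! ### The truncated potential -/

/-- The function `(1 + ε) D - min p M`, shifted by `M` so as to be nonnegative. -/
noncomputable def truncPot (ε M : ℝ≥0) (D : ℝ≥0∞) (p : EReal) : ℝ≥0∞ :=
  (1 + ε) * D + ((-p).toENNReal + (M - p.toENNReal))

section TruncPot

variable {ε M : ℝ≥0} {D D' : ℝ≥0∞} {p p' : EReal}

theorem truncPot_mono (hD : D ≤ D') (hp : p' ≤ p) : truncPot ε M D p ≤ truncPot ε M D' p' := by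
  unfold truncPot
  gcongr
  · exact EReal.toENNReal_le_toENNReal (EReal.neg_le_neg_iff.2 hp)
  · exact EReal.toENNReal_le_toENNReal hp

theorem le_truncPot : D ≤ truncPot ε M D p := by
  refine le_trans ?_ le_self_add
  exact le_mul_of_one_le_left zero_le le_self_add

/-- Truncation only enlarges the potential (1+ε)D - p + M. The positive part of p is put on the
right to avoid subtraction in [0,∞]. -/
theorem truncPot_add_ge :
    (1 + ε) * D + (-p).toENNReal + M ≤ truncPot ε M D p + p.toENNReal := by
  unfold truncPot
  rw [add_assoc, add_assoc, add_assoc]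
  gcongr
  exact le_tsub_add

/-- The last term is the only price of truncation; equi-integrability makes its integral small
uniformly in h. -/
theorem truncPot_add_le : truncPot ε M D p + p.toENNReal ≤
    (1 + ε) * D + (-p).toENNReal + M + (if (M : ℝ≥0∞) < p.toENNReal then p.toENNReal else 0) := by
  have key : (M : ℝ≥0∞) - p.toENNReal + p.toENNReal ≤
      M + (if (M : ℝ≥0∞) < p.toENNReal then p.toENNReal else 0) := by
    split_ifs with h
    · rw [tsub_eq_zero_of_le h.le, zero_add]; exact le_add_self
    · rw [tsub_add_cancel_of_le (not_lt.1 h), add_zero]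
  calc truncPot ε M D p + p.toENNReal
      = (1 + ε) * D + (-p).toENNReal + ((M : ℝ≥0∞) - p.toENNReal + p.toENNReal) := by
        unfold truncPot; ring
    _ ≤ _ := add_le_add_right key _
    _ = _ := by ring

/-- Without the shift by M, the function (1+ε)D - min(p, M) decreases when ε decreases and M
increases. Potentials at different truncation levels become comparable. -/
theorem truncPot_shift {ε' M' : ℝ≥0} (hε : ε' ≤ ε) (hM : M ≤ M') :
    truncPot ε' M' D p + M ≤ truncPot ε M D p + M' := by
  unfold truncPot
  have h1 : (M' : ℝ≥0∞) - p.toENNReal + M ≤ M - p.toENNReal + M' := by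
    have hMM : (M : ℝ≥0∞) ≤ M' := by exact_mod_cast hM
    rcases le_total p.toENNReal (M : ℝ≥0∞) with h | h
    · have hp : p.toENNReal ≠ ∞ := ne_top_of_le_ne_top ENNReal.coe_ne_top h
      rw [← ENNReal.add_le_add_iff_right hp, add_right_comm, tsub_add_cancel_of_le (h.trans hMM),
        add_right_comm, tsub_add_cancel_of_le h, add_comm]
    · rw [tsub_eq_zero_of_le h, zero_add]
      calc (M' : ℝ≥0∞) - p.toENNReal + M ≤ M' - M + M := by gcongr
        _ = M' := tsub_add_cancel_of_le hMM
  rw [add_assoc, add_assoc, add_assoc, add_assoc]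
  gcongr

theorem tendsto_truncPot {ι : Type*} {l : Filter ι} {Dh : ι → ℝ≥0∞} {ph : ι → EReal}
    (hD : Tendsto Dh l (𝓝 D)) (hp : Tendsto ph l (𝓝 p)) :
    Tendsto (fun h => truncPot ε M (Dh h) (ph h)) l (𝓝 (truncPot ε M D p)) := by
  unfold truncPot
  have h1 : Tendsto (fun h => (ph h).toENNReal) l (𝓝 p.toENNReal) :=
    (EReal.continuous_toENNReal.tendsto _).comp hp
  have h2 : Tendsto (fun h => (-ph h).toENNReal) l (𝓝 (-p).toENNReal) :=
    (EReal.continuous_toENNReal.tendsto _).comp ((continuous_neg.tendsto _).comp hp)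
  refine (ENNReal.Tendsto.const_mul hD (Or.inr (by finiteness))).add (h2.add ?_)
  exact ENNReal.Tendsto.sub tendsto_const_nhds h1 (Or.inl ENNReal.coe_ne_top)

theorem aemeasurable_truncPot {α : Type*} [MeasurableSpace α] {μ : Measure α} {Df : α → ℝ≥0∞}
    {pf : α → EReal} (hD : AEMeasurable Df μ) (hp : AEMeasurable pf μ) :
    AEMeasurable (fun x => truncPot ε M (Df x) (pf x)) μ :=
  (hD.const_mul _).add ((EReal.continuous_toENNReal.measurable.comp_aemeasurable hp.neg).add
    (aemeasurable_const.sub (EReal.continuous_toENNReal.measurable.comp_aemeasurable hp)))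

end TruncPot

/-! ### Pointwise limits of slopes and powers -/

/-- Passage to the limit at a fixed time. -/
theorem SlopePowerLimit.exists_truncPot_le {T : ℝ} {X : Type*} [TopologicalSpace X]
    {Sh : ℕ → EvolutionSystem T X} {S : EvolutionSystem T X} {ub : ℕ → X} {a b : ℝ≥0}
    (hC4 : SlopePowerLimit Sh S ub a b) {ψh : ℕ → ℝ≥0 → ℝ≥0} {ψ : ℝ≥0 → ℝ≥0}
    (hlim : ∀ v : ℝ≥0, Tendsto (fun h => ψh h v) atTop (𝓝 (ψ v)))
    {H : Set ℕ} (hH : H.Infinite) {t : ℝ} (ht : t ∈ Icc 0 T) {x : ℕ → X} {x₀ : X}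
    (hx : Tendsto x (along H) (𝓝 x₀))
    (hb : ∃ C : ℝ, ∀ h ∈ H, modEnergy Sh ub a b h t (x h) ≤ (C : EReal))
    {F : ℕ → ℝ≥0∞} (hF : ∀ h ∈ H, (Sh h).slope t (x h) ≤ F h) {ε M : ℝ≥0}
    (hfin : liminf (fun h => truncPot ε M (dual (ψh h) (F h)) ((Sh h).power t (x h) (F h)))
      (along H) ≠ ∞) :
    ∃ f : ℝ≥0, S.slope t x₀ ≤ f ∧ truncPot ε M (dual ψ f) (S.power t x₀ f) ≤
      liminf (fun h => truncPot ε M (dual (ψh h) (F h)) ((Sh h).power t (x h) (F h)))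
        (along H) := by
  set K := fun h => truncPot ε M (dual (ψh h) (F h)) ((Sh h).power t (x h) (F h)) with hK
  set ℓ := liminf K (along H) with hℓ
  obtain ⟨H₁, hH₁s, hH₁i, hK₁⟩ := exists_infinite_subset_tendsto_liminf hH K
  have hev : ∀ᶠ h in along H₁, F h ≠ ∞ := by
    filter_upwards [hK₁.eventually (gt_mem_nhds hfin.lt_top)] with h hh
    exact ne_top_of_dual_ne_top (ne_top_of_le_ne_top hh.ne le_truncPot)
  set H₂ := {h ∈ H₁ | F h ≠ ∞} with hH₂
  have hH₂i : H₂.Infinite := infinite_sep hH₁i hev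
  -- The triple lives in a compact space, so a further subsequence, depending on the fixed time,
  -- converges without any bound on the powers.
  obtain ⟨⟨f₀, D₀, p₀⟩, H₃, hH₃s, hH₃i, hlim₃⟩ := exists_infinite_subset_tendsto_of_compact hH₂i
    fun h => ((F h, dual (ψh h) (F h), (Sh h).power t (x h) (F h)) : ℝ≥0∞ × ℝ≥0∞ × EReal)
  have hF₃ : Tendsto F (along H₃) (𝓝 f₀) := (continuous_fst.tendsto _).comp hlim₃
  have hD₃ : Tendsto (fun h => dual (ψh h) (F h)) (along H₃) (𝓝 D₀) :=
    ((continuous_fst.comp continuous_snd).tendsto _).comp hlim₃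
  have hp₃ : Tendsto (fun h => (Sh h).power t (x h) (F h)) (along H₃) (𝓝 p₀) :=
    ((continuous_snd.comp continuous_snd).tendsto _).comp hlim₃
  have hH₃₁ : H₃ ⊆ H₁ := hH₃s.trans fun _ h => h.1
  have hH₃H : H₃ ⊆ H := hH₃₁.trans hH₁s
  have := along_neBot hH₃i
  have hψ₃ : ∀ v : ℝ≥0, Tendsto (fun h => ψh h v) (along H₃) (𝓝 (ψ v)) :=
    fun v => (hlim v).mono_left (along_le_atTop _)
  have hℓ₃ : truncPot ε M D₀ p₀ = ℓ :=
    tendsto_nhds_unique (tendsto_truncPot hD₃ hp₃) (hK₁.mono_left (along_mono hH₃₁))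
  have hD₀ : D₀ ≠ ∞ := ne_top_of_le_ne_top hfin (hℓ₃ ▸ le_truncPot)
  -- The hypothesis on slopes and powers covers finite limits only; f ≤ ψ*(f) + ψ(1) rules out
  -- escape to ∞.
  have hf₀ : f₀ ≠ ∞ := by
    have h1 : f₀ ≤ D₀ + ψ 1 := le_of_tendsto_of_tendsto' hF₃
      (hD₃.add (ENNReal.tendsto_coe.2 (hψ₃ 1))) fun h => le_dual_add _ _
    exact ne_top_of_le_ne_top (by finiteness) h1
  lift f₀ to ℝ≥0 using hf₀
  have hcoe : ∀ h ∈ H₃, ((F h).toNNReal : ℝ≥0∞) = F h :=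
    fun h hh => ENNReal.coe_toNNReal (hH₃s hh).2
  obtain ⟨C, hC⟩ := hb
  obtain ⟨h1, h2⟩ := hC4 H₃ x x₀ hH₃i t ht (hx.mono_left (along_mono hH₃H))
    ⟨C, fun h hh => hC h (hH₃H hh)⟩ (fun h => (F h).toNNReal) f₀
    (fun h hh => by rw [hcoe h hh]; exact hF h (hH₃H hh))
    ((ENNReal.tendsto_toNNReal ENNReal.coe_ne_top).comp hF₃)
  refine ⟨f₀, h1, ?_⟩
  rw [← hℓ₃]
  refine truncPot_mono (dual_le_of_tendsto hψ₃ hF₃ hD₃) ?_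
  have h3 : limsup (fun h => (Sh h).power t (x h) ((F h).toNNReal : ℝ≥0∞)) (along H₃) = p₀ := by
    rw [← hp₃.limsup_eq]
    refine limsup_congr ?_
    filter_upwards [mem_along_self H₃] with h hh
    rw [hcoe h hh]
  rwa [h3] at h2

/-- Passage to the limit in near-minimizers of truncated potentials. -/
theorem dual_add_le_of_truncPot_le {ψ : ℝ≥0 → ℝ≥0} {P : ℝ≥0∞ → EReal}
    (hP : UpperSemicontinuous P) {F ℓ : ℕ → ℝ≥0∞} {ε M s : ℕ → ℝ≥0}
    (hs : Tendsto s atTop (𝓝 0))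
    (hℓ : ∀ n k, n ≤ k → ℓ k + M n ≤ ℓ n + M k)
    (hF : ∀ k, truncPot (ε k) (M k) (dual ψ (F k)) (P (F k)) ≤ ℓ k + s k) (n : ℕ) :
    dual ψ (liminf F atTop) + (-P (liminf F atTop)).toENNReal + M n ≤
      ℓ n + (P (liminf F atTop)).toENNReal := by
  set F₀ := liminf F atTop with hF₀
  have huniv : along univ = atTop := by simp [along]
  obtain ⟨H₁, -, hH₁i, hF₁⟩ := exists_infinite_subset_tendsto_liminf infinite_univ F
  rw [huniv, ← hF₀] at hF₁
  obtain ⟨⟨D₀, p₀⟩, H₂, hH₂s, hH₂i, hlim₂⟩ := exists_infinite_subset_tendsto_of_compact hH₁i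
    fun k => ((dual ψ (F k), P (F k)) : ℝ≥0∞ × EReal)
  have hD₂ : Tendsto (fun k => dual ψ (F k)) (along H₂) (𝓝 D₀) :=
    (continuous_fst.tendsto _).comp hlim₂
  have hp₂ : Tendsto (fun k => P (F k)) (along H₂) (𝓝 p₀) :=
    (continuous_snd.tendsto _).comp hlim₂
  have hF₂ := hF₁.mono_left (along_mono hH₂s)
  have := along_neBot hH₂i
  have hp : p₀ ≤ P F₀ := by
    refine le_of_forall_gt_imp_ge_of_dense fun y hy => ?_
    exact le_of_tendsto hp₂ ((hF₂.eventually (hP F₀ y hy)).mono fun k hk => hk.le)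
  have hD : dual ψ F₀ ≤ D₀ :=
    dual_le_of_tendsto (ψh := fun _ => ψ) (fun _ => tendsto_const_nhds) hF₂ hD₂
  have hineq : ∀ᶠ k in along H₂, dual ψ (F k) + (-P (F k)).toENNReal + M n ≤
      ℓ n + s k + (P (F k)).toENNReal := by
    filter_upwards [(eventually_ge_atTop n).filter_mono (along_le_atTop _)] with k hk
    -- Adding M k allows level k to be exchanged for the fixed level n through the comparison `hℓ`;
    -- afterwards only k tends to infinity.
    refine (ENNReal.add_le_add_iff_right (a := (M k : ℝ≥0∞)) ENNReal.coe_ne_top).1 ?_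
    calc dual ψ (F k) + (-P (F k)).toENNReal + M n + M k
        = dual ψ (F k) + (-P (F k)).toENNReal + M k + M n := by ring
      _ ≤ (1 + ε k) * dual ψ (F k) + (-P (F k)).toENNReal + M k + M n := by
          gcongr
          exact le_mul_of_one_le_left zero_le le_self_add
      _ ≤ truncPot (ε k) (M k) (dual ψ (F k)) (P (F k)) + (P (F k)).toENNReal + M n := by
          gcongr ?_ + _; exact truncPot_add_ge
      _ ≤ ℓ k + s k + (P (F k)).toENNReal + M n := by gcongr ?_ + _ + _; exact hF k
      _ = (ℓ k + M n) + s k + (P (F k)).toENNReal := by ring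
      _ ≤ (ℓ n + M k) + s k + (P (F k)).toENNReal := by gcongr ?_ + _ + _; exact hℓ n k hk
      _ = _ := by ring
  have hpos : Tendsto (fun k => (P (F k)).toENNReal) (along H₂) (𝓝 p₀.toENNReal) :=
    (EReal.continuous_toENNReal.tendsto _).comp hp₂
  have hneg : Tendsto (fun k => (-P (F k)).toENNReal) (along H₂) (𝓝 (-p₀).toENNReal) :=
    (EReal.continuous_toENNReal.tendsto _).comp ((continuous_neg.tendsto _).comp hp₂)
  have hs' : Tendsto (fun k => (s k : ℝ≥0∞)) (along H₂) (𝓝 0) :=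
    (ENNReal.tendsto_coe.2 hs).mono_left (along_le_atTop _)
  have hlim := le_of_tendsto_of_tendsto ((hD₂.add hneg).add_const (M n : ℝ≥0∞))
    ((hs'.const_add (ℓ n)).add hpos) hineq
  rw [add_zero] at hlim
  calc dual ψ F₀ + (-P F₀).toENNReal + M n ≤ D₀ + (-p₀).toENNReal + M n := by
        gcongr
        exact EReal.toENNReal_le_toENNReal (EReal.neg_le_neg_iff.2 hp)
    _ ≤ ℓ n + p₀.toENNReal := hlim
    _ ≤ _ := by gcongr; exact EReal.toENNReal_le_toENNReal hp

/-! ### Real forms of extended inequalities -/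

/-- The left side is not -∞ and the right side is not +∞, so no term can be infinite. -/
theorem toReal_le_of_ereal_le {x y : EReal} {L p m : ℝ≥0∞} (hx : x ≠ ⊥) (hy : y ≠ ⊤) (hp : p ≠ ∞)
    (h : x + (L : EReal) ≤ y + ((p : EReal) - (m : EReal))) :
    x ≠ ⊤ ∧ y ≠ ⊥ ∧ L ≠ ∞ ∧ m ≠ ∞ ∧ x.toReal + L.toReal + m.toReal ≤ y.toReal + p.toReal := by
  lift p to ℝ≥0 using hp
  have hL : x + (L : EReal) ≠ ⊥ := by
    rw [Ne, EReal.add_eq_bot_iff]; simp [hx]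
  have hy' : y ≠ ⊥ := by
    rintro rfl
    rw [EReal.bot_add] at h
    exact hL (le_bot_iff.1 h)
  have hm : m ≠ ∞ := by
    rintro rfl
    rw [EReal.coe_ennreal_top, EReal.sub_top, EReal.add_bot] at h
    exact hL (le_bot_iff.1 h)
  lift m to ℝ≥0 using hm
  lift y to ℝ using ⟨hy, hy'⟩
  have hrhs : (y : EReal) + (((p : ℝ≥0∞) : EReal) - ((m : ℝ≥0∞) : EReal)) =
      ((y + (p - m) : ℝ) : EReal) := by
    rw [EReal.coe_nnreal_eq_coe_real, EReal.coe_nnreal_eq_coe_real]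
    norm_cast
  rw [hrhs] at h
  have hx' : x ≠ ⊤ := by
    rintro rfl
    rw [EReal.top_add_of_ne_bot (by simp)] at h
    exact EReal.coe_ne_top _ (top_le_iff.1 h)
  lift x to ℝ using ⟨hx', hx⟩
  have hL' : L ≠ ∞ := by
    rintro rfl
    rw [EReal.coe_ennreal_top, EReal.coe_add_top] at h
    exact EReal.coe_ne_top _ (top_le_iff.1 h)
  lift L to ℝ≥0 using hL'
  refine ⟨hx', hy', ENNReal.coe_ne_top, ENNReal.coe_ne_top, ?_⟩
  rw [EReal.coe_nnreal_eq_coe_real, ← EReal.coe_add, EReal.coe_le_coe_iff] at h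
  simp only [EReal.toReal_coe, ENNReal.coe_toReal] at h ⊢
  linarith

theorem ereal_le_of_toReal_le {x y : ℝ} {L p m : ℝ≥0∞} (hL : L ≠ ∞) (hp : p ≠ ∞) (hm : m ≠ ∞)
    (h : x + L.toReal + m.toReal ≤ y + p.toReal) :
    (x : EReal) + (L : EReal) ≤ y + ((p : EReal) - (m : EReal)) := by
  lift p to ℝ≥0 using hp
  lift m to ℝ≥0 using hm
  lift L to ℝ≥0 using hL
  simp only [ENNReal.coe_toReal] at h
  rw [EReal.coe_nnreal_eq_coe_real, EReal.coe_nnreal_eq_coe_real, EReal.coe_nnreal_eq_coe_real,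
    ← EReal.coe_sub, ← EReal.coe_add, ← EReal.coe_add, EReal.coe_le_coe_iff]
  linarith

theorem liminf_add_liminf_le {ι : Type*} {l : Filter ι} (α β : ι → ℝ≥0∞) :
    liminf α l + liminf β l ≤ liminf (fun i => α i + β i) l := by
  rw [liminf_eq_iSup_iInf, liminf_eq_iSup_iInf]
  refine ENNReal.biSup_add_biSup_le' ⟨univ, univ_mem⟩ ⟨univ, univ_mem⟩ fun s hs t ht => ?_
  refine le_liminf_of_le (by isBoundedDefault) ?_
  filter_upwards [hs, ht] with i his hit
  exact add_le_add (iInf₂_le i his) (iInf₂_le i hit)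

theorem add_toReal_le_of_liminf {ι : Type*} {l : Filter ι} [l.NeBot] {α β : ι → ℝ≥0∞}
    {A L : ℝ≥0∞} {c y₀ : ℝ} {y : ι → ℝ} (hA : A ≤ liminf α l) (hL : L ≤ liminf β l)
    (hα : ∀ᶠ h in l, α h ≠ ∞) (hβ : ∀ᶠ h in l, β h ≠ ∞)
    (h : ∀ᶠ h in l, c + (α h).toReal + (β h).toReal ≤ y h) (hy : Tendsto y l (𝓝 y₀)) :
    A ≠ ∞ ∧ L ≠ ∞ ∧ c + A.toReal + L.toReal ≤ y₀ := by
  have h0 : 0 ≤ y₀ - c := by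
    refine ge_of_tendsto (hy.sub_const c) ?_
    filter_upwards [h] with i hi
    have := ENNReal.toReal_nonneg (a := α i)
    have := ENNReal.toReal_nonneg (a := β i)
    linarith
  have h1 : A + L ≤ ENNReal.ofReal (y₀ - c) := by
    calc A + L ≤ liminf α l + liminf β l := add_le_add hA hL
      _ ≤ liminf (fun i => α i + β i) l := liminf_add_liminf_le α β
      _ ≤ liminf (fun i => ENNReal.ofReal (y i - c)) l := by
          refine liminf_le_liminf ?_
          filter_upwards [h, hα, hβ] with i hi h1 h2
          refine ENNReal.le_ofReal_iff_toReal_le (by finiteness) ?_ |>.2 ?_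
          · have := ENNReal.toReal_nonneg (a := α i)
            have := ENNReal.toReal_nonneg (a := β i)
            linarith
          · rw [ENNReal.toReal_add h1 h2]; linarith
      _ = ENNReal.ofReal (y₀ - c) :=
          ((ENNReal.continuous_ofReal.tendsto _).comp (hy.sub_const c)).liminf_eq
  have h2 : A + L ≠ ∞ := ne_top_of_le_ne_top ENNReal.ofReal_ne_top h1
  obtain ⟨h3, h4⟩ := ENNReal.add_ne_top.1 h2
  refine ⟨h3, h4, ?_⟩
  have h5 := (ENNReal.le_ofReal_iff_toReal_le h2 h0).1 h1
  rw [ENNReal.toReal_add h3 h4] at h5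
  linarith

/-! ### Equi-integrability -/

theorem EquiIntegrable.exists_bound {T : ℝ} {H : Set ℕ} {g : ℕ → ℝ → ℝ≥0∞}
    (hg : EquiIntegrable T H g) : ∃ Λ : ℝ≥0, ∀ h ∈ H, ∫⁻ r in Ioc (0 : ℝ) T, g h r ≤ Λ := by
  obtain ⟨δ, hδ, hA⟩ := hg 1 one_pos
  obtain ⟨η, hη0, hη⟩ := ENNReal.lt_iff_exists_nnreal_btwn.1 hδ
  have hη0 : (0 : ℝ) < η := by exact_mod_cast hη0
  -- The interval is covered by pieces of length η ≤ δ, each contributing at most 1.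
  have key : ∀ n : ℕ, ∀ h ∈ H, ∫⁻ r in Ioc (0 : ℝ) (n * η) ∩ Ioc 0 T, g h r ≤ n := by
    intro n h hh
    induction n with
    | zero => simp
    | succ n ih =>
      have hsub : Ioc (0 : ℝ) ((n + 1 : ℕ) * η) ∩ Ioc 0 T ⊆
          (Ioc (0 : ℝ) (n * η) ∩ Ioc 0 T) ∪ (Ioc (n * η : ℝ) (n * η + η) ∩ Ioc 0 T) := by
        rintro r ⟨hr1, hr2⟩
        rcases le_or_gt r (n * η) with h1 | h1
        · exact Or.inl ⟨⟨hr1.1, h1⟩, hr2⟩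
        · refine Or.inr ⟨⟨h1, ?_⟩, hr2⟩
          have := hr1.2
          push_cast at this
          linarith
      refine (lintegral_mono_set hsub).trans ((lintegral_union_le _ _ _).trans ?_)
      push_cast
      refine add_le_add ih (hA _ (measurableSet_Ioc.inter measurableSet_Ioc) inter_subset_right
        ?_ h hh)
      refine (measure_mono inter_subset_left).trans ?_
      rw [Real.volume_Ioc, add_sub_cancel_left, ENNReal.ofReal_coe_nnreal]
      exact hη.le
  obtain ⟨n, hn⟩ := exists_nat_gt (T / η)
  refine ⟨n, fun h hh => ?_⟩
  have hsub : Ioc 0 T ⊆ Ioc (0 : ℝ) (n * η) ∩ Ioc 0 T := fun r hr =>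
    ⟨⟨hr.1, hr.2.trans ((div_lt_iff₀ hη0).1 hn).le⟩, hr⟩
  exact_mod_cast (lintegral_mono_set hsub).trans (key n h hh)

theorem EquiIntegrable.exists_truncation {T : ℝ} {H : Set ℕ} {g : ℕ → ℝ → ℝ≥0∞}
    (hg : EquiIntegrable T H g) (hm : ∀ h ∈ H, AEMeasurable (g h) (volume.restrict (Ioc 0 T)))
    {ω : ℝ≥0∞} (hω : 0 < ω) :
    ∃ M : ℝ≥0, ∀ h ∈ H, ∫⁻ r in Ioc 0 T, (if (M : ℝ≥0∞) < g h r then g h r else 0) ≤ ω := by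
  obtain ⟨Λ, hΛ⟩ := hg.exists_bound
  obtain ⟨δ, hδ, hA⟩ := hg ω hω
  obtain ⟨η, hη0, hη⟩ := ENNReal.lt_iff_exists_nnreal_btwn.1 hδ
  have hη0 : 0 < η := by exact_mod_cast hη0
  -- By Markov's inequality the set where the function exceeds this level has measure at most η. The
  -- set is formed from a measurable version, since equi-integrability concerns measurable sets.
  refine ⟨(Λ + 1) / η, fun h hh => ?_⟩
  set M : ℝ≥0 := (Λ + 1) / η with hM
  have hM0 : (M : ℝ≥0∞) ≠ 0 := by
    have : 0 < M := by positivity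
    exact_mod_cast this.ne'
  obtain ⟨g', hg'm, hg'e⟩ := hm h hh
  set A : Set ℝ := {r | (M : ℝ≥0∞) < g' r} ∩ Ioc 0 T with hAdef
  have hAm : MeasurableSet A := (measurableSet_lt measurable_const hg'm).inter measurableSet_Ioc
  have hvol : volume A ≤ δ := by
    have h1 : volume A = volume.restrict (Ioc 0 T) {r | (M : ℝ≥0∞) < g' r} :=
      (Measure.restrict_apply (measurableSet_lt measurable_const hg'm)).symm
    have h2 : (M : ℝ≥0∞) * volume A ≤ Λ := by
      calc (M : ℝ≥0∞) * volume A
          ≤ M * volume.restrict (Ioc 0 T) {r | (M : ℝ≥0∞) ≤ g' r} := by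
            rw [h1]; gcongr; exact fun hr => le_of_lt hr
        _ ≤ ∫⁻ r in Ioc 0 T, g' r := mul_meas_ge_le_lintegral hg'm _
        _ = ∫⁻ r in Ioc 0 T, g h r := lintegral_congr_ae hg'e.symm
        _ ≤ Λ := hΛ h hh
    refine le_trans ?_ hη.le
    refine (ENNReal.mul_le_mul_iff_right hM0 ENNReal.coe_ne_top).1 (h2.trans ?_)
    have : Λ ≤ M * η := by rw [hM, div_mul_cancel₀ _ hη0.ne']; exact le_self_add
    exact_mod_cast this
  calc ∫⁻ r in Ioc 0 T, (if (M : ℝ≥0∞) < g h r then g h r else 0)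
      = ∫⁻ r in Ioc 0 T, {r | (M : ℝ≥0∞) < g' r}.indicator g' r := by
        refine lintegral_congr_ae ?_
        filter_upwards [hg'e] with r hr
        simp [indicator, hr]
    _ = ∫⁻ r in A, g' r := by
        rw [lintegral_indicator (measurableSet_lt measurable_const hg'm), Measure.restrict_restrict
          (measurableSet_lt measurable_const hg'm)]
    _ = ∫⁻ r in A, g h r :=
        lintegral_congr_ae (ae_mono (Measure.restrict_mono inter_subset_right le_rfl) hg'e.symm)
    _ ≤ ω := hA A hAm inter_subset_right hvol h hh

/-! ### Consequences of the energy-dissipation inequality -/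

section ED

variable {T : ℝ} {X : Type*} {S : EvolutionSystem T X} {ψ : ℝ≥0 → ℝ≥0} {u : ℝ → X}
  {F : ℝ → ℝ≥0∞}

theorem ae_restrict_Icc_iff_Ioc {a b : ℝ} {p : ℝ → Prop} :
    (∀ᵐ r ∂volume.restrict (Icc a b), p r) ↔ ∀ᵐ r ∂volume.restrict (Ioc a b), p r := by
  rw [restrict_Ioc_eq_restrict_Icc]

theorem IsAC.aemeasurable_velDiss' (hT : 0 ≤ T) (hu : IsAC S.dist 0 T u) (hψ : IsDissipation ψ) :
    AEMeasurable (velDiss S.dist ψ u) (volume.restrict (Ioc 0 T)) :=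
  @IsAC.aemeasurable_velDiss X S.metric.toPseudoEMetricSpace ψ 0 T hT u hu hψ

theorem aemeasurable_Ioc_of_Icc {β : Type*} [MeasurableSpace β] {f : ℝ → β} {t : ℝ}
    (ht : t ≤ T) (hf : AEMeasurable f (volume.restrict (Icc 0 T))) :
    AEMeasurable f (volume.restrict (Ioc 0 t)) :=
  hf.mono_measure (Measure.restrict_mono
    (Ioc_subset_Icc_self.trans (Icc_subset_Icc_right ht)) le_rfl)

theorem aemeasurable_Ioc_mono {β : Type*} [MeasurableSpace β] {f : ℝ → β} {t : ℝ}
    (ht : t ≤ T) (hf : AEMeasurable f (volume.restrict (Ioc 0 T))) :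
    AEMeasurable f (volume.restrict (Ioc 0 t)) :=
  hf.mono_measure (Measure.restrict_mono (Ioc_subset_Ioc_right ht) le_rfl)

/-- Integrability of the positive power makes every other term finite, so the inequality can be used
in real arithmetic from here on. -/
theorem SatisfiesED.real_ineq (hED : SatisfiesED S ψ u F) (hψ : IsDissipation ψ) {t : ℝ}
    (ht : t ∈ Icc 0 T) :
    S.energy t (u t) ≠ ⊤ ∧ S.energy 0 (u 0) ≠ ⊥ ∧
    ∫⁻ r in Ioc 0 t, velDiss S.dist ψ u r ≠ ∞ ∧ ∫⁻ r in Ioc 0 t, dual ψ (F r) ≠ ∞ ∧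
    ∫⁻ r in Ioc 0 t, (S.power r (u r) (F r)).toENNReal ≠ ∞ ∧
    ∫⁻ r in Ioc 0 t, (-S.power r (u r) (F r)).toENNReal ≠ ∞ ∧
    (S.energy t (u t)).toReal + (∫⁻ r in Ioc 0 t, velDiss S.dist ψ u r).toReal +
      (∫⁻ r in Ioc 0 t, dual ψ (F r)).toReal +
      (∫⁻ r in Ioc 0 t, (-S.power r (u r) (F r)).toENNReal).toReal ≤
    (S.energy 0 (u 0)).toReal + (∫⁻ r in Ioc 0 t, (S.power r (u r) (F r)).toENNReal).toReal := by
  have hT : 0 ≤ T := ht.1.trans ht.2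
  have hp : ∫⁻ r in Ioc 0 t, (S.power r (u r) (F r)).toENNReal ≠ ∞ :=
    ne_top_of_le_ne_top hED.power_pos (lintegral_mono_set (Ioc_subset_Ioc_right ht.2))
  have h := hED.ineq t ht
  have hvm := aemeasurable_Ioc_mono ht.2 (hED.ac.aemeasurable_velDiss' hT hψ)
  have hL : ∫⁻ r in Ioc 0 t, (((ψ (metricDeriv S.dist u r).toNNReal : ℝ≥0) : ℝ≥0∞)
      + dual ψ (F r)) = (∫⁻ r in Ioc 0 t, velDiss S.dist ψ u r) +
      ∫⁻ r in Ioc 0 t, dual ψ (F r) := lintegral_add_left' hvm _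
  rw [hL, erealIntegral] at h
  obtain ⟨h1, h2, h3, h4, h5⟩ := toReal_le_of_ereal_le (S.energy_ne_bot t ht _)
    hED.energy_zero.ne hp h
  obtain ⟨h6, h7⟩ := ENNReal.add_ne_top.1 h3
  rw [ENNReal.toReal_add h6 h7] at h5
  exact ⟨h1, h2, h6, h7, hp, h4, by linarith⟩

theorem SatisfiesED.ae_ne_top (hED : SatisfiesED S ψ u F) (hψ : IsDissipation ψ) (hT : 0 ≤ T) :
    ∀ᵐ r ∂volume.restrict (Icc 0 T), F r ≠ ∞ := by
  rw [ae_restrict_Icc_iff_Ioc]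
  obtain ⟨-, -, -, h, -⟩ := hED.real_ineq hψ (right_mem_Icc.2 hT)
  filter_upwards [ae_lt_top' ((measurable_dual ψ).comp_aemeasurable
    (aemeasurable_Ioc_of_Icc le_rfl hED.meas)) h] with r hr
  exact ne_top_of_dual_ne_top (Function.comp_apply (f := dual ψ) ▸ hr.ne)

theorem SatisfiesED.aemeasurable_power (hED : SatisfiesED S ψ u F) (hψ : IsDissipation ψ)
    (hT : 0 ≤ T) :
    AEMeasurable (fun r => S.power r (u r) (F r)) (volume.restrict (Icc 0 T)) :=
  S.aemeasurable_power hT hED.ac hED.meas (hED.ae_ne_top hψ hT)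

theorem SatisfiesED.aemeasurable_truncPot (hED : SatisfiesED S ψ u F) (hψ : IsDissipation ψ)
    (hT : 0 ≤ T) (ε M : ℝ≥0) :
    AEMeasurable (fun r => truncPot ε M (dual ψ (F r)) (S.power r (u r) (F r)))
      (volume.restrict (Icc 0 T)) :=
  EvolSys.aemeasurable_truncPot ((measurable_dual ψ).comp_aemeasurable hED.meas)
    (hED.aemeasurable_power hψ hT)

/-- The energy-dissipation inequality with the truncated potential. -/
theorem SatisfiesED.energy_add_truncPot_le (hED : SatisfiesED S ψ u F) (hψ : IsDissipation ψ)
    {t : ℝ} (ht : t ∈ Icc 0 T) {ε M ω C : ℝ≥0}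
    (hω : ∫⁻ r in Ioc 0 T, (if (M : ℝ≥0∞) < (S.power r (u r) (F r)).toENNReal then
      (S.power r (u r) (F r)).toENNReal else 0) ≤ ω)
    (hC : ∫⁻ r in Ioc 0 T, dual ψ (F r) ≤ C) :
    ∫⁻ r in Ioc 0 t, truncPot ε M (dual ψ (F r)) (S.power r (u r) (F r)) ≠ ∞ ∧
    (S.energy t (u t)).toReal + (∫⁻ r in Ioc 0 t, velDiss S.dist ψ u r).toReal +
      (∫⁻ r in Ioc 0 t, truncPot ε M (dual ψ (F r)) (S.power r (u r) (F r))).toReal ≤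
    (S.energy 0 (u 0)).toReal + (ε * C + M * t + ω) := by
  have hT : 0 ≤ T := ht.1.trans ht.2
  have hsub : Ioc 0 t ⊆ Ioc 0 T := Ioc_subset_Ioc_right ht.2
  obtain ⟨h1, h2, h3, h4, h5, h6, h7⟩ := hED.real_ineq hψ ht
  have hpm := aemeasurable_Ioc_of_Icc ht.2 (hED.aemeasurable_power hψ hT)
  have hPp : AEMeasurable (fun r => (S.power r (u r) (F r)).toENNReal)
      (volume.restrict (Ioc 0 t)) :=
    EReal.continuous_toENNReal.measurable.comp_aemeasurable hpm
  have hPn : AEMeasurable (fun r => (-S.power r (u r) (F r)).toENNReal)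
      (volume.restrict (Ioc 0 t)) :=
    EReal.continuous_toENNReal.measurable.comp_aemeasurable hpm.neg
  have hDm : AEMeasurable (fun r => dual ψ (F r)) (volume.restrict (Ioc 0 t)) :=
    (measurable_dual ψ).comp_aemeasurable (aemeasurable_Ioc_of_Icc ht.2 hED.meas)
  set D := ∫⁻ r in Ioc 0 t, dual ψ (F r) with hD
  set Pp := ∫⁻ r in Ioc 0 t, (S.power r (u r) (F r)).toENNReal with hPpd
  set Pn := ∫⁻ r in Ioc 0 t, (-S.power r (u r) (F r)).toENNReal with hPnd
  set K := ∫⁻ r in Ioc 0 t, truncPot ε M (dual ψ (F r)) (S.power r (u r) (F r)) with hK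
  have hDC : D ≤ C := (lintegral_mono_set hsub).trans hC
  have key : K + Pp ≤ (1 + ε) * D + Pn + M * ENNReal.ofReal t + ω := by
    calc K + Pp = ∫⁻ r in Ioc 0 t, (truncPot ε M (dual ψ (F r)) (S.power r (u r) (F r)) +
          (S.power r (u r) (F r)).toENNReal) := (lintegral_add_right' _ hPp).symm
      _ ≤ ∫⁻ r in Ioc 0 t, ((1 + ε) * dual ψ (F r) + (-S.power r (u r) (F r)).toENNReal + M +
          (if (M : ℝ≥0∞) < (S.power r (u r) (F r)).toENNReal then
            (S.power r (u r) (F r)).toENNReal else 0)) := lintegral_mono fun r => truncPot_add_le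
      _ = (1 + ε) * D + Pn + M * ENNReal.ofReal t +
          ∫⁻ r in Ioc 0 t, (if (M : ℝ≥0∞) < (S.power r (u r) (F r)).toENNReal then
            (S.power r (u r) (F r)).toENNReal else 0) := by
          have hm : AEMeasurable (fun r => (1 + (ε : ℝ≥0∞)) * dual ψ (F r) +
              (-S.power r (u r) (F r)).toENNReal + (M : ℝ≥0∞)) (volume.restrict (Ioc 0 t)) :=
            ((hDm.const_mul _).add hPn).add aemeasurable_const
          rw [lintegral_add_left' hm, lintegral_add_right' _ aemeasurable_const, lintegral_add_right' _ hPn,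
            lintegral_const_mul'' _ hDm]
          simp [hPnd, hD]
      _ ≤ _ := by
          gcongr
          exact (lintegral_mono_set hsub).trans hω
  have hfin : (1 + ε) * D + Pn + M * ENNReal.ofReal t + ω ≠ ∞ := by finiteness
  have hKP := ne_top_of_le_ne_top hfin key
  obtain ⟨hKf, -⟩ := ENNReal.add_ne_top.1 hKP
  refine ⟨hKf, ?_⟩
  have hr := ENNReal.toReal_mono hfin key
  rw [ENNReal.toReal_add hKf h5, ENNReal.toReal_add (by finiteness) (by finiteness),
    ENNReal.toReal_add (by finiteness) (by finiteness),
    ENNReal.toReal_add (by finiteness) (by finiteness), ENNReal.toReal_mul, ENNReal.toReal_mul,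
    ENNReal.toReal_add (by finiteness) (by finiteness), ENNReal.toReal_ofReal ht.1] at hr
  simp only [ENNReal.toReal_one, ENNReal.coe_toReal] at hr
  have hDr : D.toReal ≤ C := by simpa using ENNReal.toReal_mono ENNReal.coe_ne_top hDC
  have hε : (0 : ℝ) ≤ ε := ε.2
  nlinarith

/-- A priori bounds. -/
theorem SatisfiesED.apriori (hED : SatisfiesED S ψ u F) (hψ : IsDissipation ψ) (hT : 0 ≤ T)
    {a b c : ℝ≥0} {E₀ Λ : ℝ} (hsup : ∀ v, 2 * a * v ≤ ψ v + c)
    (hE₀ : (S.energy 0 (u 0)).toReal ≤ E₀) (hΛ0 : 0 ≤ Λ)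
    (hΛ : ∫⁻ r in Ioc 0 T, (S.power r (u r) (F r)).toENNReal ≤ ENNReal.ofReal Λ)
    (hC1 : ∀ t ∈ Icc 0 T, 0 ≤ S.energy t (u t) +
      (((a : ℝ≥0∞) * S.dist (u t) (u 0) : ℝ≥0∞) : EReal) + ((b : ℝ) : EReal)) :
    ∫⁻ r in Ioc 0 T, velDiss S.dist ψ u r ≤ ENNReal.ofReal (2 * (E₀ + Λ + b + c * T)) ∧
    ∫⁻ r in Ioc 0 T, dual ψ (F r) ≤ ENNReal.ofReal (2 * (E₀ + Λ + b + c * T)) ∧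
    ∀ t ∈ Icc 0 T, S.energy t (u t) +
      (((a : ℝ≥0∞) * S.dist (u t) (u 0) : ℝ≥0∞) : EReal) + ((b : ℝ) : EReal) ≤
      ((2 * (E₀ + Λ + b + c * T) : ℝ) : EReal) := by
  let _ := S.metric.toPseudoEMetricSpace
  have hu : IsAC (fun x y : X => edist x y) 0 T u := hED.ac
  have main : ∀ t ∈ Icc 0 T,
      (∫⁻ r in Ioc 0 t, velDiss S.dist ψ u r).toReal / 2 + (∫⁻ r in Ioc 0 t, dual ψ (F r)).toReal ≤
        E₀ + Λ + b + c * T ∧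
      S.energy t (u t) + (((a : ℝ≥0∞) * S.dist (u t) (u 0) : ℝ≥0∞) : EReal) + ((b : ℝ) : EReal) ≤
      ((2 * (E₀ + Λ + b + c * T) : ℝ) : EReal) := by
    intro t ht
    obtain ⟨h1, h2, h3, h4, h5, h6, h7⟩ := hED.real_ineq hψ ht
    have hsub : Ioc 0 t ⊆ Ioc 0 T := Ioc_subset_Ioc_right ht.2
    have hmono := Measure.restrict_mono hsub (le_refl (volume : Measure ℝ))
    have hΛt : (∫⁻ r in Ioc 0 t, (S.power r (u r) (F r)).toENNReal).toReal ≤ Λ := by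
      refine (ENNReal.toReal_mono ENNReal.ofReal_ne_top
        ((lintegral_mono_set hsub).trans hΛ)).trans_eq (ENNReal.toReal_ofReal hΛ0)
    have hdfin : S.dist (u t) (u 0) ≠ ∞ := hu.edist_ne_top t ht 0 ⟨le_rfl, hT⟩
    -- The factor 2 lets a·d be absorbed by half of the velocity dissipation, leaving the other half
    -- to be bounded.
    have hd : (2 * a : ℝ≥0∞) * S.dist (u t) (u 0) ≤
        (∫⁻ r in Ioc 0 t, velDiss S.dist ψ u r) + c * ENNReal.ofReal t := by
      have hd1 : S.dist (u t) (u 0) ≤ ∫⁻ r in Ioc 0 t, metricDeriv S.dist u r := by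
        have := hu.edist_le_lintegral_metricDeriv le_rfl ht.1 ht.2
        rw [edist_comm] at this
        exact this
      calc (2 * a : ℝ≥0∞) * S.dist (u t) (u 0)
          ≤ (2 * a : ℝ≥0∞) * ∫⁻ r in Ioc 0 t, metricDeriv S.dist u r := by gcongr
        _ = ∫⁻ r in Ioc 0 t, (2 * a : ℝ≥0∞) * metricDeriv S.dist u r :=
            (lintegral_const_mul' _ _ (by finiteness)).symm
        _ ≤ ∫⁻ r in Ioc 0 t, (velDiss S.dist ψ u r + c) := by
            refine lintegral_mono_ae ?_
            filter_upwards [ae_mono hmono (hu.ae_metricDeriv_ne_top hT)] with r hr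
            have := coe_superlinear_le hsup hr
            exact_mod_cast this
        _ = _ := by rw [lintegral_add_right _ measurable_const]; simp
    have hdr := ENNReal.toReal_mono (by finiteness) hd
    rw [ENNReal.toReal_add h3 (by finiteness), ENNReal.toReal_mul, ENNReal.toReal_mul,
      ENNReal.toReal_mul, ENNReal.toReal_ofReal ht.1] at hdr
    simp only [ENNReal.toReal_ofNat, ENNReal.coe_toReal] at hdr
    have hbot := S.energy_ne_bot t ht (u t)
    have hC1t := hC1 t ht
    have hcT : (c : ℝ) * t ≤ c * T := mul_le_mul_of_nonneg_left ht.2 c.2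
    have hcT0 : (0 : ℝ) ≤ c * T := mul_nonneg c.2 hT
    lift S.energy t (u t) to ℝ using ⟨h1, hbot⟩ with e
    lift S.dist (u t) (u 0) to ℝ≥0 using hdfin with δ
    have hcast : (e : EReal) + (((a : ℝ≥0∞) * (δ : ℝ≥0∞) : ℝ≥0∞) : EReal) + ((b : ℝ) : EReal)
        = ((e + a * δ + b : ℝ) : EReal) := by
      rw [← ENNReal.coe_mul, EReal.coe_nnreal_eq_coe_real]; norm_cast
    rw [hcast] at hC1t ⊢
    have hC1r : 0 ≤ e + a * δ + b := by exact_mod_cast hC1t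
    simp only [EReal.toReal_coe, ENNReal.coe_toReal] at h7 hdr
    have hn := ENNReal.toReal_nonneg (a := ∫⁻ r in Ioc 0 t, (-S.power r (u r) (F r)).toENNReal)
    have hA := ENNReal.toReal_nonneg (a := ∫⁻ r in Ioc 0 t, velDiss S.dist ψ u r)
    have hD := ENNReal.toReal_nonneg (a := ∫⁻ r in Ioc 0 t, dual ψ (F r))
    have hb : (0 : ℝ) ≤ b := b.2
    refine ⟨by linarith, ?_⟩
    rw [EReal.coe_le_coe_iff]
    linarith
  obtain ⟨h1, h2, h3, h4, h5, h6, h7⟩ := hED.real_ineq hψ (right_mem_Icc.2 hT)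
  have hTm := (main T (right_mem_Icc.2 hT)).1
  have hA := ENNReal.toReal_nonneg (a := ∫⁻ r in Ioc 0 T, velDiss S.dist ψ u r)
  have hD := ENNReal.toReal_nonneg (a := ∫⁻ r in Ioc 0 T, dual ψ (F r))
  refine ⟨?_, ?_, fun t ht => (main t ht).2⟩
  · rw [← ENNReal.ofReal_toReal h3]; exact ENNReal.ofReal_le_ofReal (by linarith)
  · rw [← ENNReal.ofReal_toReal h4]; exact ENNReal.ofReal_le_ofReal (by linarith)

end ED

/-! ### Converging curves with uniformly bounded dissipation -/

/-- Curves satisfying energy-dissipation inequalities, with uniform bounds along `H`, that converge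
pointwise. -/
structure BoundedLimit {X : Type*} [TopologicalSpace X] {T : ℝ} (Sh : ℕ → EvolutionSystem T X)
    (S : EvolutionSystem T X) (ψh : ℕ → ℝ≥0 → ℝ≥0) (ψ : ℝ≥0 → ℝ≥0) (ub : ℕ → X) (a b : ℝ≥0)
    (H : Set ℕ) (uh : ℕ → ℝ → X) (Fh : ℕ → ℝ → ℝ≥0∞) (u : ℝ → X) (C : ℝ≥0) : Prop where
  time_nonneg : 0 ≤ T
  dissip_approx : ∀ h, IsDissipation (ψh h)
  dissip : IsDissipation ψ
  dissip_lim : ∀ v : ℝ≥0, Tendsto (fun h => ψh h v) atTop (𝓝 (ψ v))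
  superlinear : IsSuperlinear ψ
  dist_liminf : DistLiminf Sh S ub a b
  energy_liminf : EnergyLiminf Sh S ub a b
  slope_power : SlopePowerLimit Sh S ub a b
  infinite : H.Infinite
  ed : ∀ h ∈ H, SatisfiesED (Sh h) (ψh h) (uh h) (Fh h)
  tendsto : ∀ t ∈ Icc 0 T, Tendsto (fun h => uh h t) (along H) (𝓝 (u t))
  vel_le : ∀ h ∈ H, ∫⁻ r in Ioc 0 T, velDiss (Sh h).dist (ψh h) (uh h) r ≤ C
  dual_le : ∀ h ∈ H, ∫⁻ r in Ioc 0 T, dual (ψh h) (Fh h r) ≤ C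
  mod_le : ∀ h ∈ H, ∀ t ∈ Icc 0 T, modEnergy Sh ub a b h t (uh h t) ≤ ((C : ℝ) : EReal)
  energy_zero_ne_top : S.energy 0 (u 0) ≠ ⊤
  energy_zero : Tendsto (fun h => ((Sh h).energy 0 (uh h 0)).toReal) (along H)
    (𝓝 (S.energy 0 (u 0)).toReal)

namespace BoundedLimit

variable {X : Type*} [TopologicalSpace X] {T : ℝ} {Sh : ℕ → EvolutionSystem T X}
  {S : EvolutionSystem T X} {ψh : ℕ → ℝ≥0 → ℝ≥0} {ψ : ℝ≥0 → ℝ≥0} {ub : ℕ → X} {a b : ℝ≥0}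
  {H : Set ℕ} {uh : ℕ → ℝ → X} {Fh : ℕ → ℝ → ℝ≥0∞} {u : ℝ → X} {C : ℝ≥0}

theorem dist_le_liminf (B : BoundedLimit Sh S ψh ψ ub a b H uh Fh u C) {s t : ℝ}
    (hs : s ∈ Icc 0 T) (ht : t ∈ Icc 0 T) {H' : Set ℕ} (hH' : H' ⊆ H) (hi : H'.Infinite) :
    S.dist (u s) (u t) ≤ liminf (fun h => (Sh h).dist (uh h s) (uh h t)) (along H') :=
  B.dist_liminf H' (fun _ => s) (fun _ => t) _ _ s t _ _ hi (fun _ _ => hs) (fun _ _ => ht)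
    ⟨C, fun h hh => B.mod_le h (hH' hh) s hs⟩ ⟨C, fun h hh => B.mod_le h (hH' hh) t ht⟩
    tendsto_const_nhds ((B.tendsto s hs).mono_left (along_mono hH'))
    tendsto_const_nhds ((B.tendsto t ht).mono_left (along_mono hH'))

open AbsolutelyContinuousOnInterval in
-- The constant c is uniform in large h, so the increment estimate survives the lower limit of
-- finitely many distances.
theorem sum_dist_le (B : BoundedLimit Sh S ψh ψ ub a b H uh Fh u C) (M : ℝ≥0) :
    ∃ c : ℝ≥0, ∀ E ∈ disjWithin 0 T,
      M * ∑ i ∈ Finset.range E.1, S.dist (u (E.2 i).1) (u (E.2 i).2) ≤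
      C + c * ENNReal.ofReal (∑ i ∈ Finset.range E.1, dist (E.2 i).1 (E.2 i).2) := by
  obtain ⟨c, hc⟩ := exists_superlinear_bound B.dissip_approx B.dissip_lim B.superlinear M
  refine ⟨c, fun E hE => ?_⟩
  rcases eq_or_ne M 0 with rfl | hM
  · simp
  have hne := along_neBot B.infinite
  have hmem : ∀ i ∈ Finset.range E.1, (E.2 i).1 ∈ Icc 0 T ∧ (E.2 i).2 ∈ Icc 0 T := by
    intro i hi; have := hE.1 i hi; rwa [uIcc_of_le B.time_nonneg] at this
  have hsum : ∀ I : Finset ℕ, (∀ i ∈ I, (E.2 i).1 ∈ Icc 0 T ∧ (E.2 i).2 ∈ Icc 0 T) →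
      ∑ i ∈ I, S.dist (u (E.2 i).1) (u (E.2 i).2) ≤
      liminf (fun h => ∑ i ∈ I, (Sh h).dist (uh h (E.2 i).1) (uh h (E.2 i).2)) (along H) := by
    intro I
    induction I using Finset.induction_on with
    | empty => simp
    | insert i I hi ih =>
      intro hm
      simp only [Finset.sum_insert hi]
      refine le_trans (add_le_add ?_ (ih fun j hj => hm j (Finset.mem_insert_of_mem hj)))
        (liminf_add_liminf_le _ _)
      obtain ⟨m1, m2⟩ := hm i (Finset.mem_insert_self _ _)
      exact B.dist_le_liminf m1 m2 le_rfl B.infinite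
  refine (mul_le_mul_right (hsum _ hmem) _).trans ?_
  rw [← ENNReal.liminf_const_mul_of_ne_zero_of_ne_top (by exact_mod_cast hM) ENNReal.coe_ne_top]
  refine liminf_le_of_frequently_le' (Eventually.frequently ?_)
  filter_upwards [mem_along_self H, hc.filter_mono (along_le_atTop H)] with h hh hch
  have := @IsAC.sum_edist_le X (Sh h).metric.toPseudoEMetricSpace _ T B.time_nonneg (uh h)
    (B.ed h hh).ac M c hch E hE
  exact this.trans (add_le_add_left (B.vel_le h hh) _)

theorem distances_absolutelyContinuous (B : BoundedLimit Sh S ψh ψ ub a b H uh Fh u C) :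
    (∀ s ∈ Icc 0 T, ∀ t ∈ Icc 0 T, S.dist (u s) (u t) ≠ ∞) ∧
    ∀ s ∈ Icc 0 T,
      AbsolutelyContinuousOnInterval (fun t => (S.dist (u s) (u t)).toReal) 0 T :=
  @absolutelyContinuous_edist_of_sum_le X S.metric.toPseudoEMetricSpace T B.time_nonneg u C
    B.sum_dist_le

theorem lintegral_lscExt_lowerDeriv_le (B : BoundedLimit Sh S ψh ψ ub a b H uh Fh u C) {t : ℝ}
    (ht : t ∈ Icc 0 T) {H' : Set ℕ} (hH' : H' ⊆ H) (hi : H'.Infinite) :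
    ∫⁻ r in Ioc 0 t,
      lscExt ψ (@lowerDeriv X S.metric.toPseudoEMetricSpace 0 T u r) ≤
    liminf (fun h => ∫⁻ r in Ioc 0 t, velDiss (Sh h).dist (ψh h) (uh h) r) (along H') := by
  have hlim : ∀ v : ℝ≥0, Tendsto (fun h => ψh h v) (along H') (𝓝 (ψ v)) :=
    fun v => (B.dissip_lim v).mono_left (along_le_atTop _)
  obtain ⟨hfin, hac⟩ := B.distances_absolutelyContinuous
  have hcont := @continuousOn_of_absolutelyContinuous_edist X S.metric.toPseudoEMetricSpace
    0 T u hfin hac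
  refine lintegral_lscExt_le_liminf
    (Qh := fun h n => @diffQuot X (Sh h).metric.toPseudoEMetricSpace 0 T (uh h) (step n))
    hlim (fun n => @measurable_diffQuot X S.metric.toPseudoEMetricSpace 0 T B.time_nonneg
      u hcont (step n)) ?_ ?_ ?_
  · filter_upwards [mem_along_self H'] with h hh n
    exact @measurable_diffQuot X (Sh h).metric.toPseudoEMetricSpace 0 T B.time_nonneg
      (uh h) (@IsAC.continuousOn X (Sh h).metric.toPseudoEMetricSpace 0 T (uh h)
        (B.ed h (hH' hh)).ac) (step n)
  · intro n r hr
    have h1 := B.dist_le_liminf (clamp_mem B.time_nonneg (r + step n))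
      (clamp_mem B.time_nonneg r) hH' hi
    have hs0 : (ENNReal.ofReal (step n))⁻¹ ≠ 0 := ENNReal.inv_ne_zero.2 ENNReal.ofReal_ne_top
    have hs1 : (ENNReal.ofReal (step n))⁻¹ ≠ ∞ :=
      ENNReal.inv_ne_top.2 (by simpa using step_pos n)
    simp only [diffQuot, div_eq_mul_inv]
    rw [ENNReal.liminf_mul_const_of_ne_zero_of_ne_top hs0 hs1]
    rw [mul_comm _ (liminf _ _)]
    exact mul_le_mul_left h1 _
  · filter_upwards [mem_along_self H'] with h hh n
    exact @IsAC.lintegral_lscExt_diffQuot_le X (Sh h).metric.toPseudoEMetricSpace _ T t (uh h)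
      (B.ed h (hH' hh)).ac (B.dissip_approx h) ht.1 ht.2 _ (step_pos n)

theorem le_lscExt_add {M c : ℝ≥0} (hψ : IsDissipation ψ) (hM : ∀ v, M * v ≤ ψ v + c) (x : ℝ≥0∞) :
    M * x ≤ lscExt ψ x + c := by
  rcases eq_or_ne x ∞ with rfl | hx
  · rcases eq_or_ne M 0 with rfl | hM0
    · simp
    · refine (ENNReal.le_of_forall_nnreal_lt fun v _ => ?_)
      have h1 : (v : ℝ≥0∞) ≤ ψ (v / M) + c := by
        have := hM (v / M)
        rw [mul_div_cancel₀ _ hM0] at this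
        exact_mod_cast this
      have h2 : (ψ (v / M) : ℝ≥0∞) ≤ lscExt ψ ∞ :=
        le_iSup₂_of_le (f := fun (v : ℝ≥0) (_ : (v : ℝ≥0∞) < ∞) => (ψ v : ℝ≥0∞)) (v / M)
          ENNReal.coe_lt_top le_rfl
      exact h1.trans (add_le_add_left h2 _)
  · refine (coe_superlinear_le hM hx).trans (add_le_add_left ?_ _)
    refine (hψ.le_lscExt _).trans_eq ?_
    rw [ENNReal.coe_toNNReal hx]

theorem lintegral_lowerDeriv_ne_top (B : BoundedLimit Sh S ψh ψ ub a b H uh Fh u C) :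
    ∫⁻ r in Ioc 0 T, @lowerDeriv X S.metric.toPseudoEMetricSpace 0 T u r ≠ ∞ := by
  have hT := right_mem_Icc.2 B.time_nonneg
  obtain ⟨c, hc⟩ := exists_superlinear_bound (ψh := fun _ => ψ) (fun _ => B.dissip)
    (fun _ => tendsto_const_nhds) B.superlinear 1
  obtain ⟨-, hc⟩ := hc.exists
  have hne := along_neBot B.infinite
  have h1 : ∫⁻ r in Ioc 0 T,
      lscExt ψ (@lowerDeriv X S.metric.toPseudoEMetricSpace 0 T u r) ≤ C :=
    (B.lintegral_lscExt_lowerDeriv_le hT le_rfl B.infinite).trans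
      (liminf_le_of_frequently_le' (Eventually.frequently
        ((mem_along_self H).mono fun h hh => B.vel_le h hh)))
  have h2 : ∫⁻ r in Ioc 0 T, @lowerDeriv X S.metric.toPseudoEMetricSpace 0 T u r ≤
      C + c * ENNReal.ofReal T := by
    calc ∫⁻ r in Ioc 0 T, @lowerDeriv X S.metric.toPseudoEMetricSpace 0 T u r
        ≤ ∫⁻ r in Ioc 0 T,
          (lscExt ψ (@lowerDeriv X S.metric.toPseudoEMetricSpace 0 T u r) + c) :=
          lintegral_mono fun r => by simpa using le_lscExt_add B.dissip hc _
      _ ≤ _ := by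
          rw [lintegral_add_right _ measurable_const]
          gcongr
          simp
  exact ne_top_of_le_ne_top (by finiteness) h2

theorem isAC (B : BoundedLimit Sh S ψh ψ ub a b H uh Fh u C) : IsAC S.dist 0 T u := by
  obtain ⟨hfin, hac⟩ := B.distances_absolutelyContinuous
  have hcont := @continuousOn_of_absolutelyContinuous_edist X S.metric.toPseudoEMetricSpace
    0 T u hfin hac
  refine ⟨@lowerDeriv X S.metric.toPseudoEMetricSpace 0 T u,
    (@measurable_lowerDeriv X S.metric.toPseudoEMetricSpace 0 T B.time_nonneg u
      hcont).aemeasurable, B.lintegral_lowerDeriv_ne_top, fun s t hs hst ht => ?_⟩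
  exact @edist_le_lintegral_lowerDeriv X S.metric.toPseudoEMetricSpace 0 T u hfin hac s t hs
    hst.le ht

/-- Almost everywhere the metric derivative is finite and equals `lowerDeriv`, and at finite
arguments `lscExt` dominates ψ. -/
theorem lintegral_velDiss_le (B : BoundedLimit Sh S ψh ψ ub a b H uh Fh u C) {t : ℝ}
    (ht : t ∈ Icc 0 T) {H' : Set ℕ} (hH' : H' ⊆ H) (hi : H'.Infinite) :
    ∫⁻ r in Ioc 0 t, velDiss S.dist ψ u r ≤
    liminf (fun h => ∫⁻ r in Ioc 0 t, velDiss (Sh h).dist (ψh h) (uh h) r) (along H') := by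
  refine le_trans (lintegral_mono_ae ?_) (B.lintegral_lscExt_lowerDeriv_le ht hH' hi)
  have hmono := Measure.restrict_mono (Ioc_subset_Ioc_right ht.2 : Ioc 0 t ⊆ Ioc 0 T)
    (le_refl (volume : Measure ℝ))
  have h1 := @IsAC.metricDeriv_ae_eq X S.metric.toPseudoEMetricSpace 0 T B.time_nonneg u B.isAC
  have h2 := @IsAC.ae_metricDeriv_ne_top X S.metric.toPseudoEMetricSpace 0 T B.time_nonneg u B.isAC
  filter_upwards [ae_mono hmono h1, ae_mono hmono h2] with r hr1 hr2
  rw [← hr1, velDiss]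
  refine (B.dissip.le_lscExt _).trans_eq ?_
  congr 1
  exact ENNReal.coe_toNNReal hr2

/-- The lower limit of the truncated potentials. -/
noncomputable def limPot (Sh : ℕ → EvolutionSystem T X) (ψh : ℕ → ℝ≥0 → ℝ≥0) (H : Set ℕ)
    (uh : ℕ → ℝ → X) (Fh : ℕ → ℝ → ℝ≥0∞) (ε M : ℝ≥0) (r : ℝ) : ℝ≥0∞ :=
  liminf (fun h => truncPot ε M (dual (ψh h) (Fh h r)) ((Sh h).power r (uh h r) (Fh h r)))
    (along H)

/-- Passing to H' can only raise a lower limit. Thus one potential, formed along all of H, serves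
every time and every subsequence. -/
theorem lintegral_limPot_le (B : BoundedLimit Sh S ψh ψ ub a b H uh Fh u C) {t : ℝ}
    (ht : t ∈ Icc 0 T) {H' : Set ℕ} (hH' : H' ⊆ H) (ε M : ℝ≥0) :
    ∫⁻ r in Ioc 0 t, limPot Sh ψh H uh Fh ε M r ≤
    liminf (fun h => ∫⁻ r in Ioc 0 t, truncPot ε M (dual (ψh h) (Fh h r))
      ((Sh h).power r (uh h r) (Fh h r))) (along H') := by
  refine le_trans (lintegral_mono fun r => ?_) (lintegral_liminf_le_of_eventually
    (f := fun h r => truncPot ε M (dual (ψh h) (Fh h r)) ((Sh h).power r (uh h r) (Fh h r))) ?_)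
  · exact liminf_le_liminf_of_le (along_mono hH')
  · filter_upwards [mem_along_self H'] with h hh
    exact aemeasurable_Ioc_of_Icc ht.2
      ((B.ed h (hH' hh)).aemeasurable_truncPot (B.dissip_approx h) B.time_nonneg ε M)

theorem aemeasurable_limPot (B : BoundedLimit Sh S ψh ψ ub a b H uh Fh u C) (ε M : ℝ≥0) :
    AEMeasurable (limPot Sh ψh H uh Fh ε M) (volume.restrict (Icc 0 T)) := by
  classical
  have h1 : ∀ h, AEMeasurable (fun r => if h ∈ H then truncPot ε M (dual (ψh h) (Fh h r))
      ((Sh h).power r (uh h r) (Fh h r)) else 0) (volume.restrict (Icc 0 T)) := by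
    intro h
    by_cases hh : h ∈ H
    · simpa [hh] using (B.ed h hh).aemeasurable_truncPot (B.dissip_approx h) B.time_nonneg ε M
    · simp [hh]
  choose g hgm hge using h1
  refine ⟨fun r => liminf (fun h => g h r) (along H), Measurable.liminf' hgm
    ⟨atTop_basis.inf_principal H, to_countable _⟩ fun _ => to_countable _, ?_⟩
  filter_upwards [ae_all_iff.2 hge] with r hr
  refine liminf_congr ?_
  filter_upwards [mem_along_self H] with h hh
  rw [← hr h, if_pos hh]

end BoundedLimit

/-! ### The chain rule in real form -/

/-- Young's inequality Fv ≤ ψ(v) + ψ*(F), integrated. -/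
theorem lintegral_mul_metricDeriv_le {T : ℝ} {X : Type*} {S : EvolutionSystem T X} (hT : 0 ≤ T)
    {ψ : ℝ≥0 → ℝ≥0} (hψ : IsDissipation ψ) {u : ℝ → X} (hu : IsAC S.dist 0 T u) (F : ℝ → ℝ≥0∞)
    {t : ℝ} (ht : t ≤ T) :
    ∫⁻ r in Ioc 0 t, F r * metricDeriv S.dist u r ≤
      (∫⁻ r in Ioc 0 t, velDiss S.dist ψ u r) + ∫⁻ r in Ioc 0 t, dual ψ (F r) := by
  have hsub : Ioc 0 t ⊆ Ioc 0 T := Ioc_subset_Ioc_right ht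
  rw [← lintegral_add_left' (aemeasurable_Ioc_mono ht (hu.aemeasurable_velDiss' hT hψ))]
  refine lintegral_mono_ae ?_
  have h2 : ∀ᵐ r ∂volume.restrict (Ioc 0 T), metricDeriv S.dist u r ≠ ∞ :=
    @IsAC.ae_metricDeriv_ne_top X S.metric.toPseudoEMetricSpace 0 T hT u hu
  filter_upwards [ae_mono (Measure.restrict_mono hsub le_rfl) h2] with r hr
  have := mul_le_add_dual ψ (F r) (metricDeriv S.dist u r).toNNReal
  rwa [ENNReal.coe_toNNReal hr] at this

theorem EvolutionSystem.IsUpperGradient.real_chain_rule {T : ℝ} {X : Type*}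
    {S : EvolutionSystem T X} (hS : S.IsUpperGradient) {u : ℝ → X} (hu : IsAC S.dist 0 T u)
    {F : ℝ → ℝ≥0∞} (hFm : AEMeasurable F (volume.restrict (Icc 0 T)))
    (hF : ∀ᵐ r ∂volume.restrict (Icc 0 T), S.slope r (u r) ≤ F r) {t : ℝ} (ht : t ∈ Icc 0 T)
    (h0 : S.energy 0 (u 0) ≠ ⊤) (h1 : S.energy t (u t) ≠ ⊤)
    (hneg : ∫⁻ r in Ioc 0 t, (-S.power r (u r) (F r)).toENNReal ≠ ∞)
    (hI : ∫⁻ r in Ioc 0 t, F r * metricDeriv S.dist u r ≠ ∞) :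
    ∫⁻ r in Ioc 0 t, (S.power r (u r) (F r)).toENNReal ≠ ∞ ∧
    (S.energy 0 (u 0)).toReal + (∫⁻ r in Ioc 0 t, (S.power r (u r) (F r)).toENNReal).toReal ≤
      (S.energy t (u t)).toReal + (∫⁻ r in Ioc 0 t, F r * metricDeriv S.dist u r).toReal +
      (∫⁻ r in Ioc 0 t, (-S.power r (u r) (F r)).toENNReal).toReal := by
  have hT : 0 ≤ T := ht.1.trans ht.2
  -- The upper gradient property asks for the slope bound at every time; the maximum provides it and
  -- changes F only on a null set.
  set G : ℝ → ℝ≥0∞ := fun r => max (F r) (S.slope r (u r)) with hG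
  have hsub : Icc 0 t ⊆ Icc 0 T := Icc_subset_Icc_right ht.2
  have hGF : ∀ᵐ r ∂volume.restrict (Ioc 0 t), G r = F r := by
    refine ae_mono (Measure.restrict_mono (Ioc_subset_Icc_self.trans hsub) le_rfl) ?_
    filter_upwards [hF] with r hr
    exact max_eq_left hr
  have e1 : ∫⁻ r in Ioc 0 t, (-S.power r (u r) (G r)).toENNReal =
      ∫⁻ r in Ioc 0 t, (-S.power r (u r) (F r)).toENNReal :=
    lintegral_congr_ae (hGF.mono fun r hr => by simp only [hr])
  have e2 : ∫⁻ r in Ioc 0 t, (S.power r (u r) (G r)).toENNReal =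
      ∫⁻ r in Ioc 0 t, (S.power r (u r) (F r)).toENNReal :=
    lintegral_congr_ae (hGF.mono fun r hr => by simp only [hr])
  have e3 : ∫⁻ r in Ioc 0 t, G r * metricDeriv S.dist u r =
      ∫⁻ r in Ioc 0 t, F r * metricDeriv S.dist u r :=
    lintegral_congr_ae (hGF.mono fun r hr => by simp only [hr])
  have hGm : AEMeasurable G (volume.restrict (Icc 0 t)) :=
    (hFm.max (S.aemeasurable_slope hT hu)).mono_measure (Measure.restrict_mono hsub le_rfl)
  have h := hS 0 t (fun s => s) u G (isTimeOrdered_id ht hu) hGm h0.lt_top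
    (fun s _ => le_max_right _ _) (by simpa [e1] using hneg)
  have h0b := S.energy_ne_bot 0 ⟨le_rfl, hT⟩ (u 0)
  have h1b := S.energy_ne_bot t ht (u t)
  simp only [erealIntegral, deriv_id'', EReal.coe_one, mul_one] at h
  rw [e1, e2, e3] at h
  lift S.energy 0 (u 0) to ℝ using ⟨h0, h0b⟩ with x
  lift S.energy t (u t) to ℝ using ⟨h1, h1b⟩ with y
  lift ∫⁻ r in Ioc 0 t, (-S.power r (u r) (F r)).toENNReal to ℝ≥0 using hneg with n
  lift ∫⁻ r in Ioc 0 t, F r * metricDeriv S.dist u r to ℝ≥0 using hI with i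
  have hp : ∫⁻ r in Ioc 0 t, (S.power r (u r) (F r)).toENNReal ≠ ∞ := by
    intro hp
    rw [hp, EReal.coe_ennreal_top, EReal.coe_nnreal_eq_coe_real, EReal.top_sub_coe,
      EReal.coe_add_top, EReal.coe_nnreal_eq_coe_real, ← EReal.coe_add] at h
    exact EReal.coe_ne_top _ (top_le_iff.1 h)
  refine ⟨hp, ?_⟩
  lift ∫⁻ r in Ioc 0 t, (S.power r (u r) (F r)).toENNReal to ℝ≥0 using hp with p
  rw [EReal.coe_nnreal_eq_coe_real, EReal.coe_nnreal_eq_coe_real, EReal.coe_nnreal_eq_coe_real,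
    ← EReal.coe_sub, ← EReal.coe_add, ← EReal.coe_add, EReal.coe_le_coe_iff] at h
  simp only [EReal.toReal_coe, ENNReal.coe_toReal]
  linarith

theorem dual_liminf_le (ψ : ℝ≥0 → ℝ≥0) (F : ℕ → ℝ≥0∞) :
    dual ψ (liminf F atTop) ≤ liminf (fun n => dual ψ (F n)) atTop := by
  refine iSup_le fun v => ?_
  rcases eq_or_ne v 0 with rfl | hv
  · simp
  rw [tsub_le_iff_left, mul_comm, ← ENNReal.liminf_mul_const_of_ne_zero_of_ne_top (by exact_mod_cast hv)
    ENNReal.coe_ne_top, ← liminf_const_add atTop _ _ (by isBoundedDefault) (by isBoundedDefault)]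
  exact liminf_le_liminf (Eventually.of_forall fun n => mul_le_add_dual ψ (F n) v)

/-- The excess of the positive part of the power over the level `M` is at most `ω` in mean. -/
def ExcessLe {X : Type*} {T : ℝ} (Sh : ℕ → EvolutionSystem T X) (H : Set ℕ) (uh : ℕ → ℝ → X) (Fh : ℕ → ℝ → ℝ≥0∞)
    (M ω : ℝ≥0) : Prop :=
  ∀ h ∈ H, ∫⁻ r in Ioc 0 T, (if (M : ℝ≥0∞) < ((Sh h).power r (uh h r) (Fh h r)).toENNReal then
    ((Sh h).power r (uh h r) (Fh h r)).toENNReal else 0) ≤ ω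

theorem ExcessLe.mono {X : Type*} {T : ℝ} {Sh : ℕ → EvolutionSystem T X} {H : Set ℕ}
    {uh : ℕ → ℝ → X} {Fh : ℕ → ℝ → ℝ≥0∞} {M M' ω : ℝ≥0} (h : ExcessLe Sh H uh Fh M ω) (hM : M ≤ M') :
    ExcessLe Sh H uh Fh M' ω := by
  intro k hk
  refine le_trans (lintegral_mono fun r => ?_) (h k hk)
  have hMM : (M : ℝ≥0∞) ≤ M' := by exact_mod_cast hM
  split_ifs with h1 h2
  · exact le_rfl
  · exact absurd (hMM.trans_lt h1) h2
  · exact zero_le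
  · exact le_rfl

/-! ### Limit inequality, near-minimizers and conclusion for bounded families -/

namespace BoundedLimit

variable {X : Type*} [TopologicalSpace X] {T : ℝ} {Sh : ℕ → EvolutionSystem T X}
  {S : EvolutionSystem T X} {ψh : ℕ → ℝ≥0 → ℝ≥0} {ψ : ℝ≥0 → ℝ≥0} {ub : ℕ → X} {a b : ℝ≥0}
  {H : Set ℕ} {uh : ℕ → ℝ → X} {Fh : ℕ → ℝ → ℝ≥0∞} {u : ℝ → X} {C : ℝ≥0}

theorem limPot_shift (B : BoundedLimit Sh S ψh ψ ub a b H uh Fh u C) {ε ε' M M' : ℝ≥0}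
    (hε : ε' ≤ ε) (hM : M ≤ M') (r : ℝ) :
    limPot Sh ψh H uh Fh ε' M' r + M ≤ limPot Sh ψh H uh Fh ε M r + M' := by
  have hne := along_neBot B.infinite
  rw [limPot, limPot, ← liminf_add_const _ _ _ (by isBoundedDefault) (by isBoundedDefault),
    ← liminf_add_const _ _ _ (by isBoundedDefault) (by isBoundedDefault)]
  exact liminf_le_liminf (Eventually.of_forall fun h => truncPot_shift hε hM)

/-- The limit inequality, for a frequent lower bound of the energies at time `t`. -/
theorem energy_le_of_frequently (B : BoundedLimit Sh S ψh ψ ub a b H uh Fh u C) {t : ℝ}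
    (ht : t ∈ Icc 0 T) {ε M ω : ℝ≥0} (hω : ExcessLe Sh H uh Fh M ω) {c : ℝ}
    (hc : ∃ᶠ h in along H, c ≤ ((Sh h).energy t (uh h t)).toReal) :
    ∫⁻ r in Ioc 0 t, velDiss S.dist ψ u r ≠ ∞ ∧
    ∫⁻ r in Ioc 0 t, limPot Sh ψh H uh Fh ε M r ≠ ∞ ∧
    c + (∫⁻ r in Ioc 0 t, velDiss S.dist ψ u r).toReal +
      (∫⁻ r in Ioc 0 t, limPot Sh ψh H uh Fh ε M r).toReal ≤
    (S.energy 0 (u 0)).toReal + (ε * C + M * t + ω) := by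
  -- Lower limits of the integrals are taken along these indices only, which keeps c as a lower
  -- bound for the energies.
  set H' := {h ∈ H | c ≤ ((Sh h).energy t (uh h t)).toReal} with hH'
  have hi : H'.Infinite := frequently_along.1 hc
  have hsub : H' ⊆ H := fun h hh => hh.1
  have hne := along_neBot hi
  have key : ∀ h ∈ H', _ := fun h hh => (B.ed h (hsub hh)).energy_add_truncPot_le
    (B.dissip_approx h) ht (ε := ε) (hω h (hsub hh)) (B.dual_le h (hsub hh))
  refine add_toReal_le_of_liminf (B.lintegral_velDiss_le ht hsub hi)
    (B.lintegral_limPot_le ht hsub ε M) ?_ ?_ ?_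
    ((B.energy_zero.mono_left (along_mono hsub)).add_const (ε * C + M * t + ω : ℝ))
  · filter_upwards [mem_along_self H'] with h hh
    exact ((B.ed h (hsub hh)).real_ineq (B.dissip_approx h) ht).2.2.1
  · filter_upwards [mem_along_self H'] with h hh using (key h hh).1
  · filter_upwards [mem_along_self H'] with h hh
    have h1 := (key h hh).2
    have h2 := hh.2
    linarith

theorem energy_le_liminf (B : BoundedLimit Sh S ψh ψ ub a b H uh Fh u C) {t : ℝ}
    (ht : t ∈ Icc 0 T) :
    S.energy t (u t) ≤ liminf (fun h => (Sh h).energy t (uh h t)) (along H) :=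
  B.energy_liminf H _ _ B.infinite t ht (B.tendsto t ht) ⟨C, fun h hh => B.mod_le h hh t ht⟩

theorem energy_ne_top (B : BoundedLimit Sh S ψh ψ ub a b H uh Fh u C) {t : ℝ} (ht : t ∈ Icc 0 T) :
    S.energy t (u t) ≠ ⊤ := by
  have hne := along_neBot B.infinite
  have h1 : S.energy t (u t) ≤ ((C : ℝ) : EReal) := by
    refine (B.energy_le_liminf ht).trans (liminf_le_of_frequently_le' (Eventually.frequently ?_))
    filter_upwards [mem_along_self H] with h hh
    refine le_trans ?_ (B.mod_le h hh t ht)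
    rw [modEnergy, add_assoc]
    refine le_add_of_nonneg_right (add_nonneg (EReal.coe_ennreal_nonneg _) ?_)
    exact_mod_cast b.2
  exact ne_top_of_le_ne_top (EReal.coe_ne_top _) h1

theorem eventually_lt_energy (B : BoundedLimit Sh S ψh ψ ub a b H uh Fh u C) {t : ℝ}
    (ht : t ∈ Icc 0 T) {y : EReal} (hy : y < S.energy t (u t)) :
    ∀ᶠ h in along H, y < (Sh h).energy t (uh h t) :=
  eventually_lt_of_lt_liminf (hy.trans_le (B.energy_le_liminf ht))

/-- The limit inequality with a truncated potential. -/
theorem energy_add_limPot_le (B : BoundedLimit Sh S ψh ψ ub a b H uh Fh u C) {t : ℝ}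
    (ht : t ∈ Icc 0 T) {ε M ω : ℝ≥0} (hω : ExcessLe Sh H uh Fh M ω) :
    ∫⁻ r in Ioc 0 t, velDiss S.dist ψ u r ≠ ∞ ∧
    ∫⁻ r in Ioc 0 t, limPot Sh ψh H uh Fh ε M r ≠ ∞ ∧
    (S.energy t (u t)).toReal + (∫⁻ r in Ioc 0 t, velDiss S.dist ψ u r).toReal +
      (∫⁻ r in Ioc 0 t, limPot Sh ψh H uh Fh ε M r).toReal ≤
    (S.energy 0 (u 0)).toReal + (ε * C + M * t + ω) := by
  have hne := along_neBot B.infinite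
  have h1 : ∀ c < (S.energy t (u t)).toReal,
      ∃ᶠ h in along H, c ≤ ((Sh h).energy t (uh h t)).toReal := by
    intro c hc
    have hc' : (c : EReal) < S.energy t (u t) := by
      rw [← EReal.coe_toReal (B.energy_ne_top ht) (S.energy_ne_bot t ht _)]
      exact_mod_cast hc
    refine Eventually.frequently ?_
    filter_upwards [B.eventually_lt_energy ht hc', mem_along_self H] with h hh hhH
    have htop := ((B.ed h hhH).real_ineq (B.dissip_approx h) ht).1
    rw [← EReal.coe_toReal htop ((Sh h).energy_ne_bot t ht _)] at hh
    exact_mod_cast hh.le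
  obtain ⟨h2, h3, -⟩ := B.energy_le_of_frequently ht (ε := ε) hω (h1 _ (sub_one_lt _))
  refine ⟨h2, h3, le_of_forall_pos_le_add fun δ hδ => ?_⟩
  have := (B.energy_le_of_frequently ht (ε := ε) hω (h1 _ (sub_lt_self _ hδ))).2.2
  linarith

/-- Measurable near-minimizers of the truncated potential. -/
theorem exists_near_minimizer (B : BoundedLimit Sh S ψh ψ ub a b H uh Fh u C) {ε M s : ℝ≥0}
    (hs : 0 < s) (hfin : ∫⁻ r in Ioc 0 T, limPot Sh ψh H uh Fh ε M r ≠ ∞) :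
    ∃ F : ℝ → ℝ≥0∞, Measurable F ∧ (∀ r, F r ≠ ∞) ∧
      ∀ᵐ r ∂volume.restrict (Icc 0 T), S.slope r (u r) ≤ F r ∧
        truncPot ε M (dual ψ (F r)) (S.power r (u r) (F r)) ≤
          limPot Sh ψh H uh Fh ε M r + s := by
  obtain ⟨e, he⟩ := exists_surjective_nat ℚ
  have hslope := S.aemeasurable_slope B.time_nonneg B.isAC
  have hlm := B.aemeasurable_limPot ε M
  have hpow : ∀ k, AEMeasurable (fun r => S.power r (u r) (nnq (e k)))
      (volume.restrict (Icc 0 T)) := fun k =>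
    S.power_meas (nnq (e k)) ENNReal.coe_ne_top 0 T _ u
      (isTimeOrdered_id ⟨B.time_nonneg, le_rfl⟩ B.isAC)
  have hae : ∀ᵐ r ∂volume.restrict (Icc 0 T), limPot Sh ψh H uh Fh ε M r ≠ ∞ := by
    rw [ae_restrict_Icc_iff_Ioc]
    filter_upwards [ae_lt_top' (aemeasurable_Ioc_of_Icc le_rfl hlm) hfin] with r hr using hr.ne
  -- Candidates are constants from a countable dense set, since the power is known to be measurable
  -- along curves for constant arguments.
  obtain ⟨N, hN, hNp⟩ := exists_measurable_selection (μ := volume.restrict (Icc 0 T))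
    (p := fun k r => S.slope r (u r) ≤ nnq (e k) ∧
      truncPot ε M (dual ψ (nnq (e k))) (S.power r (u r) (nnq (e k))) ≤
          limPot Sh ψh H uh Fh ε M r + s)
    (fun k => (nullMeasurableSet_le hslope aemeasurable_const).inter (nullMeasurableSet_le
      (aemeasurable_truncPot aemeasurable_const (hpow k)) (hlm.add aemeasurable_const))) (by
      filter_upwards [hae, ae_restrict_mem measurableSet_Icc] with r hr hrm
      obtain ⟨f, hf1, hf2⟩ := B.slope_power.exists_truncPot_le B.dissip_lim B.infinite hrm
        (B.tendsto r hrm) ⟨C, fun h hh => B.mod_le h hh r hrm⟩ (F := fun h => Fh h r)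
        (fun h hh => (B.ed h hh).slope_le r hrm) hr
      -- The increase of the dual is multiplied by 1 + ε in the potential, so it may be at most
      -- s/(1+ε).
      have hs' : (0 : ℝ≥0∞) < (s / (1 + ε) : ℝ≥0) := by
        have : 0 < s / (1 + ε) := by positivity
        exact_mod_cast this
      obtain ⟨g, hfg, hg⟩ := exists_gt_dual_le_add B.superlinear f hs'
      obtain ⟨q, hq1, hq2⟩ := exists_nnq_btwn (show (f : ℝ≥0∞) < g by exact_mod_cast hfg)
      obtain ⟨k, rfl⟩ := he q
      refine ⟨k, hf1.trans hq1.le, ?_⟩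
      have hgd := hg (nnq (e k)) (by exact_mod_cast hq2.le)
      calc truncPot ε M (dual ψ (nnq (e k))) (S.power r (u r) (nnq (e k)))
          ≤ truncPot ε M (dual ψ f + (s / (1 + ε) : ℝ≥0)) (S.power r (u r) f) :=
            truncPot_mono hgd (S.power_mono r hrm _ hq1.le)
        _ = truncPot ε M (dual ψ f) (S.power r (u r) f) + (1 + ε) * (s / (1 + ε) : ℝ≥0) := by
            unfold truncPot; ring
        _ ≤ limPot Sh ψh H uh Fh ε M r + s := by
            refine add_le_add hf2 ?_
            have : (1 + ε) * (s / (1 + ε)) = s := mul_div_cancel₀ _ (by positivity)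
            exact_mod_cast this.le)
  exact ⟨fun r => nnq (e (N r)),
    (measurable_from_nat (f := fun k => (nnq (e k) : ℝ≥0∞))).comp hN,
    fun r => ENNReal.coe_ne_top, hNp⟩

/-- The chain rule bounds the dual dissipation of near-minimizers. -/
theorem lintegral_dual_le (B : BoundedLimit Sh S ψh ψ ub a b H uh Fh u C)
    (hS : S.IsUpperGradient) {ε M ω s : ℝ≥0} (hε : 0 < ε) (hω : ExcessLe Sh H uh Fh M ω)
    (hωε : ω ≤ ε) (hs : (s : ℝ) * T ≤ ε) {F : ℝ → ℝ≥0∞} (hFm : Measurable F)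
    (hFfin : ∀ r, F r ≠ ∞)
    (hF : ∀ᵐ r ∂volume.restrict (Icc 0 T), S.slope r (u r) ≤ F r ∧
        truncPot ε M (dual ψ (F r)) (S.power r (u r) (F r)) ≤
          limPot Sh ψh H uh Fh ε M r + s) :
    ∫⁻ r in Ioc 0 T, dual ψ (F r) ≤ C + 2 := by
  have hTm := right_mem_Icc.2 B.time_nonneg
  obtain ⟨hA, hL, hcore⟩ := B.energy_add_limPot_le hTm (ε := ε) hω
  have hpm := aemeasurable_Ioc_of_Icc le_rfl (S.aemeasurable_power B.time_nonneg B.isAC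
    hFm.aemeasurable (Eventually.of_forall hFfin))
  have hPp : AEMeasurable (fun r => (S.power r (u r) (F r)).toENNReal)
      (volume.restrict (Ioc 0 T)) :=
    EReal.continuous_toENNReal.measurable.comp_aemeasurable hpm
  have hPn : AEMeasurable (fun r => (-S.power r (u r) (F r)).toENNReal)
      (volume.restrict (Ioc 0 T)) :=
    EReal.continuous_toENNReal.measurable.comp_aemeasurable hpm.neg
  have hDm : AEMeasurable (fun r => dual ψ (F r)) (volume.restrict (Ioc 0 T)) :=
    ((measurable_dual ψ).comp hFm).aemeasurable
  have hK : ∫⁻ r in Ioc 0 T, truncPot ε M (dual ψ (F r)) (S.power r (u r) (F r)) ≤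
      (∫⁻ r in Ioc 0 T, limPot Sh ψh H uh Fh ε M r) + s * ENNReal.ofReal T := by
    calc ∫⁻ r in Ioc 0 T, truncPot ε M (dual ψ (F r)) (S.power r (u r) (F r))
        ≤ ∫⁻ r in Ioc 0 T, (limPot Sh ψh H uh Fh ε M r + s) :=
          lintegral_mono_ae ((ae_restrict_Icc_iff_Ioc.1 hF).mono fun r hr => hr.2)
      _ = _ := by rw [lintegral_add_right _ measurable_const]; simp
  have hKfin := ne_top_of_le_ne_top (by finiteness) hK
  have hD : ∫⁻ r in Ioc 0 T, dual ψ (F r) ≠ ∞ :=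
    ne_top_of_le_ne_top hKfin (lintegral_mono fun r => le_truncPot)
  have hN : ∫⁻ r in Ioc 0 T, (-S.power r (u r) (F r)).toENNReal ≠ ∞ :=
    ne_top_of_le_ne_top hKfin (lintegral_mono fun r => le_self_add.trans le_add_self)
  have hI := lintegral_mul_metricDeriv_le B.time_nonneg B.dissip B.isAC F le_rfl
  have hIfin := ne_top_of_le_ne_top (ENNReal.add_ne_top.2 ⟨hA, hD⟩) hI
  obtain ⟨hP, hchain⟩ := hS.real_chain_rule B.isAC hFm.aemeasurable (hF.mono fun r hr => hr.1)
    hTm B.energy_zero_ne_top (B.energy_ne_top hTm) hN hIfin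
  have hlow : (1 + ε) * (∫⁻ r in Ioc 0 T, dual ψ (F r)) +
      (∫⁻ r in Ioc 0 T, (-S.power r (u r) (F r)).toENNReal) + M * ENNReal.ofReal T ≤
      (∫⁻ r in Ioc 0 T, truncPot ε M (dual ψ (F r)) (S.power r (u r) (F r))) +
      ∫⁻ r in Ioc 0 T, (S.power r (u r) (F r)).toENNReal := by
    rw [← lintegral_add_right' _ hPp]
    refine le_trans (le_of_eq ?_) (lintegral_mono fun r => truncPot_add_ge)
    rw [lintegral_add_right' _ aemeasurable_const, lintegral_add_right' _ hPn,
      lintegral_const_mul'' _ hDm]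
    simp
  have h1 := ENNReal.toReal_mono (ENNReal.add_ne_top.2 ⟨hA, hD⟩) hI
  have h2 := ENNReal.toReal_mono (by finiteness) hK
  have h3 := ENNReal.toReal_mono (ENNReal.add_ne_top.2 ⟨hKfin, hP⟩) hlow
  rw [ENNReal.toReal_add hA hD] at h1
  rw [ENNReal.toReal_add hL (by finiteness), ENNReal.toReal_mul,
    ENNReal.toReal_ofReal B.time_nonneg, ENNReal.coe_toReal] at h2
  rw [ENNReal.toReal_add (by finiteness) (by finiteness), ENNReal.toReal_add (by finiteness) hN,
    ENNReal.toReal_mul, ENNReal.toReal_mul, ENNReal.toReal_add (by finiteness) (by finiteness),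
    ENNReal.toReal_ofReal B.time_nonneg, ENNReal.toReal_add hKfin hP] at h3
  simp only [ENNReal.toReal_one, ENNReal.coe_toReal] at h3
  have hω' : (ω : ℝ) ≤ ε := by exact_mod_cast hωε
  have hε' : (0 : ℝ) < ε := by exact_mod_cast hε
  -- Energies, powers, velocity dissipation and MT cancel; what remains is ε∫ψ*(F) ≤ εC + ω + sT ≤
  -- ε(C + 2).
  have h4 : (∫⁻ r in Ioc 0 T, dual ψ (F r)).toReal ≤ C + 2 := by
    refine le_of_mul_le_mul_left ?_ hε'
    nlinarith
  have h5 : ((C : ℝ≥0∞) + 2).toReal = C + 2 := by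
    rw [ENNReal.toReal_add (by finiteness) (by finiteness)]; simp
  rw [← h5] at h4
  exact (ENNReal.toReal_le_toReal hD (by finiteness)).1 h4

/-- The limit curve is a gradient flow and the energies converge. -/
theorem isGradientFlow_and_tendsto (B : BoundedLimit Sh S ψh ψ ub a b H uh Fh u C)
    (hS : S.IsUpperGradient) (hex : ∀ ω : ℝ≥0, 0 < ω → ∃ M, ExcessLe Sh H uh Fh M ω) :
    IsGradientFlow S ψ u ∧ ∀ t ∈ Icc 0 T,
      Tendsto (fun h => (Sh h).energy t (uh h t)) (along H) (𝓝 (S.energy t (u t))) := by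
  have hT := B.time_nonneg
  set T' : ℝ≥0 := ⟨T, hT⟩ with hT'
  set ε : ℕ → ℝ≥0 := fun n => 1 / ((n : ℝ≥0) + 1) with hε
  have hε0 : ∀ n, 0 < ε n := fun n => by rw [hε]; positivity
  have hεanti : ∀ n k, n ≤ k → ε k ≤ ε n := fun n k hnk => by
    simp only [hε]; gcongr
  have hεlim : Tendsto ε atTop (𝓝 0) := by
    rw [hε]; exact tendsto_one_div_add_atTop_nhds_zero_nat
  choose M₀ hM₀ using fun n => hex (ε n) (hε0 n)
  -- Partial sums make the truncation levels nondecreasing, as `limPot_shift` requires.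
  set M : ℕ → ℝ≥0 := fun n => ∑ k ∈ Finset.range (n + 1), M₀ k with hM
  have hMex : ∀ n, ExcessLe Sh H uh Fh (M n) (ε n) := fun n =>
    (hM₀ n).mono (Finset.single_le_sum (f := M₀) (fun _ _ => zero_le)
      (Finset.mem_range.2 (Nat.lt_succ_self n)))
  have hMmono : ∀ n k, n ≤ k → M n ≤ M k := fun n k hnk =>
    Finset.sum_le_sum_of_subset (Finset.range_mono (Nat.succ_le_succ hnk))
  -- Chosen so that the accumulated selection error sT is at most ε n.
  set s : ℕ → ℝ≥0 := fun n => ε n / (T' + 1) with hs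
  have hs0 : ∀ n, 0 < s n := fun n => div_pos (hε0 n) (by positivity)
  have hsT : ∀ n, (s n : ℝ) * T ≤ ε n := by
    intro n
    have h1 : s n * T' ≤ ε n := by
      rw [hs]
      calc ε n / (T' + 1) * T' ≤ ε n / (T' + 1) * (T' + 1) := by gcongr; exact le_self_add
        _ = ε n := div_mul_cancel₀ _ (by positivity)
    exact_mod_cast h1
  have hslim : Tendsto s atTop (𝓝 0) := by
    have := hεlim.div_const (T' + 1)
    rwa [zero_div] at this
  have hTm := right_mem_Icc.2 hT
  choose F hFm hFfin hF using fun n => B.exists_near_minimizer (hs0 n)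
    (B.energy_add_limPot_le hTm (ε := ε n) (hMex n)).2.1
  have hFD : ∀ n, ∫⁻ r in Ioc 0 T, dual ψ (F n r) ≤ C + 2 := fun n =>
    B.lintegral_dual_le hS (hε0 n) (hMex n) le_rfl (hsT n) (hFm n) (hFfin n) (hF n)
  set F₀ : ℝ → ℝ≥0∞ := fun r => liminf (fun n => F n r) atTop with hF₀
  have hF₀m : Measurable F₀ := Measurable.liminf hFm
  have hD₀ : ∫⁻ r in Ioc 0 T, dual ψ (F₀ r) ≤ C + 2 := by
    calc ∫⁻ r in Ioc 0 T, dual ψ (F₀ r)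
        ≤ ∫⁻ r in Ioc 0 T, liminf (fun n => dual ψ (F n r)) atTop :=
          lintegral_mono fun r => dual_liminf_le _ _
      _ ≤ liminf (fun n => ∫⁻ r in Ioc 0 T, dual ψ (F n r)) atTop :=
          lintegral_liminf_le fun n => (measurable_dual ψ).comp (hFm n)
      _ ≤ C + 2 := liminf_le_of_frequently_le' (Frequently.of_forall hFD)
  have hD₀fin : ∫⁻ r in Ioc 0 T, dual ψ (F₀ r) ≠ ∞ :=
    ne_top_of_le_ne_top (by finiteness) hD₀
  have hF₀fin : ∀ᵐ r ∂volume.restrict (Icc 0 T), F₀ r ≠ ∞ := by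
    rw [ae_restrict_Icc_iff_Ioc]
    filter_upwards [ae_lt_top ((measurable_dual ψ).comp hF₀m) hD₀fin] with r hr
    exact ne_top_of_dual_ne_top (ψ := ψ) hr.ne
  have hslope₀ : ∀ᵐ r ∂volume.restrict (Icc 0 T), S.slope r (u r) ≤ F₀ r := by
    filter_upwards [ae_all_iff.2 hF] with r hr
    exact le_liminf_of_le (by isBoundedDefault) (Eventually.of_forall fun n => (hr n).1)
  have hpot : ∀ᵐ r ∂volume.restrict (Icc 0 T), ∀ n,
      dual ψ (F₀ r) + (-S.power r (u r) (F₀ r)).toENNReal + M n ≤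
      limPot Sh ψh H uh Fh (ε n) (M n) r + (S.power r (u r) (F₀ r)).toENNReal := by
    filter_upwards [ae_all_iff.2 hF, ae_restrict_mem measurableSet_Icc] with r hr hrm
    exact dual_add_le_of_truncPot_le (S.power_usc r hrm (u r)) (F := fun n => F n r)
      (ℓ := fun n => limPot Sh ψh H uh Fh (ε n) (M n) r) hslim
      (fun n k hnk => B.limPot_shift (hεanti n k hnk) (hMmono n k hnk) r) fun k => (hr k).2
  have hpm := S.aemeasurable_power hT B.isAC hF₀m.aemeasurable hF₀fin
  -- integrability of the negative part of the power
  have hneg : ∫⁻ r in Ioc 0 T, (-S.power r (u r) (F₀ r)).toENNReal ≠ ∞ := by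
    refine ne_top_of_le_ne_top (B.energy_add_limPot_le hTm (ε := ε 0) (hMex 0)).2.1
      (lintegral_mono_ae ?_)
    filter_upwards [ae_restrict_Icc_iff_Ioc.1 hpot] with r hr
    -- Where the power is nonnegative its negative part vanishes; elsewhere the positive part
    -- disappears from the pointwise inequality at n = 0.
    rcases le_total 0 (S.power r (u r) (F₀ r)) with h | h
    · rw [EReal.toENNReal_of_nonpos (EReal.neg_le_zero.2 h)]; exact zero_le
    · have h1 := hr 0
      rw [EReal.toENNReal_of_nonpos h, add_zero] at h1
      exact (le_add_self.trans le_self_add).trans h1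
  have hIoc : ∀ {t}, t ∈ Icc 0 T → Ioc 0 t ⊆ Ioc 0 T := fun ht => Ioc_subset_Ioc_right ht.2
  have hDt : ∀ t ∈ Icc 0 T, ∫⁻ r in Ioc 0 t, dual ψ (F₀ r) ≠ ∞ := fun t ht =>
    ne_top_of_le_ne_top hD₀fin (lintegral_mono_set (hIoc ht))
  have hNt : ∀ t ∈ Icc 0 T, ∫⁻ r in Ioc 0 t, (-S.power r (u r) (F₀ r)).toENNReal ≠ ∞ :=
    fun t ht => ne_top_of_le_ne_top hneg (lintegral_mono_set (hIoc ht))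
  have hAt : ∀ t ∈ Icc 0 T, ∫⁻ r in Ioc 0 t, velDiss S.dist ψ u r ≠ ∞ := fun t ht =>
    (B.energy_add_limPot_le ht (ε := ε 0) (hMex 0)).1
  -- the chain rule
  have hchain : ∀ t ∈ Icc 0 T,
      ∫⁻ r in Ioc 0 t, (S.power r (u r) (F₀ r)).toENNReal ≠ ∞ ∧
      (S.energy 0 (u 0)).toReal +
        (∫⁻ r in Ioc 0 t, (S.power r (u r) (F₀ r)).toENNReal).toReal ≤
      (S.energy t (u t)).toReal + (∫⁻ r in Ioc 0 t, velDiss S.dist ψ u r).toReal +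
        (∫⁻ r in Ioc 0 t, dual ψ (F₀ r)).toReal +
        (∫⁻ r in Ioc 0 t, (-S.power r (u r) (F₀ r)).toENNReal).toReal := by
    intro t ht
    have hI := lintegral_mul_metricDeriv_le hT B.dissip B.isAC F₀ ht.2
    have hsum := ENNReal.add_ne_top.2 ⟨hAt t ht, hDt t ht⟩
    obtain ⟨h1, h2⟩ := hS.real_chain_rule B.isAC hF₀m.aemeasurable hslope₀ ht
      B.energy_zero_ne_top (B.energy_ne_top ht) (hNt t ht) (ne_top_of_le_ne_top hsum hI)
    have h3 := ENNReal.toReal_mono hsum hI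
    rw [ENNReal.toReal_add (hAt t ht) (hDt t ht)] at h3
    exact ⟨h1, by linarith⟩
  -- the limit inequality
  have hlimit : ∀ t ∈ Icc 0 T, ∀ c : ℝ,
      (∃ᶠ h in along H, c ≤ ((Sh h).energy t (uh h t)).toReal) ∨ c = (S.energy t (u t)).toReal →
      c + (∫⁻ r in Ioc 0 t, velDiss S.dist ψ u r).toReal +
        (∫⁻ r in Ioc 0 t, dual ψ (F₀ r)).toReal +
        (∫⁻ r in Ioc 0 t, (-S.power r (u r) (F₀ r)).toENNReal).toReal ≤
      (S.energy 0 (u 0)).toReal +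
        (∫⁻ r in Ioc 0 t, (S.power r (u r) (F₀ r)).toENNReal).toReal := by
    intro t ht c hc
    have hpt : ∀ᵐ r ∂volume.restrict (Ioc 0 t), ∀ n,
        dual ψ (F₀ r) + (-S.power r (u r) (F₀ r)).toENNReal + M n ≤
        limPot Sh ψh H uh Fh (ε n) (M n) r + (S.power r (u r) (F₀ r)).toENNReal :=
      ae_mono (Measure.restrict_mono (hIoc ht) le_rfl) (ae_restrict_Icc_iff_Ioc.1 hpot)
    have hpmt := aemeasurable_Ioc_of_Icc ht.2 hpm
    have hPp : AEMeasurable (fun r => (S.power r (u r) (F₀ r)).toENNReal)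
        (volume.restrict (Ioc 0 t)) :=
      EReal.continuous_toENNReal.measurable.comp_aemeasurable hpmt
    have hPn : AEMeasurable (fun r => (-S.power r (u r) (F₀ r)).toENNReal)
        (volume.restrict (Ioc 0 t)) :=
      EReal.continuous_toENNReal.measurable.comp_aemeasurable hpmt.neg
    have hPfin := (hchain t ht).1
    -- The term M n * t cancels; the remaining error combines the ε n * C from the factor 1 + ε n
    -- with the truncation excess ε n.
    have hn : ∀ n, c + (∫⁻ r in Ioc 0 t, velDiss S.dist ψ u r).toReal +
        (∫⁻ r in Ioc 0 t, dual ψ (F₀ r)).toReal +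
        (∫⁻ r in Ioc 0 t, (-S.power r (u r) (F₀ r)).toENNReal).toReal ≤
        (S.energy 0 (u 0)).toReal +
        (∫⁻ r in Ioc 0 t, (S.power r (u r) (F₀ r)).toENNReal).toReal + ε n * (C + 1) := by
      intro n
      obtain ⟨hLfin, hc1⟩ : ∫⁻ r in Ioc 0 t, limPot Sh ψh H uh Fh (ε n) (M n) r ≠ ∞ ∧
          c + (∫⁻ r in Ioc 0 t, velDiss S.dist ψ u r).toReal +
          (∫⁻ r in Ioc 0 t, limPot Sh ψh H uh Fh (ε n) (M n) r).toReal ≤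
          (S.energy 0 (u 0)).toReal + (ε n * C + M n * t + ε n) := by
        rcases hc with hc | rfl
        · exact (B.energy_le_of_frequently ht (hMex n) hc).2
        · exact (B.energy_add_limPot_le ht (hMex n)).2
      have h1 : (∫⁻ r in Ioc 0 t, dual ψ (F₀ r)) +
          (∫⁻ r in Ioc 0 t, (-S.power r (u r) (F₀ r)).toENNReal) + M n * ENNReal.ofReal t ≤
          (∫⁻ r in Ioc 0 t, limPot Sh ψh H uh Fh (ε n) (M n) r) +
          ∫⁻ r in Ioc 0 t, (S.power r (u r) (F₀ r)).toENNReal := by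
        rw [← lintegral_add_right' _ hPp]
        refine le_trans (le_of_eq ?_) (lintegral_mono_ae (hpt.mono fun r hr => hr n))
        rw [lintegral_add_right' _ aemeasurable_const, lintegral_add_right' _ hPn]
        simp
      have h2 := ENNReal.toReal_mono (ENNReal.add_ne_top.2 ⟨hLfin, hPfin⟩) h1
      rw [ENNReal.toReal_add (ENNReal.add_ne_top.2 ⟨hDt t ht, hNt t ht⟩) (by finiteness),
        ENNReal.toReal_add (hDt t ht) (hNt t ht), ENNReal.toReal_mul,
        ENNReal.toReal_ofReal ht.1, ENNReal.coe_toReal, ENNReal.toReal_add hLfin hPfin] at h2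
      linarith
    have hε' : Tendsto (fun n => (ε n : ℝ) * (C + 1)) atTop (𝓝 0) := by
      have := (NNReal.tendsto_coe.2 hεlim).mul_const ((C : ℝ) + 1)
      rwa [NNReal.coe_zero, zero_mul] at this
    have hfinal := ge_of_tendsto' (hε'.const_add ((S.energy 0 (u 0)).toReal +
        (∫⁻ r in Ioc 0 t, (S.power r (u r) (F₀ r)).toENNReal).toReal)) hn
    rwa [add_zero] at hfinal
  refine ⟨⟨fun r => max (F₀ r) (S.slope r (u r)), ?_⟩, fun t ht => ?_⟩
  -- F₀ dominates the slope only almost everywhere; the maximum repairs this without changing any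
  -- integral.
  · have hGF : ∀ᵐ r ∂volume.restrict (Ioc 0 T), max (F₀ r) (S.slope r (u r)) = F₀ r := by
      filter_upwards [ae_restrict_Icc_iff_Ioc.1 hslope₀] with r hr using max_eq_left hr
    have hGFt : ∀ t ∈ Icc 0 T, ∀ᵐ r ∂volume.restrict (Ioc 0 t),
        max (F₀ r) (S.slope r (u r)) = F₀ r := fun t ht =>
      ae_mono (Measure.restrict_mono (hIoc ht) le_rfl) hGF
    refine ⟨B.isAC, B.energy_zero_ne_top.lt_top,
      hF₀m.aemeasurable.max (S.aemeasurable_slope hT B.isAC), fun t _ => le_max_right _ _, ?_, ?_⟩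
    · have e0 : ∫⁻ r in Ioc 0 T, (S.power r (u r) (max (F₀ r) (S.slope r (u r)))).toENNReal =
          ∫⁻ r in Ioc 0 T, (S.power r (u r) (F₀ r)).toENNReal :=
        lintegral_congr_ae (hGF.mono fun r hr => by simp only [hr])
      rw [e0]
      exact (hchain T hTm).1
    · intro t ht
      have e1 : ∫⁻ r in Ioc 0 t, (((ψ (metricDeriv S.dist u r).toNNReal : ℝ≥0) : ℝ≥0∞) +
          dual ψ (max (F₀ r) (S.slope r (u r)))) =
          (∫⁻ r in Ioc 0 t, velDiss S.dist ψ u r) + ∫⁻ r in Ioc 0 t, dual ψ (F₀ r) := by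
        have hm : Measurable fun r => dual ψ (F₀ r) := (measurable_dual ψ).comp hF₀m
        rw [← lintegral_add_right _ hm]
        exact lintegral_congr_ae ((hGFt t ht).mono fun r hr => by
          simp only [hr, velDiss])
      have e2 : erealIntegral 0 t (fun r => S.power r (u r) (max (F₀ r) (S.slope r (u r)))) =
          erealIntegral 0 t (fun r => S.power r (u r) (F₀ r)) := by
        unfold erealIntegral
        congr 2
        · exact lintegral_congr_ae ((hGFt t ht).mono fun r hr => by simp only [hr])
        · exact lintegral_congr_ae ((hGFt t ht).mono fun r hr => by simp only [hr])
      rw [e1, e2, erealIntegral,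
        ← EReal.coe_toReal (B.energy_ne_top ht) (S.energy_ne_bot t ht _),
        ← EReal.coe_toReal B.energy_zero_ne_top (S.energy_ne_bot 0 ⟨le_rfl, hT⟩ _)]
      refine ereal_le_of_toReal_le (ENNReal.add_ne_top.2 ⟨hAt t ht, hDt t ht⟩) (hchain t ht).1
        (hNt t ht) ?_
      rw [ENNReal.toReal_add (hAt t ht) (hDt t ht)]
      have := hlimit t ht _ (Or.inr rfl)
      linarith
  · refine tendsto_order.2 ⟨fun y hy => B.eventually_lt_energy ht hy, fun y hy => ?_⟩
    obtain ⟨c, hc1, hc2⟩ := EReal.lt_iff_exists_real_btwn.1 hy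
    have hcr : (S.energy t (u t)).toReal < c := by
      rw [← EReal.coe_toReal (B.energy_ne_top ht) (S.energy_ne_bot t ht _)] at hc1
      exact_mod_cast hc1
    -- Energies at least c infinitely often would put c in the limit inequality, contradicting the
    -- chain rule since c exceeds the limit energy.
    have hnot : ¬ ∃ᶠ h in along H, c ≤ ((Sh h).energy t (uh h t)).toReal := by
      intro hfr
      have h1 := hlimit t ht c (Or.inl hfr)
      have h2 := (hchain t ht).2
      linarith
    filter_upwards [not_frequently.1 hnot, mem_along_self H] with h hh hhH
    refine lt_trans ?_ hc2
    rw [← EReal.coe_toReal ((B.ed h hhH).real_ineq (B.dissip_approx h) ht).1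
      ((Sh h).energy_ne_bot t ht _)]
    exact_mod_cast not_le.1 hh

end BoundedLimit

end EvolSys

theorem theorem4p4 {X : Type*} [TopologicalSpace X] (T : ℝ) (hT : 0 < T)
    -- the approximating systems, the limit system, and the dissipation functions
    (Sh : ℕ → EvolutionSystem T X) (S : EvolutionSystem T X)
    (ψh : ℕ → ℝ≥0 → ℝ≥0) (ψ : ℝ≥0 → ℝ≥0)
    (hψh : ∀ h, IsDissipation (ψh h)) (hψ : IsDissipation ψ)
    (hψ_lim : ∀ v : ℝ≥0, Tendsto (fun h => ψh h v) atTop (𝓝 (ψ v)))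
    (hψ_super : IsSuperlinear ψ)
    -- the initial points
    (ub : ℕ → X) (ub₀ : X) (hub : Tendsto ub atTop (𝓝 ub₀))
    -- the assumptions on the convergence of the systems
    (a b : ℝ≥0)
    (hC1 : ModEnergyNonneg Sh ub a b)
    (hC2 : EquiCoercive Sh ub a b)
    (hC3 : DistLiminf Sh S ub a b)
    (hC4E : EnergyLiminf Sh S ub a b)
    (hC4FP : SlopePowerLimit Sh S ub a b)
    (hS : S.IsUpperGradient)
    -- the converging curves
    (H : Set ℕ) (hH : H.Infinite)
    (uh : ℕ → ℝ → X) (Fh : ℕ → ℝ → ℝ≥0∞) (u : ℝ → X)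
    (hED : ∀ h ∈ H, SatisfiesED (Sh h) (ψh h) (uh h) (Fh h))
    (hinit : ∀ h ∈ H, uh h 0 = ub h)
    (hconv : ∀ t ∈ Icc 0 T, Tendsto (fun h => uh h t) (along H) (𝓝 (u t)))
    (hE_fin : S.energy 0 ub₀ < ⊤)
    (hE_lim : Tendsto (fun h => (Sh h).energy 0 (ub h)) (along H) (𝓝 (S.energy 0 ub₀)))
    (hP : EquiIntegrable T H
      (fun h r => ((Sh h).power r (uh h r) (Fh h r)).toENNReal)) :
    IsGradientFlow S ψ u ∧
    ∀ t ∈ Icc 0 T,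
      Tendsto (fun h => (Sh h).energy t (uh h t)) (along H) (𝓝 (S.energy t (u t))) := by
  obtain ⟨Λ, hΛ⟩ := hP.exists_bound
  obtain ⟨c, hc⟩ := exists_superlinear_bound hψh hψ_lim hψ_super (2 * a)
  have h0T : (0 : ℝ) ∈ Icc 0 T := ⟨le_rfl, hT.le⟩
  have hE_real : Tendsto (fun h => ((Sh h).energy 0 (ub h)).toReal) (along H)
      (𝓝 (S.energy 0 ub₀).toReal) :=
    (EReal.tendsto_toReal hE_fin.ne (S.energy_ne_bot 0 h0T ub₀)).comp hE_lim
  have hev : ∀ᶠ h in along H, ((Sh h).energy 0 (ub h)).toReal ≤ (S.energy 0 ub₀).toReal + 1 ∧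
      ∀ v, 2 * a * v ≤ ψh h v + c :=
    ((hE_real.eventually (ge_mem_nhds (lt_add_one _)))).and (hc.filter_mono (along_le_atTop H))
  -- The uniform bounds hold only for large h; dropping the other indices leaves the limit filter
  -- unchanged.
  set H₁ := {h ∈ H | ((Sh h).energy 0 (ub h)).toReal ≤ (S.energy 0 ub₀).toReal + 1 ∧
      ∀ v, 2 * a * v ≤ ψh h v + c} with hH₁
  have hsub : H₁ ⊆ H := fun h hh => hh.1
  have hinf : H₁.Infinite := infinite_sep hH hev
  have halong : along H₁ = along H := along_sep_eq hev
  set C : ℝ≥0 := Real.toNNReal (2 * ((S.energy 0 ub₀).toReal + 1 + Λ + b + c * T)) with hC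
  have hap : ∀ h ∈ H₁, ∫⁻ r in Ioc 0 T, velDiss (Sh h).dist (ψh h) (uh h) r ≤ C ∧
      ∫⁻ r in Ioc 0 T, dual (ψh h) (Fh h r) ≤ C ∧
      ∀ t ∈ Icc 0 T, modEnergy Sh ub a b h t (uh h t) ≤ ((C : ℝ) : EReal) := by
    intro h hh
    have hi := hinit h (hsub hh)
    obtain ⟨h1, h2, h3⟩ := (hED h (hsub hh)).apriori (hψh h) hT.le (a := a) (b := b) (c := c)
      (E₀ := (S.energy 0 ub₀).toReal + 1) (Λ := Λ) hh.2.2 (by rw [hi]; exact hh.2.1) Λ.2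
      (by rw [ENNReal.ofReal_coe_nnreal]; exact hΛ h (hsub hh))
      (fun t ht => by rw [hi]; exact hC1 h t ht (uh h t))
    refine ⟨h1, h2, fun t ht => ?_⟩
    have h4 := h3 t ht
    rw [hi] at h4
    exact h4.trans (by exact_mod_cast Real.le_coe_toNNReal _)
  have hub₁ : Tendsto ub (along H₁) (𝓝 ub₀) := hub.mono_left (along_le_atTop H₁)
  have hub₂ : Tendsto ub (along H₁) (𝓝 (u 0)) := by
    refine ((halong ▸ hconv 0 h0T : Tendsto (fun h => uh h 0) (along H₁) (𝓝 (u 0)))).congr' ?_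
    filter_upwards [mem_along_self H₁] with h hh using hinit h (hsub hh)
  have hmod₀ : ∃ C : ℝ, ∀ h ∈ H₁, modEnergy Sh ub a b h 0 (ub h) ≤ (C : EReal) :=
    ⟨C, fun h hh => by
      have := (hap h hh).2.2 0 h0T
      rwa [hinit h (hsub hh)] at this⟩
  -- The topology need not be Hausdorff. The two limits of the same sequence are identified by (C3),
  -- as the distances from the sequence to itself vanish.
  have hu0 : u 0 = ub₀ := by
    have hne := along_neBot hinf
    have h1 := hC3 H₁ (fun _ => 0) (fun _ => 0) ub ub 0 0 (u 0) ub₀ hinf (fun _ _ => h0T)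
      (fun _ _ => h0T) hmod₀ hmod₀ tendsto_const_nhds hub₂ tendsto_const_nhds hub₁
    have h2 : (fun h => (Sh h).dist (ub h) (ub h)) = fun _ => 0 :=
      funext fun h => (Sh h).metric.edist_self (ub h)
    rw [h2, liminf_const] at h1
    exact S.metric.eq_of_edist_eq_zero (le_antisymm h1 zero_le)
  have B : BoundedLimit Sh S ψh ψ ub a b H₁ uh Fh u C :=
    { time_nonneg := hT.le
      dissip_approx := hψh
      dissip := hψ
      dissip_lim := hψ_lim
      superlinear := hψ_super
      dist_liminf := hC3
      energy_liminf := hC4E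
      slope_power := hC4FP
      infinite := hinf
      ed := fun h hh => hED h (hsub hh)
      tendsto := fun t ht => halong ▸ hconv t ht
      vel_le := fun h hh => (hap h hh).1
      dual_le := fun h hh => (hap h hh).2.1
      mod_le := fun h hh => (hap h hh).2.2
      energy_zero_ne_top := by rw [hu0]; exact hE_fin.ne
      energy_zero := by
        rw [hu0, halong]
        refine hE_real.congr' ?_
        filter_upwards [mem_along_self H] with h hh
        rw [hinit h hh] }
  rw [← halong]
  refine B.isGradientFlow_and_tendsto hS fun ω hω => ?_
  obtain ⟨M, hM⟩ := hP.exists_truncation (fun h hh =>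
    EReal.continuous_toENNReal.measurable.comp_aemeasurable
      (aemeasurable_Ioc_of_Icc le_rfl ((hED h hh).aemeasurable_power (hψh h) hT.le)))
    (ω := (ω : ℝ≥0∞)) (by exact_mod_cast hω)
  exact ⟨M, fun h hh => hM h (hsub hh)⟩
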